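/- Let $\Bbbk$ be a field of characteristic $0$. Operads are symmetric $\Bbbk$-linear operads $\mathcal P=\{\mathcal P(n)\}_n$ concentrated in degree $0$, with right actions of the symmetric groups $\Sigma_n$ and partial compositions $\circ_i:\mathcal P(m)\otimes\mathcal P(n)\to\mathcal P(m+n-1)$. **Multifiltrations.** For $\vec a\in\mathbb Z^m$, $\vec b\in\mathbb Z^n$ put $$\vec a\circ_i\vec b=(a_1,\dots,a_{i-1},b_1+a_i,\dots,b_n+a_i,a_{i+1},\dots,a_m),$$ $$[\vec a,\vec b]_{ij}=(\vec b_L+a_i,\ \vec a_L+b_j,\ a_i+b_j-1,\ \vec b_R+a_i,\ \vec a_R+b_j),$$ where $\vec a=(\vec a_L,a_i,\vec a_R)$ and $\vec b=(\vec b_L,b_j,\vec b_R)$. For $a\in\mathcal P(m)$, $b\in\mathcal P(n)$ let $$[a,b]_{ij}=(a\circ_i b)\cdot\sigma'-(b\circ_j a)\cdot\sigma'',$$ where $\sigma',\sigma''$ are the permutations that put the inputs of both terms in the following order: the inputs of $b$ before the $j$-th, those of $a$ before the $i$-th, the common input, the inputs of $b$ after the $j$-th, those of $a$ after the $i$-th.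 A *multifiltration* of $\mathcal P$ is a family of subspaces $F_{\vec p}\mathcal P(n)\subseteq\mathcal P(n)$, $\vec p\in\mathbb Z^n$, such that * $F_{\vec p}\mathcal P(n)\subseteq F_{\vec q}\mathcal P(n)$ whenever $\vec p\le\vec q$ componentwise; * $F_{\vec p}\mathcal P(n)\cdot\sigma=F_{\vec p\cdot\sigma}\mathcal P(n)$ for $\sigma\in\Sigma_n$, where $\vec p\cdot\sigma=(p_{\sigma(1)},\dots,p_{\sigma(n)})$; * $F_{\vec a}\mathcal P(m)\circ_iF_{\vec b}\mathcal P(n)\subseteq F_{\vec a\circ_i\vec b}\mathcal P(m+n-1)$; * the operad unit lies in $F_{(0)}\mathcal P(1)$; * $[F_{\vec a}\mathcal P(m),F_{\vec b}\mathcal P(n)]_{ij}\subseteq F_{[\vec a,\vec b]_{ij}}\mathcal P(m+n-1)$. It is *saturated* if $F_{\vec p}\mathcal P(n)\cap F_{\vec q}\mathcal P(n)\subseteq F_{\vec p\wedge\vec q}\mathcal P(n)$, where $\wedge$ is the componentwise minimum. The *standard multifiltration* $\overline G\mathcal P$ with respect to a generating collection $E$ is the smallest saturated multifiltration with $E(n)\subseteq\overline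 G_{(1,\dots,1)}\mathcal P(n)$ for all $n$. **Tight quadratic operads.** Let $E$ be a $\Sigma$-stable collection of subspaces of $\mathcal P$ that generates $\mathcal P$, and $\mathbb F(E)\twoheadrightarrow\mathcal P$ the canonical map from the free operad. A presentation $\mathcal P=\mathbb F(E)/(R)$ is a collection $R$ of elements of $\mathbb F(E)$ which generates the kernel of this map as an operadic ideal. The operad $\mathcal P$ is *quadratic* if it has a presentation with $R$ contained in the span of the elements $(x\circ_iy)\cdot\sigma$, $x,y\in E$. It is *tight* if it has a presentation with $R(n)\subseteq\overline G_{(1,\dots,1)}\mathbb F(E)(n)$ for all $n$. It is *generated by one binary operation* if, for some nonzero $\mu\in\mathcal P(2)$, one may take for $E$ the collection with $E(2)$ the span of $\mu\cdot\Sigma_2$ and $E(n)=0$ for $n\ne2$; tightness and quadraticity then refer to this $E$. **Theorem.** (a) An operad is tight, quadratic and generated by one binary operation if and only if it is isomorphic to one of the following: 1. a free operad on one binary operation, which is antisymmetric, symmetric, or without symmetry; 2. the operad $\mathrm{Lie}$ for Lie algebras, that is, the free operad on an antisymmetric operation $[-,-]$ modulo the Jacobiator $[1,[2,3]]+[2,[3,1]]+[3,[1,2]]$;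 3. the operad $\mathrm{LieAdm}$ for Lie-admissible algebras, that is, the free operad on one binary operation without symmetry modulo $\sum_{\sigma\in\Sigma_3}\operatorname{sgn}(\sigma)\,\mathrm{Ass}\cdot\sigma$, where $\mathrm{Ass}=((1,2),3)-(1,(2,3))$. (b) For the free operad $\mathbb F$ on one binary operation, the piece $\overline G_{(1,1,1)}\mathbb F(3)$ of the standard multifiltration is * one-dimensional, spanned by the Jacobiator, if the operation is antisymmetric; * zero, if the operation is symmetric; * one-dimensional, spanned by $\sum_{\sigma\in\Sigma_3}\operatorname{sgn}(\sigma)\,\mathrm{Ass}\cdot\sigma$, if the operation has no symmetry. -/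

import Mathlib

open Equiv

universe u v w

/-! # Symmetric operads over a field, in arities `n : ℕ`

All operads are concentrated in degree `0`, so that no Koszul signs occur. -/

namespace OperadComp

/-- The inputs of a partial composition `a ∘_i b`, where `a` has `m` inputs and `b` has `n` inputs
(so that the composite has `r = m + n - 1` inputs): the inputs of `a` before `i`, then all inputs
of `b`, then the inputs of `a` after `i`. -/
def split {m n r : ℕ} (h : m + n = r + 1) (i : Fin m) :
    Fin r ≃ {x : Fin m // x ≠ i} ⊕ Fin n where
  toFun p :=
    if h₁ : p.1 < i.1 then
      .inl ⟨⟨p.1, by omega⟩, fun e => by have := congrArg Fin.val e; simp at this; omega⟩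
    else if h₂ : p.1 < i.1 + n then .inr ⟨p.1 - i.1, by omega⟩
    else .inl ⟨⟨p.1 + 1 - n, by omega⟩, fun e => by have := congrArg Fin.val e; simp at this; omega⟩
  invFun s := match s with
    | .inl x => if h₁ : x.1.1 < i.1 then ⟨x.1.1, by omega⟩ else
        ⟨x.1.1 + n - 1, by have := x.1.2; have := Fin.val_ne_of_ne x.2; omega⟩
    | .inr y => ⟨i.1 + y.1, by omega⟩
  left_inv p := by
    ext
    by_cases h₁ : p.1 < i.1
    · simp [h₁]
    · by_cases h₂ : p.1 < i.1 + n
      · simp [h₁, h₂]; omega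
      · have h₃ : ¬ (p.1 + 1 - n < i.1) := by omega
        simp [h₁, h₂, h₃]; omega
  right_inv s := by
    rcases s with ⟨⟨x, hx⟩, hxi⟩ | ⟨y, hy⟩
    · have hxi' : x ≠ i.1 := fun e => hxi (Fin.ext e)
      by_cases h₁ : x < i.1
      · simp [h₁]
      · have h₂ : ¬ (x + n - 1 < i.1) := by omega
        have h₃ : ¬ (x + n - 1 < i.1 + n) := by omega
        simp [h₁, h₂, h₃]; omega
    · simp [hy]

/-- The permutation `σ ∘_i τ` of the inputs of a composite, which satisfies
`(a · σ) ∘_i (b · τ) = (a ∘_{σ i} b) · (σ ∘_i τ)`. -/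
def perm {m n r : ℕ} (h : m + n = r + 1) (i : Fin m) (σ : Perm (Fin m)) (τ : Perm (Fin n)) :
    Perm (Fin r) :=
  ((split h i).trans (Equiv.sumCongr
    (σ.subtypeEquiv (fun x => by simp : ∀ x : Fin m, x ≠ i ↔ σ x ≠ σ i)) τ)).trans
    (split h (σ i)).symm

/-- The permutation of `r` symbols that exchanges the `p` symbols which follow the first `o` ones
with the next `q` symbols, and leaves the others unchanged: for a word `w`, the word `w ∘ σ` is
obtained from `w` by this exchange. -/
def blockSwap (r o p q : ℕ) (h : o + p + q ≤ r) : Perm (Fin r) where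
  toFun x :=
    if x.1 < o then x
    else if h₂ : x.1 < o + q then ⟨x.1 + p, by omega⟩
    else if h₃ : x.1 < o + q + p then ⟨x.1 - q, by omega⟩
    else x
  invFun x :=
    if x.1 < o then x
    else if h₂ : x.1 < o + p then ⟨x.1 + q, by omega⟩
    else if h₃ : x.1 < o + p + q then ⟨x.1 - p, by omega⟩
    else x
  left_inv x := by
    rcases x with ⟨x, hx⟩
    ext
    by_cases h₁ : x < o
    · simp [h₁]
    · by_cases h₂ : x < o + q
      · have h₃ : ¬ (x + p < o) := by omega
        have h₄ : ¬ (x + p < o + p) := by omega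
        have h₅ : x + p < o + p + q := by omega
        simp only [h₁, h₂, h₃, h₄, h₅, if_false, dif_pos, dif_neg, not_false_eq_true]
        omega
      · by_cases h₃ : x < o + q + p
        · have h₄ : ¬ (x - q < o) := by omega
          have h₅ : x - q < o + p := by omega
          simp only [h₁, h₂, h₃, h₄, h₅, if_false, dif_pos, dif_neg, not_false_eq_true]
          omega
        · have h₄ : ¬ (x < o + p) := by omega
          have h₅ : ¬ (x < o + p + q) := by omega
          simp only [h₁, h₂, h₃, h₄, h₅, if_false, dif_neg, not_false_eq_true]
  right_inv x := by
    rcases x with ⟨x, hx⟩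
    ext
    by_cases h₁ : x < o
    · simp [h₁]
    · by_cases h₂ : x < o + p
      · have h₃ : ¬ (x + q < o) := by omega
        have h₄ : ¬ (x + q < o + q) := by omega
        have h₅ : x + q < o + q + p := by omega
        simp only [h₁, h₂, h₃, h₄, h₅, if_false, dif_pos, dif_neg, not_false_eq_true]
        omega
      · by_cases h₃ : x < o + p + q
        · have h₄ : ¬ (x - p < o) := by omega
          have h₅ : x - p < o + q := by omega
          simp only [h₁, h₂, h₃, h₄, h₅, if_false, dif_pos, dif_neg, not_false_eq_true]
          omega
        · have h₄ : ¬ (x < o + q) := by omega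
          have h₅ : ¬ (x < o + q + p) := by omega
          simp only [h₁, h₂, h₃, h₄, h₅, if_false, dif_neg, not_false_eq_true]

end OperadComp

/-- A `Σ`-module: vector spaces `E(n)` with a right linear action of the symmetric groups,
`act σ x = x · σ`. -/
structure SigmaModule (k : Type u) [Field k] where
  carrier : ℕ → Type v
  [acg : ∀ n, AddCommGroup (carrier n)]
  [mod : ∀ n, Module k (carrier n)]
  act : ∀ {n : ℕ}, Perm (Fin n) → carrier n →ₗ[k] carrier n
  act_one : ∀ {n : ℕ} (x : carrier n), act 1 x = x
  act_mul : ∀ {n : ℕ} (σ τ : Perm (Fin n)) (x : carrier n), act (σ * τ) x = act τ (act σ x)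

attribute [instance] SigmaModule.acg SigmaModule.mod

/-- A `k`-linear symmetric operad. `comp h i a b` is the partial composition `a ∘_i b` of
`a ∈ P(m)` and `b ∈ P(n)`, which lies in `P(r)` for `r = m + n - 1`. Inputs are numbered from `0`. -/
structure LinOperad (k : Type u) [Field k] extends SigmaModule.{u, v} k where
  one : carrier 1
  comp : ∀ {m n r : ℕ}, m + n = r + 1 → Fin m → carrier m →ₗ[k] carrier n →ₗ[k] carrier r
  one_comp : ∀ {n : ℕ} (h : 1 + n = n + 1) (b : carrier n), comp h 0 one b = b
  comp_one : ∀ {m : ℕ} (i : Fin m) (a : carrier m), comp rfl i a one = a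
  /-- Sequential associativity, `(a ∘_i b) ∘_{i + j} c = a ∘_i (b ∘_j c)`. -/
  comp_seq : ∀ {m n l r s t : ℕ} (h₁ : m + n = r + 1) (h₂ : r + l = s + 1) (h₃ : n + l = t + 1)
    (h₄ : m + t = s + 1) (i : Fin m) (j : Fin n) (a : carrier m) (b : carrier n) (c : carrier l),
    comp h₂ ⟨i.1 + j.1, by omega⟩ (comp h₁ i a b) c = comp h₄ i a (comp h₃ j b c)
  /-- Parallel associativity, `(a ∘_i b) ∘_{i' + n - 1} c = (a ∘_{i'} c) ∘_i b` for `i < i'`. -/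
  comp_par : ∀ {m n l r s t : ℕ} (h₁ : m + n = r + 1) (h₂ : r + l = s + 1) (h₃ : m + l = t + 1)
    (h₄ : t + n = s + 1) (i i' : Fin m) (hi : i.1 < i'.1) (a : carrier m) (b : carrier n)
    (c : carrier l),
    comp h₂ ⟨i'.1 + n - 1, by omega⟩ (comp h₁ i a b) c =
      comp h₄ ⟨i.1, by omega⟩ (comp h₃ i' a c) b
  comp_act : ∀ {m n r : ℕ} (h : m + n = r + 1) (i : Fin m) (σ : Perm (Fin m)) (τ : Perm (Fin n))
    (a : carrier m) (b : carrier n),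
    comp h i (act σ a) (act τ b) = act (OperadComp.perm h i σ τ) (comp h (σ i) a b)

namespace LinOperad

variable {k : Type u} [Field k]

/-- Morphisms of operads. -/
structure Hom (P : LinOperad.{u, v} k) (Q : LinOperad.{u, w} k) where
  app : ∀ n : ℕ, P.carrier n →ₗ[k] Q.carrier n
  map_one : app 1 P.one = Q.one
  map_act : ∀ {n : ℕ} (σ : Perm (Fin n)) (a : P.carrier n), app n (P.act σ a) = Q.act σ (app n a)
  map_comp : ∀ {m n r : ℕ} (h : m + n = r + 1) (i : Fin m) (a : P.carrier m) (b : P.carrier n),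
    app r (P.comp h i a b) = Q.comp h i (app m a) (app n b)

/-- Two operads are isomorphic. -/
def Isomorphic (P : LinOperad.{u, v} k) (Q : LinOperad.{u, w} k) : Prop :=
  ∃ φ : Hom P Q, ∀ n, Function.Bijective (φ.app n)

/-! ### Operadic ideals and quotients -/

/-- Operadic (two-sided, `Σ`-stable) ideals. -/
structure OpIdeal (P : LinOperad.{u, v} k) where
  sub : ∀ n : ℕ, Submodule k (P.carrier n)
  act_mem : ∀ {n : ℕ} (σ : Perm (Fin n)) {a : P.carrier n}, a ∈ sub n → P.act σ a ∈ sub n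
  comp_mem_left : ∀ {m n r : ℕ} (h : m + n = r + 1) (i : Fin m) {a : P.carrier m}
    (b : P.carrier n), a ∈ sub m → P.comp h i a b ∈ sub r
  comp_mem_right : ∀ {m n r : ℕ} (h : m + n = r + 1) (i : Fin m) (a : P.carrier m)
    {b : P.carrier n}, b ∈ sub n → P.comp h i a b ∈ sub r

/-- The operadic ideal `(R)` generated by a collection `R` of elements: the intersection of all
ideals that contain `R`. -/
def idealSpan (P : LinOperad.{u, v} k) (R : ∀ n, Set (P.carrier n)) : OpIdeal P where
  sub n := ⨅ (I : OpIdeal P) (_ : ∀ m, R m ⊆ I.sub m), I.sub n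
  act_mem σ a ha := by
    simp only [Submodule.mem_iInf] at ha ⊢
    exact fun I hI => I.act_mem σ (ha I hI)
  comp_mem_left h i a b ha := by
    simp only [Submodule.mem_iInf] at ha ⊢
    exact fun I hI => I.comp_mem_left h i b (ha I hI)
  comp_mem_right h i a b hb := by
    simp only [Submodule.mem_iInf] at hb ⊢
    exact fun I hI => I.comp_mem_right h i a (hb I hI)

/-- The quotient operad `P / I`. -/
def quotient (P : LinOperad.{u, v} k) (I : OpIdeal P) : LinOperad.{u, v} k where
  carrier n := P.carrier n ⧸ I.sub n
  act {n} σ := (I.sub n).mapQ (I.sub n) (P.act σ) fun _ ha => I.act_mem σ ha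
  act_one x := by
    obtain ⟨a, rfl⟩ := Submodule.Quotient.mk_surjective _ x
    simp [P.act_one]
  act_mul σ τ x := by
    obtain ⟨a, rfl⟩ := Submodule.Quotient.mk_surjective _ x
    simp [P.act_mul]
  one := Submodule.Quotient.mk P.one
  comp {m n r} h i := (I.sub m).liftQ
    (((I.sub n).liftQ (((P.comp h i).compr₂ (I.sub r).mkQ).flip) (by
      intro b hb
      ext a
      simpa using I.comp_mem_right h i a hb)).flip) (by
      intro a ha
      ext b
      exact (Submodule.Quotient.mk_eq_zero _).2 (I.comp_mem_left h i b ha))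
  one_comp h b := by
    obtain ⟨b, rfl⟩ := Submodule.Quotient.mk_surjective _ b
    exact congrArg Submodule.Quotient.mk (P.one_comp h b)
  comp_one i a := by
    obtain ⟨a, rfl⟩ := Submodule.Quotient.mk_surjective _ a
    exact congrArg Submodule.Quotient.mk (P.comp_one i a)
  comp_seq h₁ h₂ h₃ h₄ i j a b c := by
    obtain ⟨a, rfl⟩ := Submodule.Quotient.mk_surjective _ a
    obtain ⟨b, rfl⟩ := Submodule.Quotient.mk_surjective _ b
    obtain ⟨c, rfl⟩ := Submodule.Quotient.mk_surjective _ c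
    exact congrArg Submodule.Quotient.mk (P.comp_seq h₁ h₂ h₃ h₄ i j a b c)
  comp_par h₁ h₂ h₃ h₄ i i' hi a b c := by
    obtain ⟨a, rfl⟩ := Submodule.Quotient.mk_surjective _ a
    obtain ⟨b, rfl⟩ := Submodule.Quotient.mk_surjective _ b
    obtain ⟨c, rfl⟩ := Submodule.Quotient.mk_surjective _ c
    exact congrArg Submodule.Quotient.mk (P.comp_par h₁ h₂ h₃ h₄ i i' hi a b c)
  comp_act h i σ τ a b := by
    obtain ⟨a, rfl⟩ := Submodule.Quotient.mk_surjective _ a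
    obtain ⟨b, rfl⟩ := Submodule.Quotient.mk_surjective _ b
    exact congrArg Submodule.Quotient.mk (P.comp_act h i σ τ a b)

end LinOperad

/-! ### The free operad on a `Σ`-module -/

namespace FreeOperad

variable {k : Type u} [Field k]

/-- Formal expressions built from the elements of `E` by the operations of a linear operad. -/
inductive Term (E : SigmaModule.{u, v} k) : ℕ → Type (max u v)
  | zero (n : ℕ) : Term E n
  | add {n : ℕ} (s t : Term E n) : Term E n
  | smul {n : ℕ} (c : k) (t : Term E n) : Term E n
  | gen {n : ℕ} (x : E.carrier n) : Term E n
  | one : Term E 1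
  | act {n : ℕ} (σ : Perm (Fin n)) (t : Term E n) : Term E n
  | comp {m n r : ℕ} (h : m + n = r + 1) (i : Fin m) (s : Term E m) (t : Term E n) : Term E r

/-- The smallest congruence on formal expressions that imposes the axioms of a linear operad and
makes `E → Term E` linear and equivariant. -/
inductive Rel (E : SigmaModule.{u, v} k) : ∀ {n : ℕ}, Term E n → Term E n → Prop
  | refl {n : ℕ} (t : Term E n) : Rel E t t
  | symm {n : ℕ} {s t : Term E n} : Rel E s t → Rel E t s
  | trans {n : ℕ} {s t t' : Term E n} : Rel E s t → Rel E t t' → Rel E s t'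
  | add_congr {n : ℕ} {s s' t t' : Term E n} :
      Rel E s s' → Rel E t t' → Rel E (.add s t) (.add s' t')
  | smul_congr {n : ℕ} (c : k) {t t' : Term E n} : Rel E t t' → Rel E (.smul c t) (.smul c t')
  | act_congr {n : ℕ} (σ : Perm (Fin n)) {t t' : Term E n} :
      Rel E t t' → Rel E (.act σ t) (.act σ t')
  | comp_congr {m n r : ℕ} (h : m + n = r + 1) (i : Fin m) {s s' : Term E m} {t t' : Term E n} :
      Rel E s s' → Rel E t t' → Rel E (.comp h i s t) (.comp h i s' t')
  | add_assoc {n : ℕ} (s t t' : Term E n) :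
      Rel E (.add (.add s t) t') (.add s (.add t t'))
  | add_comm {n : ℕ} (s t : Term E n) : Rel E (.add s t) (.add t s)
  | zero_add {n : ℕ} (t : Term E n) : Rel E (.add (.zero n) t) t
  | one_smul {n : ℕ} (t : Term E n) : Rel E (.smul 1 t) t
  | mul_smul {n : ℕ} (c d : k) (t : Term E n) : Rel E (.smul (c * d) t) (.smul c (.smul d t))
  | smul_add {n : ℕ} (c : k) (s t : Term E n) :
      Rel E (.smul c (.add s t)) (.add (.smul c s) (.smul c t))
  | add_smul {n : ℕ} (c d : k) (t : Term E n) :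
      Rel E (.smul (c + d) t) (.add (.smul c t) (.smul d t))
  | zero_smul {n : ℕ} (t : Term E n) : Rel E (.smul 0 t) (.zero n)
  | gen_add {n : ℕ} (x y : E.carrier n) : Rel E (.gen (x + y)) (.add (.gen x) (.gen y))
  | gen_smul {n : ℕ} (c : k) (x : E.carrier n) : Rel E (.gen (c • x)) (.smul c (.gen x))
  | gen_act {n : ℕ} (σ : Perm (Fin n)) (x : E.carrier n) :
      Rel E (.gen (E.act σ x)) (.act σ (.gen x))
  | act_add {n : ℕ} (σ : Perm (Fin n)) (s t : Term E n) :
      Rel E (.act σ (.add s t)) (.add (.act σ s) (.act σ t))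
  | act_smul {n : ℕ} (σ : Perm (Fin n)) (c : k) (t : Term E n) :
      Rel E (.act σ (.smul c t)) (.smul c (.act σ t))
  | act_one {n : ℕ} (t : Term E n) : Rel E (.act 1 t) t
  | act_mul {n : ℕ} (σ τ : Perm (Fin n)) (t : Term E n) :
      Rel E (.act (σ * τ) t) (.act τ (.act σ t))
  | add_comp {m n r : ℕ} (h : m + n = r + 1) (i : Fin m) (s s' : Term E m) (t : Term E n) :
      Rel E (.comp h i (.add s s') t) (.add (.comp h i s t) (.comp h i s' t))
  | smul_comp {m n r : ℕ} (h : m + n = r + 1) (i : Fin m) (c : k) (s : Term E m) (t : Term E n) :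
      Rel E (.comp h i (.smul c s) t) (.smul c (.comp h i s t))
  | comp_add {m n r : ℕ} (h : m + n = r + 1) (i : Fin m) (s : Term E m) (t t' : Term E n) :
      Rel E (.comp h i s (.add t t')) (.add (.comp h i s t) (.comp h i s t'))
  | comp_smul {m n r : ℕ} (h : m + n = r + 1) (i : Fin m) (c : k) (s : Term E m) (t : Term E n) :
      Rel E (.comp h i s (.smul c t)) (.smul c (.comp h i s t))
  | one_comp {n : ℕ} (h : 1 + n = n + 1) (t : Term E n) : Rel E (.comp h 0 .one t) t
  | comp_one {m : ℕ} (i : Fin m) (s : Term E m) : Rel E (.comp rfl i s .one) s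
  | comp_seq {m n l r s t : ℕ} (h₁ : m + n = r + 1) (h₂ : r + l = s + 1) (h₃ : n + l = t + 1)
      (h₄ : m + t = s + 1) (i : Fin m) (j : Fin n) (a : Term E m) (b : Term E n) (c : Term E l) :
      Rel E (.comp h₂ ⟨i.1 + j.1, by omega⟩ (.comp h₁ i a b) c) (.comp h₄ i a (.comp h₃ j b c))
  | comp_par {m n l r s t : ℕ} (h₁ : m + n = r + 1) (h₂ : r + l = s + 1) (h₃ : m + l = t + 1)
      (h₄ : t + n = s + 1) (i i' : Fin m) (hi : i.1 < i'.1) (a : Term E m) (b : Term E n)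
      (c : Term E l) :
      Rel E (.comp h₂ ⟨i'.1 + n - 1, by omega⟩ (.comp h₁ i a b) c)
        (.comp h₄ ⟨i.1, by omega⟩ (.comp h₃ i' a c) b)
  | comp_act {m n r : ℕ} (h : m + n = r + 1) (i : Fin m) (σ : Perm (Fin m)) (τ : Perm (Fin n))
      (a : Term E m) (b : Term E n) :
      Rel E (.comp h i (.act σ a) (.act τ b))
        (.act (OperadComp.perm h i σ τ) (.comp h (σ i) a b))

/-- The space of operations of arity `n` of the free operad: formal expressions modulo the axioms. -/
def Carrier (E : SigmaModule.{u, v} k) (n : ℕ) : Type (max u v) :=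
  Quot (Rel E : Term E n → Term E n → Prop)

namespace Carrier

variable {E : SigmaModule.{u, v} k}

/-- The class of a formal expression. -/
def mk {n : ℕ} (t : Term E n) : Carrier E n := Quot.mk _ t

def add {n : ℕ} : Carrier E n → Carrier E n → Carrier E n :=
  Quot.map₂ .add (fun s _ _ h => .add_congr (.refl s) h) (fun _ _ t h => .add_congr h (.refl t))

def smul {n : ℕ} (c : k) : Carrier E n → Carrier E n :=
  Quot.map (.smul c) (fun _ _ h => .smul_congr c h)

instance {n : ℕ} : Add (Carrier E n) := ⟨add⟩

instance {n : ℕ} : Zero (Carrier E n) := ⟨mk (.zero n)⟩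

instance {n : ℕ} : Neg (Carrier E n) := ⟨smul (-1)⟩

instance {n : ℕ} : AddCommGroup (Carrier E n) where
  add_assoc := by
    rintro ⟨a⟩ ⟨b⟩ ⟨c⟩
    exact Quot.sound (.add_assoc a b c)
  zero_add := by
    rintro ⟨a⟩
    exact Quot.sound (.zero_add a)
  add_zero := by
    rintro ⟨a⟩
    exact Quot.sound (.trans (.add_comm a _) (.zero_add a))
  add_comm := by
    rintro ⟨a⟩ ⟨b⟩
    exact Quot.sound (.add_comm a b)
  neg_add_cancel := by
    rintro ⟨a⟩
    refine Quot.sound (.trans (.trans (.add_congr (.refl _) (.symm (.one_smul a)))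
      (.symm (.add_smul (-1) 1 a))) ?_)
    rw [neg_add_cancel]
    exact .zero_smul a
  nsmul := nsmulRec
  zsmul := zsmulRec

instance {n : ℕ} : Module k (Carrier E n) where
  smul := smul
  one_smul := by
    rintro ⟨a⟩
    exact Quot.sound (.one_smul a)
  mul_smul := by
    rintro c d ⟨a⟩
    exact Quot.sound (.mul_smul c d a)
  smul_zero c := by
    refine Quot.sound (.trans (.smul_congr c (.symm (.zero_smul (.zero n)))) ?_)
    refine .trans (.symm (.mul_smul c 0 _)) ?_
    rw [mul_zero]
    exact .zero_smul _
  smul_add := by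
    rintro c ⟨a⟩ ⟨b⟩
    exact Quot.sound (.smul_add c a b)
  add_smul := by
    rintro c d ⟨a⟩
    exact Quot.sound (.add_smul c d a)
  zero_smul := by
    rintro ⟨a⟩
    exact Quot.sound (.zero_smul a)

def act {n : ℕ} (σ : Perm (Fin n)) : Carrier E n →ₗ[k] Carrier E n where
  toFun := Quot.map (.act σ) (fun _ _ h => .act_congr σ h)
  map_add' := by
    rintro ⟨a⟩ ⟨b⟩
    exact Quot.sound (.act_add σ a b)
  map_smul' := by
    rintro c ⟨a⟩
    exact Quot.sound (.act_smul σ c a)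

def comp {m n r : ℕ} (h : m + n = r + 1) (i : Fin m) :
    Carrier E m →ₗ[k] Carrier E n →ₗ[k] Carrier E r :=
  LinearMap.mk₂ k
    (Quot.map₂ (.comp h i) (fun s _ _ e => .comp_congr h i (.refl s) e)
      (fun _ _ t e => .comp_congr h i e (.refl t)))
    (by
      rintro ⟨a⟩ ⟨a'⟩ ⟨b⟩
      exact Quot.sound (.add_comp h i a a' b))
    (by
      rintro c ⟨a⟩ ⟨b⟩
      exact Quot.sound (.smul_comp h i c a b))
    (by
      rintro ⟨a⟩ ⟨b⟩ ⟨b'⟩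
      exact Quot.sound (.comp_add h i a b b'))
    (by
      rintro c ⟨a⟩ ⟨b⟩
      exact Quot.sound (.comp_smul h i c a b))

end Carrier

end FreeOperad

/-- The free operad on a `Σ`-module `E`. -/
def FreeOperad {k : Type u} [Field k] (E : SigmaModule.{u, v} k) : LinOperad.{u, max u v} k where
  carrier := FreeOperad.Carrier E
  act := FreeOperad.Carrier.act
  act_one := by
    rintro n ⟨a⟩
    exact Quot.sound (.act_one a)
  act_mul := by
    rintro n σ τ ⟨a⟩
    exact Quot.sound (.act_mul σ τ a)
  one := FreeOperad.Carrier.mk .one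
  comp := FreeOperad.Carrier.comp
  one_comp := by
    rintro n h ⟨b⟩
    exact Quot.sound (.one_comp h b)
  comp_one := by
    rintro m i ⟨a⟩
    exact Quot.sound (.comp_one i a)
  comp_seq := by
    rintro m n l r s t h₁ h₂ h₃ h₄ i j ⟨a⟩ ⟨b⟩ ⟨c⟩
    exact Quot.sound (.comp_seq h₁ h₂ h₃ h₄ i j a b c)
  comp_par := by
    rintro m n l r s t h₁ h₂ h₃ h₄ i i' hi ⟨a⟩ ⟨b⟩ ⟨c⟩
    exact Quot.sound (.comp_par h₁ h₂ h₃ h₄ i i' hi a b c)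
  comp_act := by
    rintro m n r h i σ τ ⟨a⟩ ⟨b⟩
    exact Quot.sound (.comp_act h i σ τ a b)

namespace FreeOperad

variable {k : Type u} [Field k]

/-- The inclusion of generators `E(n) → F(E)(n)`. -/
def gen (E : SigmaModule.{u, v} k) (n : ℕ) : E.carrier n →ₗ[k] (FreeOperad E).carrier n where
  toFun x := Carrier.mk (.gen x)
  map_add' x y := Quot.sound (.gen_add x y)
  map_smul' c x := Quot.sound (.gen_smul c x)

/-- The value of a formal expression in an operad. -/
def Term.eval {E : SigmaModule.{u, v} k} (P : LinOperad.{u, w} k)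
    (f : ∀ n, E.carrier n →ₗ[k] P.carrier n) : ∀ {n : ℕ}, Term E n → P.carrier n
  | _, .zero _ => 0
  | _, .add s t => s.eval P f + t.eval P f
  | _, .smul c t => c • t.eval P f
  | _, .gen x => f _ x
  | _, .one => P.one
  | _, .act σ t => P.act σ (t.eval P f)
  | _, .comp h i s t => P.comp h i (s.eval P f) (t.eval P f)

theorem Rel.eval_eq {E : SigmaModule.{u, v} k} (P : LinOperad.{u, w} k)
    (f : ∀ n, E.carrier n →ₗ[k] P.carrier n)
    (hf : ∀ (n : ℕ) (σ : Perm (Fin n)) (x : E.carrier n), f n (E.act σ x) = P.act σ (f n x))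
    {n : ℕ} {s t : Term E n} (h : Rel E s t) : s.eval P f = t.eval P f := by
  induction h with
  | refl => rfl
  | symm _ ih => exact ih.symm
  | trans _ _ ih ih' => exact ih.trans ih'
  | add_congr _ _ ih ih' => simp only [Term.eval, ih, ih']
  | smul_congr _ _ ih => simp only [Term.eval, ih]
  | act_congr _ _ ih => simp only [Term.eval, ih]
  | comp_congr _ _ _ _ ih ih' => simp only [Term.eval, ih, ih']
  | add_assoc => simp only [Term.eval, _root_.add_assoc]
  | add_comm => simp only [Term.eval]; exact _root_.add_comm _ _
  | zero_add => simp only [Term.eval, _root_.zero_add]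
  | one_smul => simp only [Term.eval, _root_.one_smul]
  | mul_smul => simp only [Term.eval, SemigroupAction.mul_smul]
  | smul_add => simp only [Term.eval, _root_.smul_add]
  | add_smul => simp only [Term.eval, _root_.add_smul]
  | zero_smul => simp only [Term.eval, _root_.zero_smul]
  | gen_add => simp only [Term.eval, map_add]
  | gen_smul => simp only [Term.eval, map_smul]
  | gen_act σ x => exact hf _ σ x
  | act_add => simp only [Term.eval, map_add]
  | act_smul => simp only [Term.eval, map_smul]
  | act_one => exact P.act_one _
  | act_mul => exact P.act_mul _ _ _
  | add_comp => simp only [Term.eval, map_add, LinearMap.add_apply]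
  | smul_comp => simp only [Term.eval, map_smul, LinearMap.smul_apply]
  | comp_add => simp only [Term.eval, map_add]
  | comp_smul => simp only [Term.eval, map_smul]
  | one_comp h t => exact P.one_comp h _
  | comp_one i s => exact P.comp_one i _
  | comp_seq h₁ h₂ h₃ h₄ i j a b c => exact P.comp_seq h₁ h₂ h₃ h₄ i j _ _ _
  | comp_par h₁ h₂ h₃ h₄ i i' hi a b c => exact P.comp_par h₁ h₂ h₃ h₄ i i' hi _ _ _
  | comp_act h i σ τ a b => exact P.comp_act h i σ τ _ _

/-- The morphism of operads `F(E) → P` that extends an equivariant linear map `E → P`. -/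
def lift {E : SigmaModule.{u, v} k} (P : LinOperad.{u, w} k)
    (f : ∀ n, E.carrier n →ₗ[k] P.carrier n)
    (hf : ∀ (n : ℕ) (σ : Perm (Fin n)) (x : E.carrier n), f n (E.act σ x) = P.act σ (f n x)) :
    LinOperad.Hom (FreeOperad E) P where
  app n :=
    { toFun := Quot.lift (fun t => t.eval P f) (fun _ _ h => h.eval_eq P f hf)
      map_add' := by
        rintro ⟨a⟩ ⟨b⟩
        rfl
      map_smul' := by
        rintro c ⟨a⟩
        rfl }
  map_one := rfl
  map_act := by
    rintro n σ ⟨a⟩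
    rfl
  map_comp := by
    rintro m n r h i ⟨a⟩ ⟨b⟩
    rfl

end FreeOperad

/-! ### Multifiltrations -/

namespace MultiIndex

/-- `a ∘_i b = (a_1, …, a_{i-1}, b_1 + a_i, …, b_n + a_i, a_{i+1}, …, a_m)`. -/
def comp {m n r : ℕ} (h : m + n = r + 1) (i : Fin m) (a : Fin m → ℤ) (b : Fin n → ℤ) :
    Fin r → ℤ :=
  fun p => Sum.elim (fun x => a x.1) (fun y => b y + a i) (OperadComp.split h i p)

/-- `[a, b]_{ij} = (b_L + a_i, a_L + b_j, a_i + b_j - 1, b_R + a_i, a_R + b_j)`, where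
`a = (a_L, a_i, a_R)` and `b = (b_L, b_j, b_R)`. -/
def bracket {m n r : ℕ} (h : m + n = r + 1) (i : Fin m) (j : Fin n) (a : Fin m → ℤ)
    (b : Fin n → ℤ) : Fin r → ℤ :=
  fun p =>
    if h₁ : p.1 < j.1 then b ⟨p.1, by omega⟩ + a i
    else if h₂ : p.1 < i.1 + j.1 then a ⟨p.1 - j.1, by omega⟩ + b j
    else if h₃ : p.1 = i.1 + j.1 then a i + b j - 1
    else if h₄ : p.1 < i.1 + n then b ⟨p.1 - i.1, by omega⟩ + a i
    else a ⟨p.1 + 1 - n, by omega⟩ + b j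

end MultiIndex

namespace LinOperad

variable {k : Type u} [Field k]

/-- The operadic commutator
`[a, b]_{ij} = (a ∘_i b) · (τ × id) - (b ∘_j a) · (id × τ')`. The permutations reorder the inputs
of both summands to: the inputs of `b` before `j`, those of `a` before `i`, the common input, the
inputs of `b` after `j`, those of `a` after `i`. -/
def bracket (P : LinOperad.{u, v} k) {m n r : ℕ} (h : m + n = r + 1) (i : Fin m) (j : Fin n)
    (a : P.carrier m) (b : P.carrier n) : P.carrier r :=
  P.act (OperadComp.blockSwap r 0 i.1 j.1 (by omega)) (P.comp h i a b) -
    P.act (OperadComp.blockSwap r (i.1 + j.1 + 1) (m - 1 - i.1) (n - 1 - j.1) (by omega))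
      (P.comp ((Nat.add_comm n m).trans h) j b a)

/-- (D-)multifiltrations of an operad: subspaces `F_p P(n)`, for `p ∈ ℤⁿ`. -/
structure IsMultifiltration (P : LinOperad.{u, v} k)
    (F : ∀ n : ℕ, (Fin n → ℤ) → Submodule k (P.carrier n)) : Prop where
  mono : ∀ (n : ℕ) (p q : Fin n → ℤ), p ≤ q → F n p ≤ F n q
  equivariant : ∀ (n : ℕ) (p : Fin n → ℤ) (σ : Perm (Fin n)),
    (F n p).map (P.act σ) = F n (fun x => p (σ x))
  comp_mem : ∀ {m n r : ℕ} (h : m + n = r + 1) (i : Fin m) (p : Fin m → ℤ) (q : Fin n → ℤ)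
    (a : P.carrier m) (b : P.carrier n), a ∈ F m p → b ∈ F n q →
    P.comp h i a b ∈ F r (MultiIndex.comp h i p q)
  one_mem : P.one ∈ F 1 (fun _ => 0)
  bracket_mem : ∀ {m n r : ℕ} (h : m + n = r + 1) (i : Fin m) (j : Fin n) (p : Fin m → ℤ)
    (q : Fin n → ℤ) (a : P.carrier m) (b : P.carrier n), a ∈ F m p → b ∈ F n q →
    P.bracket h i j a b ∈ F r (MultiIndex.bracket h i j p q)

/-- Saturation: `F_p P(n) ∩ F_q P(n) ⊆ F_{p ∧ q} P(n)`. -/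
def IsSaturated (P : LinOperad.{u, v} k)
    (F : ∀ n : ℕ, (Fin n → ℤ) → Submodule k (P.carrier n)) : Prop :=
  ∀ (n : ℕ) (p q : Fin n → ℤ), F n p ⊓ F n q ≤ F n (p ⊓ q)

/-- The standard multifiltration of `P` with respect to generators `E(n) ⊆ P(n)`: the smallest
saturated D-multifiltration with `E(n) ⊆ F_{(1, …, 1)} P(n)` for all `n`, obtained as the
intersection of all of them. -/
def standardMultifiltration (P : LinOperad.{u, v} k) (E : ∀ n, Submodule k (P.carrier n))
    (n : ℕ) (p : Fin n → ℤ) : Submodule k (P.carrier n) :=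
  ⨅ (F : ∀ n : ℕ, (Fin n → ℤ) → Submodule k (P.carrier n))
    (_ : P.IsMultifiltration F) (_ : P.IsSaturated F) (_ : ∀ m, E m ≤ F m (fun _ => 1)), F n p

end LinOperad

/-- The standard multifiltration of the free operad `F(E)` with respect to `E`. -/
def FreeOperad.standard {k : Type u} [Field k] (E : SigmaModule.{u, v} k) (n : ℕ)
    (p : Fin n → ℤ) : Submodule k ((FreeOperad E).carrier n) :=
  (FreeOperad E).standardMultifiltration (fun m => LinearMap.range (FreeOperad.gen E m)) n p

/-! ### Generators, presentations, quadratic and tight operads -/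

namespace LinOperad

variable {k : Type u} [Field k]

/-- A collection of `Σ`-submodules `E(n) ⊆ P(n)`. -/
structure SubCollection (P : LinOperad.{u, v} k) where
  sub : ∀ n : ℕ, Submodule k (P.carrier n)
  act_mem : ∀ {n : ℕ} (σ : Perm (Fin n)) (a : P.carrier n), a ∈ sub n → P.act σ a ∈ sub n

/-- A subcollection as a `Σ`-module in its own right. -/
def SubCollection.toSigmaModule {P : LinOperad.{u, v} k} (E : P.SubCollection) :
    SigmaModule.{u, v} k where
  carrier n := E.sub n
  act σ := (P.act σ).restrict (E.act_mem σ)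
  act_one x := Subtype.ext (P.act_one x.1)
  act_mul σ τ x := Subtype.ext (P.act_mul σ τ x.1)

/-- The canonical morphism `F(E) → P` for a subcollection `E` of `P`. -/
def SubCollection.canonical {P : LinOperad.{u, v} k} (E : P.SubCollection) :
    Hom (FreeOperad E.toSigmaModule) P :=
  FreeOperad.lift P (fun n => (E.sub n).subtype) (fun _ _ _ => rfl)

/-- `P = F(E)/(R)`: the subcollection `E` generates `P`, and the kernel of the canonical morphism
`F(E) → P` is the operadic ideal generated by `R`. -/
def SubCollection.IsPresentation {P : LinOperad.{u, v} k} (E : P.SubCollection)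
    (R : ∀ n, Set ((FreeOperad E.toSigmaModule).carrier n)) : Prop :=
  ∀ n, Function.Surjective (E.canonical.app n) ∧
    LinearMap.ker (E.canonical.app n) = ((FreeOperad E.toSigmaModule).idealSpan R).sub n

/-- The operad `P` with generating collection `E` is quadratic: `P = F(E)/(R)` with relations `R`
in the part of weight two of `F(E)`, which is spanned by the elements `(x ∘_i y) · σ` with
`x, y ∈ E`. -/
def SubCollection.IsQuadratic {P : LinOperad.{u, v} k} (E : P.SubCollection) : Prop :=
  ∃ R : ∀ n, Set ((FreeOperad E.toSigmaModule).carrier n),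
    (∀ r, R r ⊆ Submodule.span k {z : (FreeOperad E.toSigmaModule).carrier r |
      ∃ (m n : ℕ) (h : m + n = r + 1) (i : Fin m) (x : E.toSigmaModule.carrier m)
        (y : E.toSigmaModule.carrier n) (σ : Perm (Fin r)),
        z = (FreeOperad E.toSigmaModule).act σ ((FreeOperad E.toSigmaModule).comp h i
          (FreeOperad.gen _ m x) (FreeOperad.gen _ n y))}) ∧
    E.IsPresentation R

/-- The operad `P` with generating collection `E` is tight: `P = F(E)/(R)` with relations
`R(n)` in the piece of multiindex `(1, …, 1)` of the standard multifiltration of `F(E)`. -/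
def SubCollection.IsTight {P : LinOperad.{u, v} k} (E : P.SubCollection) : Prop :=
  ∃ R : ∀ n, Set ((FreeOperad E.toSigmaModule).carrier n),
    (∀ n, R n ⊆ FreeOperad.standard E.toSigmaModule n (fun _ => 1)) ∧ E.IsPresentation R

/-- The subcollection spanned by one operation `μ ∈ P(m)`: it is the span of all `μ · σ` in arity
`m`, and zero in the other arities. -/
def spanOne (P : LinOperad.{u, v} k) {m : ℕ} (μ : P.carrier m) : P.SubCollection where
  sub n := Submodule.span k
    {x | ∃ y : P.carrier n, (⟨n, y⟩ : Sigma P.carrier) = ⟨m, μ⟩ ∧ ∃ σ, x = P.act σ y}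
  act_mem {n} σ a ha := by
    induction ha using Submodule.span_induction with
    | mem x hx =>
      obtain ⟨y, hy, τ, rfl⟩ := hx
      exact Submodule.subset_span ⟨y, hy, τ * σ, (P.act_mul τ σ y).symm⟩
    | zero => simp
    | add x y _ _ hx hy => simpa using Submodule.add_mem _ hx hy
    | smul c x _ hx => simpa using Submodule.smul_mem _ c hx

/-- `P` is a tight quadratic operad generated by a single (nonzero) binary operation. -/
def IsTightQuadraticOneBinary (P : LinOperad.{u, v} k) : Prop :=
  ∃ μ : P.carrier 2, μ ≠ 0 ∧ (P.spanOne μ).IsQuadratic ∧ (P.spanOne μ).IsTight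

/-- The collection of relations that consists of the single element `r` of arity `m`. -/
def oneRelation (P : LinOperad.{u, v} k) {m : ℕ} (r : P.carrier m) (n : ℕ) : Set (P.carrier n) :=
  {x | (⟨n, x⟩ : Sigma P.carrier) = ⟨m, r⟩}

/-- `[[1,2],3] = μ ∘_1 μ`. -/
def leftComb (P : LinOperad.{u, v} k) (μ : P.carrier 2) : P.carrier 3 :=
  P.comp (rfl : 2 + 2 = 3 + 1) 0 μ μ

/-- `[1,[2,3]] = μ ∘_2 μ`. -/
def rightComb (P : LinOperad.{u, v} k) (μ : P.carrier 2) : P.carrier 3 :=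
  P.comp (rfl : 2 + 2 = 3 + 1) 1 μ μ

/-- The Jacobiator `[1,[2,3]] + [2,[3,1]] + [3,[1,2]]` of a binary operation. -/
def jacobiator (P : LinOperad.{u, v} k) (μ : P.carrier 2) : P.carrier 3 :=
  P.rightComb μ + P.act (finRotate 3) (P.rightComb μ) +
    P.act (finRotate 3 * finRotate 3) (P.rightComb μ)

/-- The Lie-admissibility relation `∑_σ sgn(σ) Ass · σ` of a binary operation, where
`Ass = ((1,2),3) - (1,(2,3))` is the associator. -/
def lieAdmissibility (P : LinOperad.{u, v} k) (μ : P.carrier 2) : P.carrier 3 :=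
  ∑ σ : Perm (Fin 3), ((Perm.sign σ : ℤ) : k) • P.act σ (P.leftComb μ - P.rightComb μ)

end LinOperad

/-! ### The three kinds of one binary generator, and the operads `Lie` and `LieAdm` -/

/-- The `Σ`-module concentrated in arity `2` (where `PLift (n = 2) → V` is `V`; it is `0` for the
other arities), with the transposition acting on `V` by the involution `t`. -/
def binaryModule (k : Type u) [Field k] (V : Type v) [AddCommGroup V] [Module k V] (t : V →ₗ[k] V)
    (ht : t ∘ₗ t = LinearMap.id) : SigmaModule.{u, v} k where
  carrier n := PLift (n = 2) → V
  act {n} σ := if Perm.sign σ = 1 then LinearMap.id else t.compLeft (PLift (n = 2))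
  act_one x := by simp
  act_mul σ τ x := by
    have ht' : ∀ y, t (t y) = y := fun y => LinearMap.congr_fun ht y
    rcases Int.units_eq_one_or (Perm.sign σ) with h | h <;>
      rcases Int.units_eq_one_or (Perm.sign τ) with h' | h' <;>
      ext e <;> simp [Perm.sign_mul, h, h', ht']

section

variable (k : Type u) [Field k]

/-- One antisymmetric binary generator. -/
def antisymGen : SigmaModule.{u, u} k :=
  binaryModule k k (-LinearMap.id) (by ext; simp)

/-- One symmetric binary generator. -/
def symGen : SigmaModule.{u, u} k :=
  binaryModule k k LinearMap.id rfl

/-- One binary generator with no symmetry: the regular representation of `Σ_2`. -/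
def nosymGen : SigmaModule.{u, u} k :=
  binaryModule k (k × k) (LinearMap.prod (LinearMap.snd k k k) (LinearMap.fst k k k)) (by ext <;> simp)

/-- The generator of the free operad on one antisymmetric binary operation. -/
def antisymOp : (FreeOperad (antisymGen k)).carrier 2 :=
  FreeOperad.gen (antisymGen k) 2 (fun _ : PLift (2 = 2) => (1 : k))

/-- The generator of the free operad on one binary operation with no symmetry. -/
def nosymOp : (FreeOperad (nosymGen k)).carrier 2 :=
  FreeOperad.gen (nosymGen k) 2 (fun _ : PLift (2 = 2) => ((1, 0) : k × k))

/-- The operad for Lie algebras. -/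
def LieOperad : LinOperad.{u, u} k :=
  (FreeOperad (antisymGen k)).quotient ((FreeOperad (antisymGen k)).idealSpan
    ((FreeOperad (antisymGen k)).oneRelation
      ((FreeOperad (antisymGen k)).jacobiator (antisymOp k))))

/-- The operad for Lie-admissible algebras. -/
def LieAdmOperad : LinOperad.{u, u} k :=
  (FreeOperad (nosymGen k)).quotient ((FreeOperad (nosymGen k)).idealSpan
    ((FreeOperad (nosymGen k)).oneRelation
      ((FreeOperad (nosymGen k)).lieAdmissibility (nosymOp k))))

end

universe v' w'

/-! Both halves rest on computing the piece of multiindex `(1, 1, 1)` of the standard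
multifiltration of the free operad on one binary operation.

Upper bound. A translation invariant polydifferential operator multiplies a tuple of exponentials
with frequencies `ξ` by a number `a(ξ)`, its symbol, and returns the exponential whose frequency is
the sum of the `ξ`'s. Symbols therefore form an operad: in `a ∘_i b` the slot `i` of `a` receives
the sum of the frequencies of `b`. Filter symbols by the degree in each variable. Orders add under
composition, and the bracket in a common variable has order one less, because the leading terms
cancel; saturation is clear, since the conditions on different variables are independent
(`SymbolOperad.isMultifiltration`, `SymbolOperad.isSaturated`). Preimages of saturated
multifiltrations under operad morphisms are again such, so a morphism from the free operad that
sends the generators to symbols of degree at most one in each variable sends the standard piece to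
symbols of degree at most one in each variable. For the symbols `y - x`, `x y` and `-x + y + x y`,
the resulting linear equations on the coefficients of an arity three element leave a line, zero and
a line (`standard_antisymGen_le`, `standard_symGen_eq_bot`, `standard_nosymGen_le`).

Lower bound. The Jacobiator of an antisymmetric `ν` of multiindex `(1, 1)` differs from `ν ∘_2 ν` by
an operadic commutator, which gives multiindex `(1, 2, 2)`. It is invariant under rotation, so
saturation gives `(1, 1, 1)` (`LinOperad.jacobiator_mem`). The Lie-admissibility relation is minus
the Jacobiator of the commutator (`LinOperad.lieAdmissibility_eq`).

Classification. One operation spans an antisymmetric, a symmetric or a regular representation of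
`Σ_2`. By quadraticity the kernel of the free operad over `P` is generated in arity three; by
tightness its arity three part lies in the piece just computed, of dimension at most one. So the
kernel vanishes or is generated by the Jacobiator or by the Lie-admissibility relation. -/

open OperadComp in
theorem OperadComp.sum_split {M : Type*} [AddCommMonoid M] {m n r : ℕ} (h : m + n = r + 1)
    (i : Fin m) (f : Fin r → M) :
    ∑ p, f p = ∑ x : {x : Fin m // x ≠ i}, f ((split h i).symm (.inl x)) +
      ∑ y, f ((split h i).symm (.inr y)) := by
  rw [← (split h i).symm.sum_comp f, Fintype.sum_sum_type]

/-! ### An operad of symbols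

Functions of `n` variables, thought of as symbols of translation invariant polydifferential
operators: substituting an operator into an input amounts to adding up the frequencies. -/

namespace SymbolOperad

open OperadComp

variable {k : Type u} [Field k]

/-- The frequencies of the outer operation in a composite. -/
def outerFreq {m n r : ℕ} (h : m + n = r + 1) (i : Fin m) (ξ : Fin r → k) (x : Fin m) : k :=
  if hx : x = i then ∑ y, ξ ((split h i).symm (.inr y)) else ξ ((split h i).symm (.inl ⟨x, hx⟩))

/-- The frequencies of the inner operation in a composite. -/
def innerFreq {m n r : ℕ} (h : m + n = r + 1) (i : Fin m) (ξ : Fin r → k) (y : Fin n) : k :=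
  ξ ((split h i).symm (.inr y))

theorem outerFreq_self {m n r : ℕ} (h : m + n = r + 1) (i : Fin m) (ξ : Fin r → k) :
    outerFreq h i ξ i = ∑ y, innerFreq h i ξ y := by
  simp [outerFreq, innerFreq]

theorem outerFreq_ne {m n r : ℕ} (h : m + n = r + 1) (i : Fin m) (ξ : Fin r → k) {x : Fin m}
    (hx : x ≠ i) : outerFreq h i ξ x = ξ ((split h i).symm (.inl ⟨x, hx⟩)) := by
  simp [outerFreq, hx]

theorem outerFreq_lt {m n r : ℕ} (h : m + n = r + 1) (i : Fin m) (ξ : Fin r → k) {x : Fin m}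
    (hx : x.1 < i.1) : outerFreq h i ξ x = ξ ⟨x.1, by omega⟩ := by
  rw [outerFreq_ne h i ξ (Fin.ne_of_lt hx)]
  have hx' : x < i := hx
  simp [split, hx']

theorem outerFreq_gt {m n r : ℕ} (h : m + n = r + 1) (i : Fin m) (ξ : Fin r → k) {x : Fin m}
    (hx : i.1 < x.1) : outerFreq h i ξ x = ξ ⟨x.1 + n - 1, by omega⟩ := by
  rw [outerFreq_ne h i ξ (Fin.ne_of_gt hx)]
  have hx' : ¬ x < i := Fin.lt_asymm hx
  simp [split, hx']

omit [Field k] in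
theorem innerFreq_apply {m n r : ℕ} (h : m + n = r + 1) (i : Fin m) (ξ : Fin r → k) (y : Fin n) :
    innerFreq h i ξ y = ξ ⟨i.1 + y.1, by omega⟩ := rfl

/-- Conservation of the total frequency: slot `i` collects exactly the frequencies that enter the
inner operation. Sequential associativity of the composition of symbols depends on it. -/
theorem sum_outerFreq {m n r : ℕ} (h : m + n = r + 1) (i : Fin m) (ξ : Fin r → k) :
    ∑ x, outerFreq h i ξ x = ∑ p, ξ p := by
  rw [sum_split h i, Fintype.sum_eq_add_sum_subtype_ne _ i, outerFreq_self, add_comm]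
  congr 1
  exact Finset.sum_congr rfl fun x _ => outerFreq_ne h i ξ x.2

end SymbolOperad

open SymbolOperad in
/-- The operad of symbols. -/
def SymbolOperad (k : Type u) [Field k] : LinOperad.{u, u} k where
  carrier n := (Fin n → k) → k
  act σ := LinearMap.funLeft k k fun ξ => ξ ∘ σ.symm
  act_one _ := rfl
  act_mul _ _ _ := rfl
  one := 1
  comp h i := LinearMap.mk₂ k (fun a b ξ => a (outerFreq h i ξ) * b (innerFreq h i ξ))
    (fun _ _ _ => funext fun _ => add_mul _ _ _) (fun _ _ _ => funext fun _ => mul_assoc _ _ _)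
    (fun _ _ _ => funext fun _ => mul_add _ _ _)
    (fun _ _ _ => funext fun _ => mul_left_comm _ _ _)
  one_comp h b := by
    funext ξ
    have : innerFreq h 0 ξ = ξ := by
      funext y
      simp [innerFreq_apply]
    simp [LinearMap.mk₂_apply, this]
  comp_one i a := by
    funext ξ
    have : outerFreq rfl i ξ = ξ := by
      funext x
      rcases lt_trichotomy x.1 i.1 with hx | hx | hx
      · rw [outerFreq_lt _ _ _ hx]
      · obtain rfl := Fin.ext hx
        simp [outerFreq_self, innerFreq_apply]
      · simp [outerFreq_gt _ _ _ hx]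
    simp [LinearMap.mk₂_apply, this]
  comp_seq {m n l r s t} h₁ h₂ h₃ h₄ i j a b c := by
    funext ξ
    have e₁ : innerFreq h₁ i (outerFreq h₂ ⟨i.1 + j.1, by omega⟩ ξ) = outerFreq h₃ j (innerFreq h₄ i ξ) := by
      funext y
      rw [innerFreq_apply]
      rcases lt_trichotomy y.1 j.1 with hy | hy | hy
      · rw [outerFreq_lt _ _ _ hy, outerFreq_lt _ _ _ (by simpa using hy), innerFreq_apply]
      · obtain rfl := Fin.ext hy
        rw [outerFreq_self, outerFreq_self]
        simp [innerFreq_apply, add_assoc]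
      · rw [outerFreq_gt _ _ _ hy, outerFreq_gt _ _ _ (by simpa using hy), innerFreq_apply]
        congr 2
        simp only
        omega
    have e₂ : outerFreq h₁ i (outerFreq h₂ ⟨i.1 + j.1, by omega⟩ ξ) = outerFreq h₄ i ξ := by
      funext x
      rcases lt_trichotomy x.1 i.1 with hx | hx | hx
      · rw [outerFreq_lt _ _ _ hx, outerFreq_lt _ _ _ (by simp; omega), outerFreq_lt _ _ _ hx]
      · obtain rfl := Fin.ext hx
        -- Slot `i` receives everything that enters `b ∘_j c`, whether or not the inputs of `c` are
        -- added up beforehand.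
        rw [outerFreq_self, outerFreq_self, e₁, sum_outerFreq]
      · rw [outerFreq_gt _ _ _ hx, outerFreq_gt _ _ _ (by simp; omega), outerFreq_gt _ _ _ hx]
        congr 2
        simp only
        omega
    have e₃ : innerFreq h₂ ⟨i.1 + j.1, by omega⟩ ξ = innerFreq h₃ j (innerFreq h₄ i ξ) := by
      funext z
      simp [innerFreq_apply, add_assoc]
    simp [LinearMap.mk₂_apply, e₁, e₂, e₃, mul_assoc]
  comp_par {m n l r s t} h₁ h₂ h₃ h₄ i i' hi a b c := by
    funext ξ
    have e₁ : innerFreq h₁ i (outerFreq h₂ ⟨i'.1 + n - 1, by omega⟩ ξ) = innerFreq h₄ ⟨i.1, by omega⟩ ξ := by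
      funext y
      rw [innerFreq_apply, outerFreq_lt _ _ _ (by simp; omega), innerFreq_apply]
    have e₂ : innerFreq h₃ i' (outerFreq h₄ ⟨i.1, by omega⟩ ξ) = innerFreq h₂ ⟨i'.1 + n - 1, by omega⟩ ξ := by
      funext y
      rw [innerFreq_apply, outerFreq_gt _ _ _ (by simp; omega), innerFreq_apply]
      congr 2
      simp only
      omega
    have e₃ : outerFreq h₁ i (outerFreq h₂ ⟨i'.1 + n - 1, by omega⟩ ξ) =
        outerFreq h₃ i' (outerFreq h₄ ⟨i.1, by omega⟩ ξ) := by
      funext x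
      rcases lt_trichotomy x.1 i.1 with hx | hx | hx
      · rw [outerFreq_lt _ _ _ hx, outerFreq_lt _ _ _ (by simp; omega),
          outerFreq_lt h₃ i' _ (by omega), outerFreq_lt _ _ _ (by simpa using hx)]
      · obtain rfl := Fin.ext hx
        rw [outerFreq_self, outerFreq_lt _ _ _ hi, e₁, outerFreq_self]
      · rw [outerFreq_gt _ _ _ hx]
        rcases lt_trichotomy x.1 i'.1 with hx' | hx' | hx'
        · rw [outerFreq_lt _ _ _ (by simp; omega), outerFreq_lt _ _ _ hx', outerFreq_gt _ _ _ (by simp; omega)]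
        · obtain rfl := Fin.ext hx'
          rw [outerFreq_self, outerFreq_self, e₂]
        · rw [outerFreq_gt _ _ _ (by simp; omega), outerFreq_gt _ _ _ hx', outerFreq_gt _ _ _ (by simp; omega)]
          congr 2
          simp only
          omega
    simp [LinearMap.mk₂_apply, e₁, e₂, e₃, mul_comm, mul_left_comm]
  comp_act {m n r} h i σ τ a b := by
    funext ξ
    have e₁ : innerFreq h (σ i) (ξ ∘ (OperadComp.perm h i σ τ).symm) = innerFreq h i ξ ∘ τ.symm := by
      funext y
      rw [Function.comp_apply, innerFreq, innerFreq, Function.comp_apply]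
      congr 1
      rw [Equiv.symm_apply_eq]
      simp [OperadComp.perm]
    have e₂ : outerFreq h (σ i) (ξ ∘ (OperadComp.perm h i σ τ).symm) = outerFreq h i ξ ∘ σ.symm := by
      funext x
      by_cases hx : x = σ i
      · subst hx
        rw [outerFreq_self, e₁]
        simp only [Function.comp_apply, Equiv.symm_apply_apply, outerFreq_self]
        exact τ.symm.sum_comp (innerFreq h i ξ)
      · have hx' : σ.symm x ≠ i := fun e => hx (by simp [← e])
        rw [outerFreq_ne _ _ _ hx, Function.comp_apply, Function.comp_apply, outerFreq_ne _ _ _ hx']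
        congr 1
        rw [Equiv.symm_apply_eq]
        simp [OperadComp.perm]
    simp [LinearMap.mk₂_apply, LinearMap.funLeft_apply, e₁, e₂]

namespace SymbolOperad

open OperadComp Polynomial

variable {k : Type u} [Field k]

/-- The polynomial functions of degree at most `d` in one variable; there is only the zero function
if `d` is negative. -/
def polyDegLE (k : Type u) [Field k] (d : ℤ) : Submodule k (k → k) where
  carrier := {g | ∃ q : k[X], (∀ n : ℕ, d < n → q.coeff n = 0) ∧ ∀ t, g t = q.eval t}
  add_mem' := by
    rintro f g ⟨p, hp, hf⟩ ⟨q, hq, hg⟩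
    exact ⟨p + q, fun n hn => by simp [hp n hn, hq n hn], fun t => by simp [hf, hg]⟩
  zero_mem' := ⟨0, by simp, by simp⟩
  smul_mem' := by
    rintro c f ⟨p, hp, hf⟩
    exact ⟨C c * p, fun n hn => by simp [hp n hn], fun t => by simp [hf]⟩

theorem polyDegLE_mono {d e : ℤ} (h : d ≤ e) : polyDegLE k d ≤ polyDegLE k e := by
  rintro f ⟨p, hp, hf⟩
  exact ⟨p, fun n hn => hp n (by omega), hf⟩

theorem polyDegLE_inf (d e : ℤ) : polyDegLE k d ⊓ polyDegLE k e ≤ polyDegLE k (d ⊓ e) := by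
  rintro f ⟨hd, he⟩
  rcases le_total d e with h | h
  · rwa [inf_eq_left.2 h]
  · rwa [inf_eq_right.2 h]

theorem eq_zero_of_mem_polyDegLE {d : ℤ} (hd : d < 0) {f : k → k} (hf : f ∈ polyDegLE k d) :
    f = 0 := by
  obtain ⟨p, hp, hf⟩ := hf
  obtain rfl : p = 0 := Polynomial.ext fun n => by simpa using hp n (by omega)
  funext t
  simp [hf]

theorem mem_polyDegLE_natCast {d : ℕ} {f : k → k} :
    f ∈ polyDegLE k d ↔ ∃ q : k[X], q.natDegree ≤ d ∧ ∀ t, f t = q.eval t := by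
  simp only [natDegree_le_iff_coeff_eq_zero]
  exact exists_congr fun q => and_congr_left' ⟨fun h n hn => h n (by exact_mod_cast hn),
    fun h n hn => h n (by exact_mod_cast hn)⟩

theorem const_mem_polyDegLE (c : k) : (fun _ => c) ∈ polyDegLE k 0 :=
  mem_polyDegLE_natCast.2 ⟨C c, by simp, by simp⟩

theorem mul_mem_polyDegLE {d e : ℤ} {f g : k → k} (hf : f ∈ polyDegLE k d)
    (hg : g ∈ polyDegLE k e) : (fun t => f t * g t) ∈ polyDegLE k (d + e) := by
  rcases lt_or_ge d 0 with hd | hd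
  · rw [eq_zero_of_mem_polyDegLE hd hf]
    convert (polyDegLE k (d + e)).zero_mem using 1
    funext t
    simp
  rcases lt_or_ge e 0 with he | he
  · rw [eq_zero_of_mem_polyDegLE he hg]
    convert (polyDegLE k (d + e)).zero_mem using 1
    funext t
    simp
  lift d to ℕ using hd
  lift e to ℕ using he
  obtain ⟨p, hp, hf⟩ := mem_polyDegLE_natCast.1 hf
  obtain ⟨q, hq, hg⟩ := mem_polyDegLE_natCast.1 hg
  rw [← Nat.cast_add]
  exact mem_polyDegLE_natCast.2
    ⟨p * q, natDegree_mul_le_of_le hp hq, fun t => by simp [hf, hg]⟩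

theorem shift_mem_polyDegLE {d : ℤ} {f : k → k} (hf : f ∈ polyDegLE k d) (c : k) :
    (fun t => f (t + c)) ∈ polyDegLE k d := by
  rcases lt_or_ge d 0 with hd | hd
  · rw [eq_zero_of_mem_polyDegLE hd hf]
    exact (polyDegLE k d).zero_mem
  lift d to ℕ using hd
  obtain ⟨p, hp, hf⟩ := mem_polyDegLE_natCast.1 hf
  exact mem_polyDegLE_natCast.2 ⟨taylor c p, by simpa, fun t => by simp [hf, taylor_eval]⟩

/-- A shift of the variable changes a polynomial only by terms of lower degree; this is what makes
the leading terms of a commutator cancel. -/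
theorem coeff_taylor_of_natDegree_le {p : k[X]} {d : ℕ} (hp : p.natDegree ≤ d) (c : k) :
    (taylor c p).coeff d = p.coeff d := by
  rcases hp.lt_or_eq with h | rfl
  · rw [coeff_eq_zero_of_natDegree_lt h, coeff_eq_zero_of_natDegree_lt (by simpa using h)]
  · rw [coeff_taylor_natDegree, leadingCoeff]

/-- The commutator of two differential operators of orders `d` and `e` has order `d + e - 1`. -/
theorem commutator_mem_polyDegLE {d e : ℤ} {f g : k → k} (hf : f ∈ polyDegLE k d)
    (hg : g ∈ polyDegLE k e) (b c : k) :
    (fun t => f (t + b) * g t - g (t + c) * f t) ∈ polyDegLE k (d + e - 1) := by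
  rcases lt_or_ge d 0 with hd | hd
  · rw [eq_zero_of_mem_polyDegLE hd hf]
    convert (polyDegLE k (d + e - 1)).zero_mem using 1
    funext t
    simp
  rcases lt_or_ge e 0 with he | he
  · rw [eq_zero_of_mem_polyDegLE he hg]
    convert (polyDegLE k (d + e - 1)).zero_mem using 1
    funext t
    simp
  lift d to ℕ using hd
  lift e to ℕ using he
  obtain ⟨p, hp, hf⟩ := mem_polyDegLE_natCast.1 hf
  obtain ⟨q, hq, hg⟩ := mem_polyDegLE_natCast.1 hg
  have hp' : (taylor b p).natDegree ≤ d := by simpa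
  have hq' : (taylor c q).natDegree ≤ e := by simpa
  refine ⟨taylor b p * q - taylor c q * p, fun n hn => ?_,
    fun t => by simp [hf, hg, taylor_eval]⟩
  -- Above `d + e` both products have no coefficient. At `d + e` both have the product of the
  -- coefficients of `p` and `q` in degrees `d` and `e`, which the shifts leave unchanged.
  rcases (show d + e ≤ n by omega).eq_or_lt with rfl | hn
  · rw [coeff_sub, coeff_mul_add_eq_of_natDegree_le hp' hq, add_comm, coeff_mul_add_eq_of_natDegree_le hq' hp,
      coeff_taylor_of_natDegree_le hp, coeff_taylor_of_natDegree_le hq, mul_comm, sub_self]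
  · rw [coeff_sub, coeff_eq_zero_of_natDegree_lt ((natDegree_mul_le_of_le hp' hq).trans_lt hn),
      coeff_eq_zero_of_natDegree_lt ((natDegree_mul_le_of_le hq' hp).trans_lt (by omega)), sub_self]

/-- Functions that are polynomial of degree at most `p i` in the `i`-th variable. -/
def filtration (k : Type u) [Field k] (n : ℕ) (p : Fin n → ℤ) :
    Submodule k ((SymbolOperad k).carrier n) where
  carrier := {f | ∀ i ξ, (fun t => f (Function.update ξ i t)) ∈ polyDegLE k (p i)}
  add_mem' hf hg i ξ := (polyDegLE k (p i)).add_mem (hf i ξ) (hg i ξ)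
  zero_mem' i _ := (polyDegLE k (p i)).zero_mem
  smul_mem' c _ hf i ξ := (polyDegLE k (p i)).smul_mem c (hf i ξ)

/-- A single negative index already kills the symbol. This disposes of the cases of the bracket
axiom in which the inequalities between multiindices fail. -/
theorem eq_zero_of_mem_filtration {n : ℕ} {p : Fin n → ℤ} {i : Fin n} (hi : p i < 0)
    {f : (SymbolOperad k).carrier n} (hf : f ∈ filtration k n p) : f = 0 := by
  funext ξ
  have := congrFun (eq_zero_of_mem_polyDegLE hi (hf i ξ)) (ξ i)
  rwa [Function.update_eq_self] at this

theorem comp_apply {m n r : ℕ} (h : m + n = r + 1) (i : Fin m) (a : (SymbolOperad k).carrier m)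
    (b : (SymbolOperad k).carrier n) (ξ : Fin r → k) :
    (SymbolOperad k).comp h i a b ξ = a (outerFreq h i ξ) * b (innerFreq h i ξ) := rfl

theorem act_apply {n : ℕ} (σ : Perm (Fin n)) (a : (SymbolOperad k).carrier n) (ξ : Fin n → k) :
    (SymbolOperad k).act σ a ξ = a (ξ ∘ σ.symm) := rfl

omit [Field k] in
theorem update_comp_symm {n : ℕ} (σ : Perm (Fin n)) (ξ : Fin n → k) (i : Fin n) (t : k) :
    Function.update ξ i t ∘ σ.symm = Function.update (ξ ∘ σ.symm) (σ i) t := by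
  rw [Function.update_comp_equiv, Equiv.symm_symm]

omit [Field k] in
theorem innerFreq_update_inl {m n r : ℕ} (h : m + n = r + 1) (i : Fin m) (ξ : Fin r → k)
    (x : {x : Fin m // x ≠ i}) (t : k) :
    innerFreq h i (Function.update ξ ((split h i).symm (.inl x)) t) = innerFreq h i ξ := by
  funext y
  simp [innerFreq]

theorem outerFreq_update_inl {m n r : ℕ} (h : m + n = r + 1) (i : Fin m) (ξ : Fin r → k)
    (x : {x : Fin m // x ≠ i}) (t : k) :
    outerFreq h i (Function.update ξ ((split h i).symm (.inl x)) t) =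
      Function.update (outerFreq h i ξ) x t := by
  funext z
  by_cases hz : z = i
  · subst hz
    rw [Function.update_of_ne x.2.symm, outerFreq_self, outerFreq_self, innerFreq_update_inl]
  · rw [outerFreq_ne h i _ hz]
    by_cases hzx : z = x
    · subst hzx
      simp
    · rw [Function.update_of_ne hzx, outerFreq_ne h i _ hz, Function.update_of_ne]
      simpa [Subtype.ext_iff] using hzx

omit [Field k] in
theorem innerFreq_update_inr {m n r : ℕ} (h : m + n = r + 1) (i : Fin m) (ξ : Fin r → k)
    (y : Fin n) (t : k) :
    innerFreq h i (Function.update ξ ((split h i).symm (.inr y)) t) =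
      Function.update (innerFreq h i ξ) y t := by
  funext z
  by_cases hz : z = y
  · subst hz
    simp [innerFreq]
  · rw [Function.update_of_ne hz, innerFreq, innerFreq, Function.update_of_ne]
    simpa using hz

/-- Slot `i` depends on one inner frequency through a translation by the sum of the others.
Translations preserve degrees, hence the entries `b_y + a_i` in `a ∘_i b`. -/
theorem outerFreq_update_inr {m n r : ℕ} (h : m + n = r + 1) (i : Fin m) (ξ : Fin r → k)
    (y : Fin n) (t : k) :
    outerFreq h i (Function.update ξ ((split h i).symm (.inr y)) t) =
      Function.update (outerFreq h i ξ) i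
        (t + ∑ z ∈ Finset.univ.erase y, innerFreq h i ξ z) := by
  funext x
  by_cases hx : x = i
  · subst hx
    rw [Function.update_self, outerFreq_self, innerFreq_update_inr,
      ← Finset.add_sum_erase _ _ (Finset.mem_univ y), Function.update_self]
    congr 1
    exact Finset.sum_congr rfl fun z hz => Function.update_of_ne (Finset.ne_of_mem_erase hz) _ _
  · rw [Function.update_of_ne hx, outerFreq_ne h i _ hx, outerFreq_ne h i _ hx,
      Function.update_of_ne]
    simp

theorem comp_update_mem {m n r : ℕ} (h : m + n = r + 1) (i : Fin m) {p : Fin m → ℤ}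
    {q : Fin n → ℤ} {a : (SymbolOperad k).carrier m} {b : (SymbolOperad k).carrier n}
    (ha : a ∈ filtration k m p) (hb : b ∈ filtration k n q) (s : Fin r) (ξ : Fin r → k) :
    (fun t => (SymbolOperad k).comp h i a b (Function.update ξ s t)) ∈
      polyDegLE k (MultiIndex.comp h i p q s) := by
  obtain ⟨x | y, rfl⟩ := (split h i).symm.surjective s
  · simp only [comp_apply, innerFreq_update_inl, outerFreq_update_inl, MultiIndex.comp,
      Equiv.apply_symm_apply, Sum.elim_inl]
    simpa using mul_mem_polyDegLE (ha x _) (const_mem_polyDegLE _)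
  · simp only [comp_apply, innerFreq_update_inr, outerFreq_update_inr, MultiIndex.comp,
      Equiv.apply_symm_apply, Sum.elim_inr]
    rw [add_comm]
    exact mul_mem_polyDegLE (shift_mem_polyDegLE (ha i _) _) (hb y _)

end SymbolOperad

/-! ### Comparison of the multiindices of composites and of brackets -/

namespace MultiIndex

open OperadComp

theorem comp_lt {m n r : ℕ} (h : m + n = r + 1) (i : Fin m) (p : Fin m → ℤ) (q : Fin n → ℤ)
    {s : Fin r} (hs : s.1 < i.1) : comp h i p q s = p ⟨s.1, by omega⟩ := by
  simp [comp, split, hs]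

theorem comp_mid {m n r : ℕ} (h : m + n = r + 1) (i : Fin m) (p : Fin m → ℤ) (q : Fin n → ℤ)
    {s : Fin r} (hs : i.1 ≤ s.1) (hs' : s.1 < i.1 + n) :
    comp h i p q s = q ⟨s.1 - i.1, by omega⟩ + p i := by
  simp [comp, split, hs.not_gt, hs']

theorem comp_gt {m n r : ℕ} (h : m + n = r + 1) (i : Fin m) (p : Fin m → ℤ) (q : Fin n → ℤ)
    {s : Fin r} (hs : i.1 + n ≤ s.1) (hs' : i.1 ≤ s.1) :
    comp h i p q s = p ⟨s.1 + 1 - n, by omega⟩ := by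
  simp [comp, split, hs.not_gt, hs'.not_gt]

end MultiIndex

namespace MultiIndex

open OperadComp

/-- At an input of `b` the two sides agree; at an input of `a` the bracket has the extra summand
`b_j`, whence the sign condition. Only at the common input is the bracket index smaller than that of
the composite, by one. -/
theorem comp_le_bracket {m n r : ℕ} (h : m + n = r + 1) (i : Fin m) (j : Fin n)
    (p : Fin m → ℤ) (q : Fin n → ℤ) (hq : 0 ≤ q j) (s : Fin r)
    (hs : s.1 ≠ i.1 + j.1) :
    comp h i p q (blockSwap r 0 i.1 j.1 (by omega) s) ≤ bracket h i j p q s := by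
  have hv : (blockSwap r 0 i.1 j.1 (by omega) s).1 =
      if s.1 < j.1 then s.1 + i.1 else if s.1 < i.1 + j.1 then s.1 - j.1 else s.1 := by
    simp only [blockSwap, Equiv.coe_fn_mk]
    split_ifs <;> (try simp) <;> omega
  unfold bracket
  split_ifs with h₁ h₂ h₃
  · rw [if_pos h₁] at hv
    rw [comp_mid _ _ _ _ (by omega) (by omega)]
    exact le_of_eq (by congr 3; omega)
  · rw [if_neg h₁, if_pos h₂] at hv
    rw [comp_lt _ _ _ _ (by omega)]
    exact (le_add_of_nonneg_right hq).trans_eq' (by congr 2; omega)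
  · rw [if_neg h₁, if_neg h₂] at hv
    rw [comp_mid _ _ _ _ (by omega) (by omega)]
    exact le_of_eq (by congr 3; omega)
  · rw [if_neg h₁, if_neg h₂] at hv
    rw [comp_gt _ _ _ _ (by omega) (by omega)]
    exact (le_add_of_nonneg_right hq).trans_eq' (by congr 2; omega)

theorem comp_le_bracket' {m n r : ℕ} (h : m + n = r + 1) (i : Fin m) (j : Fin n)
    (p : Fin m → ℤ) (q : Fin n → ℤ) (hp : 0 ≤ p i) (s : Fin r)
    (hs : s.1 ≠ i.1 + j.1) :
    comp ((Nat.add_comm n m).trans h) j q p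
      (blockSwap r (i.1 + j.1 + 1) (m - 1 - i.1) (n - 1 - j.1) (by omega) s) ≤
        bracket h i j p q s := by
  have hv : (blockSwap r (i.1 + j.1 + 1) (m - 1 - i.1) (n - 1 - j.1) (by omega) s).1 =
      if s.1 < i.1 + j.1 then s.1 else if s.1 < i.1 + n then s.1 + (m - 1 - i.1)
        else s.1 - (n - 1 - j.1) := by
    simp only [blockSwap, Equiv.coe_fn_mk]
    split_ifs <;> (try simp) <;> omega
  unfold bracket
  split_ifs with h₁ h₂ h₃
  · rw [if_pos (by omega)] at hv
    rw [comp_lt _ _ _ _ (by omega)]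
    exact (le_add_of_nonneg_right hp).trans_eq' (by congr 2; omega)
  · rw [if_pos (by omega)] at hv
    rw [comp_mid _ _ _ _ (by omega) (by omega)]
    exact le_of_eq (by congr 3; omega)
  · rw [if_neg h₂, if_pos h₃] at hv
    rw [comp_gt _ _ _ _ (by omega) (by omega)]
    exact (le_add_of_nonneg_right hp).trans_eq' (by congr 2; omega)
  · rw [if_neg h₂, if_neg h₃] at hv
    rw [comp_mid _ _ _ _ (by omega) (by omega)]
    exact le_of_eq (by congr 3; omega)

end MultiIndex

/-! ### The filtration of symbols by degrees is a saturated multifiltration -/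

namespace SymbolOperad

open OperadComp

variable {k : Type u} [Field k]

/-- As functions of the common frequency `t`, let `f` be `a` in slot `i` and `g` be `b` in slot `j`,
the other slots being frozen. The two composites are `f (t + b') * g t` and `g (t + c') * f t`, with
`b'` and `c'` the sums of the remaining inner frequencies, so `commutator_mem_polyDegLE` applies. -/
theorem bracket_common_mem {m n r : ℕ} (h : m + n = r + 1) (i : Fin m) (j : Fin n)
    {p : Fin m → ℤ} {q : Fin n → ℤ} {a : (SymbolOperad k).carrier m}
    {b : (SymbolOperad k).carrier n} (ha : a ∈ filtration k m p) (hb : b ∈ filtration k n q)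
    (ξ : Fin r → k) :
    (fun t => (SymbolOperad k).bracket h i j a b
      (Function.update ξ ⟨i.1 + j.1, by omega⟩ t)) ∈ polyDegLE k (p i + q j - 1) := by
  set σ := blockSwap r 0 i.1 j.1 (by omega)
  set τ := blockSwap r (i.1 + j.1 + 1) (m - 1 - i.1) (n - 1 - j.1) (by omega)
  have h' : n + m = r + 1 := (Nat.add_comm n m).trans h
  have hσ : σ ⟨i.1 + j.1, by omega⟩ = (split h i).symm (.inr j) := by
    ext
    simp [σ, blockSwap, split, add_comm]
  have hτ : τ ⟨i.1 + j.1, by omega⟩ = (split h' j).symm (.inr i) := by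
    ext
    simp [τ, blockSwap, split, add_comm]
  -- The permutations `σ` and `τ` are chosen so that the slots of `a` other than `i` carry the same
  -- frequencies in both composites; `eb` is the same for `b`.
  have ea : ∀ t, Function.update (outerFreq h i (ξ ∘ σ.symm)) i t =
      Function.update (innerFreq h' j (ξ ∘ τ.symm)) i t := by
    intro t
    refine Function.update_eq_iff.2 ⟨by simp, fun x hx => ?_⟩
    rw [Function.update_of_ne hx, innerFreq_apply]
    rcases Nat.lt_or_gt_of_ne (Fin.val_ne_of_ne hx) with hx | hx
    · rw [outerFreq_lt _ _ _ hx, Function.comp_apply, Function.comp_apply]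
      congr 1
      ext
      simp only [σ, τ, blockSwap, Equiv.coe_fn_symm_mk]
      split_ifs <;> simp <;> omega
    · rw [outerFreq_gt _ _ _ hx, Function.comp_apply, Function.comp_apply]
      congr 1
      ext
      simp only [σ, τ, blockSwap, Equiv.coe_fn_symm_mk]
      split_ifs <;> simp <;> omega
  have eb : ∀ t, Function.update (outerFreq h' j (ξ ∘ τ.symm)) j t =
      Function.update (innerFreq h i (ξ ∘ σ.symm)) j t := by
    intro t
    refine Function.update_eq_iff.2 ⟨by simp, fun x hx => ?_⟩
    rw [Function.update_of_ne hx, innerFreq_apply]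
    rcases Nat.lt_or_gt_of_ne (Fin.val_ne_of_ne hx) with hx | hx
    · rw [outerFreq_lt _ _ _ hx, Function.comp_apply, Function.comp_apply]
      congr 1
      ext
      simp only [σ, τ, blockSwap, Equiv.coe_fn_symm_mk]
      split_ifs <;> simp <;> omega
    · rw [outerFreq_gt _ _ _ hx, Function.comp_apply, Function.comp_apply]
      congr 1
      ext
      simp only [σ, τ, blockSwap, Equiv.coe_fn_symm_mk]
      split_ifs <;> simp <;> omega
  have e : ∀ t, (SymbolOperad k).bracket h i j a b (Function.update ξ ⟨i.1 + j.1, by omega⟩ t) =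
      (SymbolOperad k).comp h i a b
        (Function.update (ξ ∘ σ.symm) ((split h i).symm (.inr j)) t) -
      (SymbolOperad k).comp h' j b a
        (Function.update (ξ ∘ τ.symm) ((split h' j).symm (.inr i)) t) := by
    intro t
    rw [← hσ, ← hτ, ← update_comp_symm, ← update_comp_symm]
    rfl
  simp only [e, comp_apply, innerFreq_update_inr, outerFreq_update_inr, ea, eb]
  simp only [← ea, ← eb]
  exact commutator_mem_polyDegLE (ha i _) (hb j _) _ _

theorem bracket_update_mem {m n r : ℕ} (h : m + n = r + 1) (i : Fin m) (j : Fin n)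
    {p : Fin m → ℤ} {q : Fin n → ℤ} {a : (SymbolOperad k).carrier m}
    {b : (SymbolOperad k).carrier n} (ha : a ∈ filtration k m p) (hb : b ∈ filtration k n q)
    (hp : 0 ≤ p i) (hq : 0 ≤ q j) (s : Fin r) (hs : s.1 ≠ i.1 + j.1) (ξ : Fin r → k) :
    (fun t => (SymbolOperad k).bracket h i j a b (Function.update ξ s t)) ∈
      polyDegLE k (MultiIndex.bracket h i j p q s) := by
  have h' : n + m = r + 1 := (Nat.add_comm n m).trans h
  have key : ∀ (f : (SymbolOperad k).carrier r) (σ : Perm (Fin r)) (t : k),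
      (SymbolOperad k).act σ f (Function.update ξ s t) =
        f (Function.update (ξ ∘ σ.symm) (σ s) t) := fun f σ t => by
    rw [act_apply, update_comp_symm]
  have e : ∀ t, (SymbolOperad k).bracket h i j a b (Function.update ξ s t) =
      (SymbolOperad k).act (blockSwap r 0 i.1 j.1 (by omega)) ((SymbolOperad k).comp h i a b)
        (Function.update ξ s t) -
      (SymbolOperad k).act (blockSwap r (i.1 + j.1 + 1) (m - 1 - i.1) (n - 1 - j.1) (by omega))
        ((SymbolOperad k).comp h' j b a) (Function.update ξ s t) := fun _ => rfl
  simp only [e, key]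
  refine (polyDegLE k _).sub_mem (polyDegLE_mono ?_ (comp_update_mem h i ha hb _ _))
    (polyDegLE_mono ?_ (comp_update_mem h' j hb ha _ _))
  · exact MultiIndex.comp_le_bracket h i j p q hq s hs
  · exact MultiIndex.comp_le_bracket' h i j p q hp s hs

theorem isMultifiltration : (SymbolOperad k).IsMultifiltration (filtration k) where
  mono n p q hpq f hf i ξ := polyDegLE_mono (hpq i) (hf i ξ)
  equivariant n p σ := by
    ext f
    constructor
    · rintro ⟨f, hf, rfl⟩ i ξ
      simp only [act_apply, update_comp_symm]
      exact hf _ _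
    · intro hf
      refine ⟨(SymbolOperad k).act σ⁻¹ f, fun i ξ => ?_, ?_⟩
      · simp only [act_apply, update_comp_symm]
        simpa using hf (σ⁻¹ i) (ξ ∘ σ⁻¹.symm)
      · rw [← (SymbolOperad k).act_mul, inv_mul_cancel, (SymbolOperad k).act_one]
  comp_mem h i p q a b ha hb s ξ := comp_update_mem h i ha hb s ξ
  one_mem _ _ := const_mem_polyDegLE 1
  bracket_mem {m n r} h i j p q a b ha hb := by
    -- If `p i` or `q j` is negative, then `a` or `b` vanishes and so does the bracket.
    by_cases hp : 0 ≤ p i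
    · by_cases hq : 0 ≤ q j
      · intro s ξ
        by_cases hs : s.1 = i.1 + j.1
        · have hr : i.1 + j.1 < r := by omega
          obtain rfl : s = ⟨i.1 + j.1, hr⟩ := Fin.ext hs
          have : MultiIndex.bracket h i j p q ⟨i.1 + j.1, hr⟩ = p i + q j - 1 := by
            simp [MultiIndex.bracket]
          rw [this]
          exact bracket_common_mem h i j ha hb ξ
        · exact bracket_update_mem h i j ha hb hp hq s hs ξ
      · obtain rfl := eq_zero_of_mem_filtration (not_le.1 hq) hb
        simp [LinOperad.bracket]
    · obtain rfl := eq_zero_of_mem_filtration (not_le.1 hp) ha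
      simp [LinOperad.bracket]

theorem isSaturated : (SymbolOperad k).IsSaturated (filtration k) :=
  fun _ p q _ hf i ξ => polyDegLE_inf (p i) (q i) ⟨hf.1 i ξ, hf.2 i ξ⟩

end SymbolOperad

/-! ### Morphisms of operads, ideals and preimages of multifiltrations -/

namespace LinOperad

variable {k : Type u} [Field k]

namespace Hom

variable {P : LinOperad.{u, v} k} {Q : LinOperad.{u, w} k} {S : LinOperad.{u, w'} k}

/-- The composition of morphisms of operads. -/
def comp (ψ : Hom Q S) (φ : Hom P Q) : Hom P S where
  app n := ψ.app n ∘ₗ φ.app n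
  map_one := by simp [φ.map_one, ψ.map_one]
  map_act := by simp [φ.map_act, ψ.map_act]
  map_comp := by simp [φ.map_comp, ψ.map_comp]

/-- The inverse of a bijective morphism of operads. -/
noncomputable def inverse (φ : Hom P Q) (h : ∀ n, Function.Bijective (φ.app n)) : Hom Q P where
  app n := (LinearEquiv.ofBijective (φ.app n) (h n)).symm
  map_one := by simp [LinearEquiv.symm_apply_eq, φ.map_one]
  map_act {n} σ a := by
    obtain ⟨a, rfl⟩ := (h n).2 a
    have e : ∀ x, (LinearEquiv.ofBijective (φ.app n) (h n)).symm (φ.app n x) = x :=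
      (LinearEquiv.ofBijective (φ.app n) (h n)).symm_apply_apply
    simp [← φ.map_act, e]
  map_comp {m n r} hr i a b := by
    obtain ⟨a, rfl⟩ := (h m).2 a
    obtain ⟨b, rfl⟩ := (h n).2 b
    have e : ∀ n x, (LinearEquiv.ofBijective (φ.app n) (h n)).symm (φ.app n x) = x :=
      fun n => (LinearEquiv.ofBijective (φ.app n) (h n)).symm_apply_apply
    simp [← φ.map_comp, e]

theorem inverse_bijective (φ : Hom P Q) (h : ∀ n, Function.Bijective (φ.app n)) (n : ℕ) :
    Function.Bijective ((φ.inverse h).app n) :=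
  (LinearEquiv.ofBijective (φ.app n) (h n)).symm.bijective

/-- The preimage of an operadic ideal. -/
def comapIdeal (φ : Hom P Q) (I : OpIdeal Q) : OpIdeal P where
  sub n := (I.sub n).comap (φ.app n)
  act_mem σ a ha := by simpa [φ.map_act] using I.act_mem σ ha
  comp_mem_left h i a b ha := by simpa [φ.map_comp] using I.comp_mem_left h i _ ha
  comp_mem_right h i a b hb := by simpa [φ.map_comp] using I.comp_mem_right h i _ hb

/-- The kernel of a morphism of operads. -/
def kerIdeal (φ : Hom P Q) : OpIdeal P where
  sub n := LinearMap.ker (φ.app n)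
  act_mem σ a ha := by simp_all [φ.map_act]
  comp_mem_left h i a b ha := by simp_all [φ.map_comp]
  comp_mem_right h i a b hb := by simp_all [φ.map_comp]

theorem map_bracket (φ : Hom P Q) {m n r : ℕ} (h : m + n = r + 1) (i : Fin m) (j : Fin n)
    (a : P.carrier m) (b : P.carrier n) :
    φ.app r (P.bracket h i j a b) = Q.bracket h i j (φ.app m a) (φ.app n b) := by
  simp [bracket, φ.map_act, φ.map_comp]

theorem map_leftComb (φ : Hom P Q) (μ : P.carrier 2) :
    φ.app 3 (P.leftComb μ) = Q.leftComb (φ.app 2 μ) := φ.map_comp _ _ _ _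

theorem map_rightComb (φ : Hom P Q) (μ : P.carrier 2) :
    φ.app 3 (P.rightComb μ) = Q.rightComb (φ.app 2 μ) := φ.map_comp _ _ _ _

theorem map_jacobiator (φ : Hom P Q) (μ : P.carrier 2) :
    φ.app 3 (P.jacobiator μ) = Q.jacobiator (φ.app 2 μ) := by
  simp [jacobiator, map_rightComb, φ.map_act]

theorem isMultifiltration_comap (φ : Hom P Q)
    {F : ∀ n : ℕ, (Fin n → ℤ) → Submodule k (Q.carrier n)} (hF : Q.IsMultifiltration F) :
    P.IsMultifiltration fun n p => (F n p).comap (φ.app n) where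
  mono n p q hpq := Submodule.comap_mono (hF.mono n p q hpq)
  equivariant n p σ := by
    -- Equivariance is an equality of subspaces, but inclusions for all permutations suffice: the
    -- reverse one comes from `σ⁻¹`.
    have key : ∀ (p : Fin n → ℤ) (σ : Perm (Fin n)), ∀ x ∈ F n p,
        Q.act σ x ∈ F n fun i => p (σ i) :=
      fun p σ x hx => hF.equivariant n p σ ▸ Submodule.mem_map_of_mem hx
    ext x
    constructor
    · rintro ⟨x, hx, rfl⟩
      simpa [φ.map_act] using key p σ _ hx
    · intro hx
      refine ⟨P.act σ⁻¹ x, ?_, by rw [← P.act_mul, inv_mul_cancel, P.act_one]⟩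
      simpa [φ.map_act] using key _ σ⁻¹ _ hx
  comp_mem h i p q a b ha hb := by simpa [φ.map_comp] using hF.comp_mem h i p q _ _ ha hb
  one_mem := by simpa [φ.map_one] using hF.one_mem
  bracket_mem h i j p q a b ha hb := by
    simpa [φ.map_bracket] using hF.bracket_mem h i j p q _ _ ha hb

theorem isSaturated_comap (φ : Hom P Q)
    {F : ∀ n : ℕ, (Fin n → ℤ) → Submodule k (Q.carrier n)} (hF : Q.IsSaturated F) :
    P.IsSaturated fun n p => (F n p).comap (φ.app n) :=
  fun n p q _ hx => hF n p q hx

end Hom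

variable {P : LinOperad.{u, v} k} {Q : LinOperad.{u, w} k}

theorem mem_standardMultifiltration {E : ∀ n, Submodule k (P.carrier n)} {n : ℕ}
    {p : Fin n → ℤ} {x : P.carrier n} :
    x ∈ P.standardMultifiltration E n p ↔
      ∀ F, P.IsMultifiltration F → P.IsSaturated F → (∀ m, E m ≤ F m fun _ => 1) → x ∈ F n p := by
  simp only [standardMultifiltration, Submodule.mem_iInf]

/-- The preimage of `F` is one of the multifiltrations whose intersection is the standard one. All
upper bounds on the standard multifiltration are obtained this way. -/
theorem Hom.map_mem_of_mem_standard (φ : Hom P Q) {E : ∀ n, Submodule k (P.carrier n)}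
    {F : ∀ n : ℕ, (Fin n → ℤ) → Submodule k (Q.carrier n)} (hF : Q.IsMultifiltration F)
    (hF' : Q.IsSaturated F) (hE : ∀ m, ∀ x ∈ E m, φ.app m x ∈ F m fun _ => 1) {n : ℕ}
    {p : Fin n → ℤ} {x : P.carrier n} (hx : x ∈ P.standardMultifiltration E n p) :
    φ.app n x ∈ F n p :=
  mem_standardMultifiltration.1 hx _ (φ.isMultifiltration_comap hF) (φ.isSaturated_comap hF') hE

theorem Hom.map_standardMultifiltration (φ : Hom P Q) {E : ∀ n, Submodule k (P.carrier n)}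
    {E' : ∀ n, Submodule k (Q.carrier n)} (hE : ∀ m, ∀ x ∈ E m, φ.app m x ∈ E' m) {n : ℕ}
    {p : Fin n → ℤ} {x : P.carrier n} (hx : x ∈ P.standardMultifiltration E n p) :
    φ.app n x ∈ Q.standardMultifiltration E' n p :=
  mem_standardMultifiltration.2 fun _ hF hF' h =>
    φ.map_mem_of_mem_standard hF hF' (fun m x hx => h m (hE m x hx)) hx

/-- A constant multiindex is fixed by every permutation, so its piece is `Σ`-stable. -/
theorem act_mem_standardMultifiltration_const {E : ∀ n, Submodule k (P.carrier n)} {n : ℕ}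
    {c : ℤ} {x : P.carrier n} (σ : Perm (Fin n))
    (hx : x ∈ P.standardMultifiltration E n fun _ => c) :
    P.act σ x ∈ P.standardMultifiltration E n fun _ => c :=
  mem_standardMultifiltration.2 fun F hF hF' h =>
    hF.equivariant n (fun _ => c) σ ▸
      Submodule.mem_map_of_mem (mem_standardMultifiltration.1 hx F hF hF' h)

theorem mem_idealSpan {R : ∀ n, Set (P.carrier n)} {n : ℕ} {x : P.carrier n} :
    x ∈ (P.idealSpan R).sub n ↔ ∀ I : OpIdeal P, (∀ m, R m ⊆ I.sub m) → x ∈ I.sub n := by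
  simp only [idealSpan, Submodule.mem_iInf]

theorem subset_idealSpan (R : ∀ n, Set (P.carrier n)) (n : ℕ) :
    R n ⊆ (P.idealSpan R).sub n :=
  fun _ hx => mem_idealSpan.2 fun _ hI => hI n hx

theorem idealSpan_le {R : ∀ n, Set (P.carrier n)} {I : OpIdeal P} (h : ∀ m, R m ⊆ I.sub m)
    (n : ℕ) : (P.idealSpan R).sub n ≤ I.sub n :=
  fun _ hx => mem_idealSpan.1 hx I h

/-- The zero ideal. -/
def zeroIdeal (P : LinOperad.{u, v} k) : OpIdeal P where
  sub _ := ⊥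
  act_mem σ a ha := by simp_all
  comp_mem_left h i a b ha := by simp_all
  comp_mem_right h i a b hb := by simp_all

theorem idealSpan_eq_bot {R : ∀ n, Set (P.carrier n)} (h : ∀ n, R n ⊆ {0}) (n : ℕ) :
    (P.idealSpan R).sub n = ⊥ :=
  le_bot_iff.1 (idealSpan_le (I := P.zeroIdeal) (fun m => by simpa [zeroIdeal] using h m) n)

theorem oneRelation_subset {m : ℕ} {r : P.carrier m} {S : ∀ n, Set (P.carrier n)} (hr : r ∈ S m)
    (n : ℕ) : P.oneRelation r n ⊆ S n := by
  intro x hx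
  obtain ⟨rfl, hx⟩ := Sigma.mk.inj_iff.1 (hx : (⟨n, x⟩ : Sigma P.carrier) = ⟨m, r⟩)
  rwa [eq_of_heq hx]

theorem self_mem_oneRelation {m : ℕ} (r : P.carrier m) : r ∈ P.oneRelation r m :=
  show (⟨m, r⟩ : Sigma P.carrier) = ⟨m, r⟩ from rfl

/-- The projection onto a quotient operad. -/
def quotientMap (P : LinOperad.{u, v} k) (I : OpIdeal P) : Hom P (P.quotient I) where
  app n := (I.sub n).mkQ
  map_one := rfl
  map_act _ _ := rfl
  map_comp _ _ _ _ := rfl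

theorem quotientMap_surjective (I : OpIdeal P) (n : ℕ) :
    Function.Surjective ((P.quotientMap I).app n) := Submodule.mkQ_surjective _

theorem ker_quotientMap (I : OpIdeal P) (n : ℕ) :
    LinearMap.ker ((P.quotientMap I).app n) = I.sub n := Submodule.ker_mkQ _

theorem Hom.isomorphic_of_bijective (φ : Hom P Q) (h : ∀ n, Function.Bijective (φ.app n)) :
    Q.Isomorphic P := ⟨φ.inverse h, φ.inverse_bijective h⟩

/-- The first isomorphism theorem for operads. -/
theorem Hom.isomorphic_quotient (φ : Hom P Q) (I : OpIdeal P)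
    (hs : ∀ n, Function.Surjective (φ.app n)) (hk : ∀ n, LinearMap.ker (φ.app n) = I.sub n) :
    Q.Isomorphic (P.quotient I) := by
  let ψ : Hom (P.quotient I) Q :=
    { app := fun n => (I.sub n).liftQ (φ.app n) (hk n).ge
      map_one := φ.map_one
      map_act := fun {n} σ a => by
        obtain ⟨a, rfl⟩ := Submodule.Quotient.mk_surjective _ a
        exact φ.map_act σ a
      map_comp := fun h i a b => by
        obtain ⟨a, rfl⟩ := Submodule.Quotient.mk_surjective _ a
        obtain ⟨b, rfl⟩ := Submodule.Quotient.mk_surjective _ b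
        exact φ.map_comp h i a b }
  refine ψ.isomorphic_of_bijective fun n => ⟨?_, ?_⟩
  · exact LinearMap.ker_eq_bot.1 (Submodule.ker_liftQ_eq_bot _ _ _ (hk n).le)
  · intro y
    obtain ⟨x, rfl⟩ := hs n y
    exact ⟨Submodule.Quotient.mk x, rfl⟩

end LinOperad

/-! ### Induction in a free operad -/

namespace FreeOperad

variable {k : Type u} [Field k] {E : SigmaModule.{u, v} k}

theorem mem_of_closed {S : ∀ n, Submodule k ((FreeOperad E).carrier n)}
    (hgen : ∀ n x, gen E n x ∈ S n) (hone : (FreeOperad E).one ∈ S 1)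
    (hact : ∀ {n} (σ : Perm (Fin n)), ∀ x ∈ S n, (FreeOperad E).act σ x ∈ S n)
    (hcomp : ∀ {m n r} (h : m + n = r + 1) (i : Fin m), ∀ x ∈ S m, ∀ y ∈ S n,
      (FreeOperad E).comp h i x y ∈ S r) {n : ℕ} (x : (FreeOperad E).carrier n) : x ∈ S n := by
  refine Quot.ind (fun t => ?_) x
  clear x
  induction t with
  | zero n => exact (S n).zero_mem
  | add s t hs ht => exact (S _).add_mem hs ht
  | smul c t ht => exact (S _).smul_mem c ht
  | gen x => exact hgen _ x
  | one => exact hone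
  | act σ t ht => exact hact σ _ ht
  | comp h i s t hs ht => exact hcomp h i _ hs _ ht

theorem hom_ext {P : LinOperad.{u, w} k} {φ ψ : LinOperad.Hom (FreeOperad E) P}
    (h : ∀ n x, φ.app n (gen E n x) = ψ.app n (gen E n x)) {n : ℕ}
    (x : (FreeOperad E).carrier n) : φ.app n x = ψ.app n x := by
  refine mem_of_closed (S := fun n => LinearMap.eqLocus (φ.app n) (ψ.app n)) h ?_ ?_ ?_ x
  · simp [φ.map_one, ψ.map_one]
  · intro n σ x hx
    simp_all [φ.map_act, ψ.map_act]
  · intro m n r h i x hx y hy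
    simp_all [φ.map_comp, ψ.map_comp]

theorem act_gen {n : ℕ} (σ : Perm (Fin n)) (x : E.carrier n) :
    (FreeOperad E).act σ (gen E n x) = gen E n (E.act σ x) :=
  (Quot.sound (.gen_act σ x)).symm

/-! ### Low arities of a free operad on binary operations -/

/-- Nothing of arity zero occurs and arity one contains only multiples of the unit. A composite of
two elements of arity at least two therefore has arity at least three, with arity three only for two
generators. -/
theorem mem_of_lowArity_closed (hE : ∀ n, n ≠ 2 → Subsingleton (E.carrier n))
    {S : ∀ n, Submodule k ((FreeOperad E).carrier n)} (h0 : S 0 = ⊥)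
    (h1 : S 1 = Submodule.span k {(FreeOperad E).one}) (h2 : S 2 = LinearMap.range (gen E 2))
    (h4 : ∀ n, 4 ≤ n → S n = ⊤) (hact : ∀ (σ : Perm (Fin 3)), ∀ x ∈ S 3, (FreeOperad E).act σ x ∈ S 3)
    (h3 : ∀ i x y, (FreeOperad E).comp (rfl : 2 + 2 = 3 + 1) i (gen E 2 x) (gen E 2 y) ∈ S 3)
    {n : ℕ} (x : (FreeOperad E).carrier n) : x ∈ S n := by
  refine mem_of_closed ?_ ?_ ?_ ?_ x
  · intro n x
    by_cases hn : n = 2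
    · subst hn
      rw [h2]
      exact ⟨x, rfl⟩
    · have := hE n hn
      rw [Subsingleton.elim x 0, map_zero]
      exact (S n).zero_mem
  · rw [h1]
    exact Submodule.mem_span_singleton_self _
  · intro n σ x hx
    match n with
    | 0 => rwa [Subsingleton.elim σ 1, (FreeOperad E).act_one]
    | 1 => rwa [Subsingleton.elim σ 1, (FreeOperad E).act_one]
    | 2 =>
      rw [h2] at hx ⊢
      obtain ⟨x, rfl⟩ := hx
      exact ⟨_, (act_gen σ x).symm⟩
    | 3 => exact hact σ x hx
    | n + 4 => simp [h4 (n + 4) (by omega)]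
  · intro m n r h i x hx y hy
    match m, n with
    | 0, _ => exact i.elim0
    | _, 0 =>
      rw [h0, Submodule.mem_bot] at hy
      simp [hy]
    | 1, n =>
      rw [h1, Submodule.mem_span_singleton] at hx
      obtain ⟨c, rfl⟩ := hx
      obtain rfl : n = r := by omega
      rw [Subsingleton.elim i 0, map_smul, LinearMap.smul_apply, (FreeOperad E).one_comp]
      exact (S n).smul_mem c hy
    | m, 1 =>
      rw [h1, Submodule.mem_span_singleton] at hy
      obtain ⟨c, rfl⟩ := hy
      obtain rfl : m = r := by omega
      rw [map_smul, (FreeOperad E).comp_one]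
      exact (S m).smul_mem c hx
    | 2, 2 =>
      obtain rfl : r = 3 := by omega
      rw [h2] at hx hy
      obtain ⟨x, rfl⟩ := hx
      obtain ⟨y, rfl⟩ := hy
      exact h3 i x y
    | m + 3, n + 2 => simp [h4 r (by omega)]
    | m + 2, n + 3 => simp [h4 r (by omega)]

end FreeOperad

namespace FreeOperad

variable {k : Type u} [Field k] {E : SigmaModule.{u, v} k}

/-- The part of weight two of the free operad. -/
def weightTwo (E : SigmaModule.{u, v} k) (r : ℕ) : Submodule k ((FreeOperad E).carrier r) :=
  Submodule.span k {z | ∃ (m n : ℕ) (h : m + n = r + 1) (i : Fin m) (x : E.carrier m)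
    (y : E.carrier n) (σ : Perm (Fin r)),
    z = (FreeOperad E).act σ ((FreeOperad E).comp h i (gen _ m x) (gen _ n y))}

theorem act_mem_weightTwo {r : ℕ} (σ : Perm (Fin r)) {x : (FreeOperad E).carrier r}
    (hx : x ∈ weightTwo E r) : (FreeOperad E).act σ x ∈ weightTwo E r := by
  refine Submodule.span_induction (p := fun x _ => (FreeOperad E).act σ x ∈ weightTwo E r)
    ?_ ?_ ?_ ?_ hx
  · rintro x ⟨m, n, h, i, a, b, τ, rfl⟩
    exact Submodule.subset_span ⟨m, n, h, i, a, b, τ * σ, ((FreeOperad E).act_mul τ σ _).symm⟩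
  · simp
  · intro x y _ _ hx hy
    simpa using Submodule.add_mem _ hx hy
  · intro c x _ hx
    simpa using Submodule.smul_mem _ c hx

/-- The low arities of a free operad on binary operations. -/
def lowArity (E : SigmaModule.{u, v} k) : ∀ n, Submodule k ((FreeOperad E).carrier n)
  | 0 => ⊥
  | 1 => Submodule.span k {(FreeOperad E).one}
  | 2 => LinearMap.range (gen E 2)
  | 3 => weightTwo E 3
  | _ + 4 => ⊤

section

variable (hE : ∀ n, n ≠ 2 → Subsingleton (E.carrier n))

include hE

theorem mem_lowArity {n : ℕ} (x : (FreeOperad E).carrier n) : x ∈ lowArity E n := by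
  refine mem_of_lowArity_closed hE (S := lowArity E) rfl rfl rfl ?_ (fun σ x => act_mem_weightTwo σ) ?_ x
  · rintro (_ | _ | _ | _ | n) hn <;> first | omega | rfl
  · intro i x y
    exact Submodule.subset_span ⟨2, 2, rfl, i, x, y, 1, ((FreeOperad E).act_one _).symm⟩

theorem arity_zero (x : (FreeOperad E).carrier 0) : x = 0 := mem_lowArity hE x

theorem arity_one (x : (FreeOperad E).carrier 1) : ∃ c : k, c • (FreeOperad E).one = x :=
  Submodule.mem_span_singleton.1 (mem_lowArity hE x)

theorem arity_two (x : (FreeOperad E).carrier 2) : ∃ e, gen E 2 e = x := mem_lowArity hE x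

theorem arity_three (x : (FreeOperad E).carrier 3) : x ∈ weightTwo E 3 := mem_lowArity hE x

theorem weightTwo_eq_bot {r : ℕ} (hr : r ≠ 3) : weightTwo E r = ⊥ := by
  refine Submodule.span_eq_bot.2 ?_
  rintro z ⟨m, n, h, i, x, y, σ, rfl⟩
  by_cases hm : m = 2
  · have := hE n (by omega)
    rw [Subsingleton.elim y 0]
    simp
  · have := hE m hm
    rw [Subsingleton.elim x 0]
    simp

end

/-- A collection of subspaces that vanishes below arity three and is everything above. -/
def fromThree (J : Submodule k ((FreeOperad E).carrier 3)) :
    ∀ n, Submodule k ((FreeOperad E).carrier n)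
  | 0 => ⊥
  | 1 => ⊥
  | 2 => ⊥
  | 3 => J
  | _ + 4 => ⊤

theorem fromThree_of_lt (J : Submodule k ((FreeOperad E).carrier 3)) {n : ℕ} (hn : n < 3) :
    fromThree J n = ⊥ := by
  match n with
  | 0 => rfl
  | 1 => rfl
  | 2 => rfl

theorem fromThree_of_gt (J : Submodule k ((FreeOperad E).carrier 3)) {n : ℕ} (hn : 3 < n) :
    fromThree J n = ⊤ := by
  match n with
  | n + 4 => rfl

/-- For a free operad on binary operations, a `Σ`-stable subspace in arity three together with
everything in higher arities is an ideal. -/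
def idealFromThree (hE : ∀ n, n ≠ 2 → Subsingleton (E.carrier n))
    (J : Submodule k ((FreeOperad E).carrier 3))
    (hJ : ∀ (σ : Perm (Fin 3)), ∀ x ∈ J, (FreeOperad E).act σ x ∈ J) :
    LinOperad.OpIdeal (FreeOperad E) where
  sub := fromThree J
  act_mem {n} σ a ha := by
    rcases lt_trichotomy n 3 with hn | rfl | hn
    · rw [fromThree_of_lt J hn, Submodule.mem_bot] at ha ⊢
      simp [ha]
    · exact hJ σ a ha
    · simp [fromThree_of_gt J hn]
  comp_mem_left {m n r} h i a b ha := by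
    rcases lt_trichotomy m 3 with hm | rfl | hm
    · rw [fromThree_of_lt J hm, Submodule.mem_bot] at ha
      simp [ha]
    · match n with
      | 0 => simp [arity_zero hE b]
      | 1 =>
        obtain rfl : r = 3 := by omega
        obtain ⟨c, rfl⟩ := arity_one hE b
        rw [map_smul, (FreeOperad E).comp_one]
        exact J.smul_mem c ha
      | n + 2 => simp [fromThree_of_gt J (show 3 < r by omega)]
    · match n with
      | 0 => simp [arity_zero hE b]
      | n + 1 => simp [fromThree_of_gt J (show 3 < r by omega)]
  comp_mem_right {m n r} h i a b hb := by
    rcases lt_trichotomy n 3 with hn | rfl | hn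
    · rw [fromThree_of_lt J hn, Submodule.mem_bot] at hb
      simp [hb]
    · match m with
      | 0 => exact i.elim0
      | 1 =>
        obtain rfl : r = 3 := by omega
        obtain ⟨c, rfl⟩ := arity_one hE a
        rw [Subsingleton.elim i 0, map_smul, LinearMap.smul_apply, (FreeOperad E).one_comp]
        exact J.smul_mem c hb
      | m + 2 => simp [fromThree_of_gt J (show 3 < r by omega)]
    · simp [fromThree_of_gt J (show 3 < r by have := i.2; omega)]

/-- Composition with anything but multiples of the unit raises the arity, so relations of arity at
least three generate nothing below arity three, and in arity three only the `Σ`-stable span of the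
relations there. -/
theorem idealSpan_le_fromThree (hE : ∀ n, n ≠ 2 → Subsingleton (E.carrier n))
    {J : Submodule k ((FreeOperad E).carrier 3)}
    (hJ : ∀ (σ : Perm (Fin 3)), ∀ x ∈ J, (FreeOperad E).act σ x ∈ J)
    {R : ∀ n, Set ((FreeOperad E).carrier n)} (h : ∀ n < 3, R n ⊆ {0}) (h3 : R 3 ⊆ J) (n : ℕ) :
    ((FreeOperad E).idealSpan R).sub n ≤ fromThree J n := by
  refine LinOperad.idealSpan_le (I := idealFromThree hE J hJ) (fun m => ?_) n
  rcases lt_trichotomy m 3 with hm | rfl | hm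
  · simpa [idealFromThree, fromThree_of_lt J hm] using h m hm
  · exact h3
  · simp [idealFromThree, fromThree_of_gt J hm]

/-- `P = F(E)/(R)` by means of the morphism `π`. -/
def Presents {P : LinOperad.{u, w} k} (π : LinOperad.Hom (FreeOperad E) P)
    (R : ∀ n, Set ((FreeOperad E).carrier n)) : Prop :=
  ∀ n, Function.Surjective (π.app n) ∧
    LinearMap.ker (π.app n) = ((FreeOperad E).idealSpan R).sub n

/-- `π` admits a presentation with relations of weight two. -/
def QuadraticMap {P : LinOperad.{u, w} k} (π : LinOperad.Hom (FreeOperad E) P) : Prop :=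
  ∃ R, (∀ r, R r ⊆ (weightTwo E r : Set _)) ∧ Presents π R

/-- `π` admits a presentation with relations in the pieces of multiindex `(1, …, 1)`. -/
def TightMap {P : LinOperad.{u, w} k} (π : LinOperad.Hom (FreeOperad E) P) : Prop :=
  ∃ R, (∀ n, R n ⊆ (standard E n (fun _ => 1) : Set ((FreeOperad E).carrier n))) ∧ Presents π R

/-- The kernel of a tight quadratic quotient of a free operad on binary operations is generated by
a subspace of `F(E)(3)`, which lies in the piece of multiindex `(1, 1, 1)`. -/
theorem exists_generators_of_quadratic_of_tight (hE : ∀ n, n ≠ 2 → Subsingleton (E.carrier n))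
    {P : LinOperad.{u, w} k} {π : LinOperad.Hom (FreeOperad E) P} (hq : QuadraticMap π)
    (ht : TightMap π) : LinearMap.ker (π.app 3) ≤ standard E 3 (fun _ => 1) ∧
      (∀ n, Function.Surjective (π.app n)) ∧
      ∀ I : LinOperad.OpIdeal (FreeOperad E), LinearMap.ker (π.app 3) ≤ I.sub 3 →
        ∀ n, LinearMap.ker (π.app n) ≤ I.sub n := by
  obtain ⟨R, hR, hπR⟩ := hq
  obtain ⟨S, hS, hπS⟩ := ht
  have hR' : ∀ n, n ≠ 3 → R n ⊆ {0} := fun n hn => by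
    simpa [weightTwo_eq_bot hE hn] using hR n
  have low : ∀ n < 3, LinearMap.ker (π.app n) = ⊥ := fun n hn => by
    -- Only arities below three matter here, so the crudest choice `⊤` in arity three will do.
    rw [(hπR n).2, ← le_bot_iff, ← fromThree_of_lt ⊤ hn]
    exact idealSpan_le_fromThree hE (by simp) (fun m hm => hR' m hm.ne) (by simp) n
  refine ⟨?_, fun n => (hπR n).1, fun I hI n => ?_⟩
  · rw [(hπS 3).2]
    refine idealSpan_le_fromThree hE
      (fun σ x => LinOperad.act_mem_standardMultifiltration_const σ) (fun m hm => ?_) (hS 3) 3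
    -- Tightness alone does not exclude relations in `S` of arity below three. They lie in the
    -- kernel, which vanishes there because of the quadratic presentation.
    have := LinOperad.subset_idealSpan S m
    rw [← (hπS m).2, low m hm] at this
    simpa using this
  · rw [(hπR n).2]
    refine LinOperad.idealSpan_le (fun m => ?_) n
    by_cases hm : m = 3
    · subst hm
      have := LinOperad.subset_idealSpan R 3
      rw [← (hπR 3).2] at this
      exact this.trans hI
    · exact (hR' m hm).trans (by simp)

/-! ### Change of generators -/

variable {E' : SigmaModule.{u, v'} k}

/-- The morphism of free operads that is induced by a morphism of generators. -/
def map (e : ∀ n, E.carrier n →ₗ[k] E'.carrier n)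
    (he : ∀ (n : ℕ) (σ : Perm (Fin n)) (x : E.carrier n), e n (E.act σ x) = E'.act σ (e n x)) :
    LinOperad.Hom (FreeOperad E) (FreeOperad E') :=
  lift (FreeOperad E') (fun n => gen E' n ∘ₗ e n) fun n σ x => by
    rw [LinearMap.comp_apply, he, LinearMap.comp_apply, act_gen]

theorem map_mem_weightTwo (e : ∀ n, E.carrier n →ₗ[k] E'.carrier n)
    (he : ∀ (n : ℕ) (σ : Perm (Fin n)) (x : E.carrier n), e n (E.act σ x) = E'.act σ (e n x))
    {r : ℕ} {x : (FreeOperad E).carrier r} (hx : x ∈ weightTwo E r) :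
    (map e he).app r x ∈ weightTwo E' r := by
  refine Submodule.span_induction (p := fun x _ => (map e he).app r x ∈ weightTwo E' r)
    ?_ ?_ ?_ ?_ hx
  · rintro x ⟨m, n, h, i, a, b, τ, rfl⟩
    rw [(map e he).map_act, (map e he).map_comp]
    exact Submodule.subset_span ⟨m, n, h, i, e m a, e n b, τ, rfl⟩
  · simp
  · intro x y _ _ hx hy
    simpa using Submodule.add_mem _ hx hy
  · intro c x _ hx
    simpa using Submodule.smul_mem _ c hx

theorem map_mem_standard (e : ∀ n, E.carrier n →ₗ[k] E'.carrier n)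
    (he : ∀ (n : ℕ) (σ : Perm (Fin n)) (x : E.carrier n), e n (E.act σ x) = E'.act σ (e n x))
    {n : ℕ} {p : Fin n → ℤ} {x : (FreeOperad E).carrier n} (hx : x ∈ standard E n p) :
    (map e he).app n x ∈ standard E' n p := by
  refine (map e he).map_standardMultifiltration ?_ hx
  rintro m _ ⟨y, rfl⟩
  exact ⟨e m y, rfl⟩

/-- An element of the kernel of `π'` is carried by the section `ψ` into the ideal generated by `R`,
and `φ` carries that ideal into the one generated by the images of `R`. -/
theorem presents_image {P : LinOperad.{u, w} k} {π : LinOperad.Hom (FreeOperad E) P}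
    {π' : LinOperad.Hom (FreeOperad E') P} {R : ∀ n, Set ((FreeOperad E).carrier n)}
    (hR : Presents π R) (φ : LinOperad.Hom (FreeOperad E) (FreeOperad E'))
    (ψ : LinOperad.Hom (FreeOperad E') (FreeOperad E))
    (hφψ : ∀ n x, φ.app n (ψ.app n x) = x)
    (hπ : ∀ n x, π'.app n (φ.app n x) = π.app n x) :
    Presents π' fun n => φ.app n '' R n := by
  refine fun n => ⟨fun y => ?_, le_antisymm (fun x hx => ?_) ?_⟩
  · obtain ⟨x, rfl⟩ := (hR n).1 y
    exact ⟨_, hπ n x⟩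
  · have hx' : ψ.app n x ∈ LinearMap.ker (π.app n) := by
      rw [LinearMap.mem_ker, ← hπ, hφψ]
      exact hx
    rw [(hR n).2] at hx'
    have := LinOperad.idealSpan_le (I := φ.comapIdeal ((FreeOperad E').idealSpan
      fun n => φ.app n '' R n)) (fun m y hy =>
        LinOperad.subset_idealSpan _ m (Set.mem_image_of_mem _ hy)) n hx'
    rw [← hφψ n x]
    exact this
  · refine LinOperad.idealSpan_le (I := π'.kerIdeal) (fun m => ?_) n
    rintro _ ⟨y, hy, rfl⟩
    have := LinOperad.subset_idealSpan R m hy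
    rw [← (hR m).2] at this
    exact (hπ m y).trans this

theorem map_map (e : ∀ n, E.carrier n →ₗ[k] E'.carrier n)
    (he : ∀ (n : ℕ) (σ : Perm (Fin n)) (x : E.carrier n), e n (E.act σ x) = E'.act σ (e n x))
    (e' : ∀ n, E'.carrier n →ₗ[k] E.carrier n)
    (he' : ∀ (n : ℕ) (σ : Perm (Fin n)) (x : E'.carrier n), e' n (E'.act σ x) = E.act σ (e' n x))
    (hee : ∀ n x, e' n (e n x) = x) {n : ℕ} (x : (FreeOperad E).carrier n) :
    (map e' he').app n ((map e he).app n x) = x := by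
  refine hom_ext (φ := (map e' he').comp (map e he))
    (ψ := ⟨fun n => LinearMap.id, rfl, fun _ _ => rfl, fun _ _ _ _ => rfl⟩) (fun n x => ?_) x
  exact congrArg (gen E n) (hee n x)

theorem quadraticMap_and_tightMap_of_equiv {P : LinOperad.{u, w} k}
    {π : LinOperad.Hom (FreeOperad E) P} {π' : LinOperad.Hom (FreeOperad E') P}
    (e : ∀ n, E.carrier n ≃ₗ[k] E'.carrier n)
    (he : ∀ (n : ℕ) (σ : Perm (Fin n)) (x : E.carrier n), e n (E.act σ x) = E'.act σ (e n x))
    (hπ : ∀ n x, π'.app n (gen E' n (e n x)) = π.app n (gen E n x)) :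
    (QuadraticMap π → QuadraticMap π') ∧ (TightMap π → TightMap π') := by
  have he' : ∀ (n : ℕ) (σ : Perm (Fin n)) (x : E'.carrier n),
      (e n).symm (E'.act σ x) = E.act σ ((e n).symm x) := fun n σ x => by
    simp [LinearEquiv.symm_apply_eq, he]
  let φ := map (fun n => (e n : E.carrier n →ₗ[k] E'.carrier n)) he
  let ψ := map (fun n => ((e n).symm : E'.carrier n →ₗ[k] E.carrier n)) he'
  have key : ∀ R, Presents π R → Presents π' fun n => φ.app n '' R n := fun R hR =>
    presents_image hR φ ψ (fun n x => map_map _ he' _ he (fun n x => by simp) x)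
      (fun n x => hom_ext (φ := π'.comp φ) (ψ := π) hπ x)
  constructor
  · rintro ⟨R, hR, h⟩
    refine ⟨_, fun n => ?_, key R h⟩
    rintro _ ⟨x, hx, rfl⟩
    exact map_mem_weightTwo _ he (hR n hx)
  · rintro ⟨R, hR, h⟩
    refine ⟨_, fun n => ?_, key R h⟩
    rintro _ ⟨x, hx, rfl⟩
    exact map_mem_standard _ he (hR n hx)

end FreeOperad

/-! ### Operads generated by one binary operation -/

namespace LinOperad

open FreeOperad

variable {k : Type u} [Field k] {P : LinOperad.{u, w} k}

/-- Quadraticity and tightness may be checked on any `Σ`-module isomorphic to the generators. -/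
theorem SubCollection.isQuadratic_and_isTight_iff (E : P.SubCollection) {V : SigmaModule.{u, v} k}
    (π : Hom (FreeOperad V) P) (hinj : ∀ n, Function.Injective (π.app n ∘ₗ gen V n))
    (hrange : ∀ n, LinearMap.range (π.app n ∘ₗ gen V n) = E.sub n) :
    (E.IsQuadratic ↔ QuadraticMap π) ∧ (E.IsTight ↔ TightMap π) := by
  let e : ∀ n, V.carrier n ≃ₗ[k] E.toSigmaModule.carrier n := fun n =>
    (LinearEquiv.ofInjective _ (hinj n)).trans (LinearEquiv.ofEq _ _ (hrange n))
  have he : ∀ (n : ℕ) (σ : Perm (Fin n)) (x : V.carrier n),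
      e n (V.act σ x) = E.toSigmaModule.act σ (e n x) := fun n σ x => Subtype.ext <| by
    show π.app n (gen V n (V.act σ x)) = P.act σ (π.app n (gen V n x))
    rw [← act_gen, π.map_act]
  have hπ : ∀ n x, E.canonical.app n (gen _ n (e n x)) = π.app n (gen _ n x) :=
    fun n x => rfl
  have h₁ := quadraticMap_and_tightMap_of_equiv e he hπ
  have h₂ := quadraticMap_and_tightMap_of_equiv (π := E.canonical) (π' := π)
    (fun n => (e n).symm) (fun n σ x => by simp [LinearEquiv.symm_apply_eq, he])
    (fun n x => by rw [← hπ]; simp)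
  exact ⟨⟨h₂.1, h₁.1⟩, ⟨h₂.2, h₁.2⟩⟩

end LinOperad

theorem perm_fin_two (σ : Perm (Fin 2)) : σ = 1 ∨ σ = swap 0 1 := by
  revert σ
  decide

namespace LinOperad

open FreeOperad

variable {k : Type u} [Field k] {P : LinOperad.{u, w} k}

theorem act_swap_act_swap (x : P.carrier 2) : P.act (swap 0 1) (P.act (swap 0 1) x) = x := by
  rw [← P.act_mul, swap_mul_self, P.act_one]

theorem spanOne_sub_two (μ : P.carrier 2) :
    (P.spanOne μ).sub 2 = Submodule.span k {μ, P.act (swap 0 1) μ} := by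
  refine le_antisymm (Submodule.span_le.2 ?_) (Submodule.span_le.2 ?_)
  · rintro x ⟨y, hy, σ, rfl⟩
    obtain rfl := eq_of_heq (Sigma.mk.inj_iff.1 hy).2
    rcases perm_fin_two σ with rfl | rfl
    · rw [P.act_one]
      exact Submodule.subset_span (by simp)
    · exact Submodule.subset_span (by simp)
  · rintro x (rfl | rfl)
    · exact Submodule.subset_span ⟨x, rfl, 1, (P.act_one x).symm⟩
    · exact Submodule.subset_span ⟨μ, rfl, swap 0 1, rfl⟩

theorem spanOne_sub_of_ne (μ : P.carrier 2) {n : ℕ} (hn : n ≠ 2) : (P.spanOne μ).sub n = ⊥ :=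
  Submodule.span_eq_bot.2 fun _ ⟨_, hy, _⟩ => absurd (Sigma.mk.inj_iff.1 hy).1 hn

theorem spanOne_isQuadratic_and_isTight_iff {V : SigmaModule.{u, v} k}
    (hV : ∀ n, n ≠ 2 → Subsingleton (V.carrier n)) (π : Hom (FreeOperad V) P) {μ : P.carrier 2}
    (hinj : Function.Injective (π.app 2 ∘ₗ gen V 2))
    (hrange : LinearMap.range (π.app 2 ∘ₗ gen V 2) = Submodule.span k {μ, P.act (swap 0 1) μ}) :
    ((P.spanOne μ).IsQuadratic ↔ QuadraticMap π) ∧ ((P.spanOne μ).IsTight ↔ TightMap π) := by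
  refine (P.spanOne μ).isQuadratic_and_isTight_iff π (fun n => ?_) (fun n => ?_)
  · by_cases hn : n = 2
    · subst hn
      exact hinj
    · have := hV n hn
      exact Function.injective_of_subsingleton _
  · by_cases hn : n = 2
    · subst hn
      rw [spanOne_sub_two, hrange]
    · have := hV n hn
      rw [spanOne_sub_of_ne μ hn, LinearMap.range_eq_bot]
      exact Subsingleton.elim _ _

/-- The kernel is generated by its arity three part, so it is contained in the zero ideal as soon as
that part vanishes. -/
theorem isomorphic_free_of_ker_eq_bot {V : SigmaModule.{u, v} k}
    (hV : ∀ n, n ≠ 2 → Subsingleton (V.carrier n)) {π : Hom (FreeOperad V) P}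
    (hq : QuadraticMap π) (ht : TightMap π) (h : LinearMap.ker (π.app 3) = ⊥) :
    P.Isomorphic (FreeOperad V) := by
  obtain ⟨-, hs, hI⟩ := exists_generators_of_quadratic_of_tight hV hq ht
  exact π.isomorphic_of_bijective fun n =>
    ⟨LinearMap.ker_eq_bot.1 (le_bot_iff.1 (hI (zeroIdeal _) h.le n)), hs n⟩

/-- The arity three part of the kernel lies in the line spanned by `x`: either it contains `x`,
which then generates the kernel, or it is zero. -/
theorem isomorphic_free_or_quotient {V : SigmaModule.{u, v} k}
    (hV : ∀ n, n ≠ 2 → Subsingleton (V.carrier n)) {π : Hom (FreeOperad V) P}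
    (hq : QuadraticMap π) (ht : TightMap π) {x : (FreeOperad V).carrier 3}
    (hx : FreeOperad.standard V 3 (fun _ => 1) ≤ Submodule.span k {x}) :
    P.Isomorphic (FreeOperad V) ∨
      P.Isomorphic ((FreeOperad V).quotient
        ((FreeOperad V).idealSpan ((FreeOperad V).oneRelation x))) := by
  obtain ⟨hk, hs, hI⟩ := exists_generators_of_quadratic_of_tight hV hq ht
  by_cases hxk : x ∈ LinearMap.ker (π.app 3)
  · refine .inr (π.isomorphic_quotient _ hs fun n => le_antisymm (hI _ ?_ n) ?_)
    · refine (hk.trans hx).trans (Submodule.span_le.2 (Set.singleton_subset_iff.2 ?_))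
      exact subset_idealSpan _ 3 (self_mem_oneRelation x)
    · exact idealSpan_le (I := π.kerIdeal)
        (fun m => oneRelation_subset (r := x)
          (S := fun n => (π.kerIdeal.sub n : Set ((FreeOperad V).carrier n))) hxk m) n
  · refine .inl (isomorphic_free_of_ker_eq_bot hV hq ht (le_bot_iff.1 fun y hy => ?_))
    obtain ⟨c, rfl⟩ := Submodule.mem_span_singleton.1 (hx (hk hy))
    by_cases hc : c = 0
    · simp [hc]
    · exact absurd (((LinearMap.ker (π.app 3)).smul_mem_iff hc).1 hy) hxk

/-- A quotient of a free operad on one binary operation by tight quadratic relations. -/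
theorem isTightQuadraticOneBinary_of_isomorphic {V : SigmaModule.{u, v} k}
    (hV : ∀ n, n ≠ 2 → Subsingleton (V.carrier n)) (hgen : Function.Injective (gen V 2))
    {x : V.carrier 2} (hx : x ≠ 0) (hspan : ∀ y, y ∈ Submodule.span k {x, V.act (swap 0 1) x})
    {Q : LinOperad.{u, w'} k} (ρ : Hom (FreeOperad V) Q)
    {R : ∀ n, Set ((FreeOperad V).carrier n)} (hR : Presents ρ R)
    (hq : ∀ r, R r ⊆ (weightTwo V r : Set _))
    (ht : ∀ n, R n ⊆ (FreeOperad.standard V n (fun _ => 1) : Set ((FreeOperad V).carrier n)))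
    (hPQ : P.Isomorphic Q) : P.IsTightQuadraticOneBinary := by
  obtain ⟨φ, hφ⟩ := hPQ
  let π := (φ.inverse hφ).comp ρ
  have hker : ∀ n, LinearMap.ker (π.app n) = LinearMap.ker (ρ.app n) := fun n =>
    LinearMap.ker_comp_of_ker_eq_bot _ (LinearMap.ker_eq_bot.2 (φ.inverse_bijective hφ n).1)
  have hπ : Presents π R := fun n =>
    ⟨(φ.inverse_bijective hφ n).2.comp (hR n).1, by rw [hker, (hR n).2]⟩
  -- Relations of weight two leave arity two untouched, so the generators embed into `P` and their
  -- image is the subcollection spanned by one operation.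
  have hker2 : LinearMap.ker (π.app 2) = ⊥ := by
    rw [(hπ 2).2, ← le_bot_iff, ← fromThree_of_lt ⊤ (show 2 < 3 by omega)]
    refine idealSpan_le_fromThree hV (by simp) (fun m hm => ?_) (by simp) 2
    simpa [weightTwo_eq_bot hV hm.ne] using hq m
  have hinj : Function.Injective (π.app 2 ∘ₗ gen V 2) :=
    (LinearMap.ker_eq_bot.1 hker2).comp hgen
  have hact : π.app 2 (gen V 2 (V.act (swap 0 1) x)) = P.act (swap 0 1) (π.app 2 (gen V 2 x)) := by
    rw [← act_gen, π.map_act]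
  have hrange : LinearMap.range (π.app 2 ∘ₗ gen V 2) =
      Submodule.span k {π.app 2 (gen V 2 x), P.act (swap 0 1) (π.app 2 (gen V 2 x))} := by
    rw [← hact, LinearMap.range_eq_map, ← (Submodule.eq_top_iff'.2 hspan), Submodule.map_span,
      Set.image_pair]
    rfl
  have key := spanOne_isQuadratic_and_isTight_iff hV π hinj hrange
  refine ⟨π.app 2 (gen V 2 x), fun h0 => hx (hinj ?_), key.1.2 ⟨R, hq, hπ⟩, key.2.2 ⟨R, ht, hπ⟩⟩
  rw [map_zero]
  exact h0

end LinOperad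

/-! ### Morphisms from free operads on one binary operation -/

section

variable {k : Type u} [Field k] {W : Type v} [AddCommGroup W] [Module k W] {t : W →ₗ[k] W}
  {ht : t ∘ₗ t = LinearMap.id}

theorem binaryModule_subsingleton (n : ℕ) (hn : n ≠ 2) :
    Subsingleton ((binaryModule k W t ht).carrier n) := by
  have : IsEmpty (PLift (n = 2)) := ⟨fun h => hn h.down⟩
  exact inferInstanceAs (Subsingleton (PLift (n = 2) → W))

theorem binaryModule_act_swap (x : (binaryModule k W t ht).carrier 2) :
    (binaryModule k W t ht).act (swap 0 1) x = fun e : PLift (2 = 2) => t (x e) := by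
  have : Perm.sign (swap (0 : Fin 2) 1) = -1 := Perm.sign_swap (by decide)
  simp [binaryModule, this]
  rfl

variable (t ht)

/-- The maps of `Σ`-modules from `binaryModule`. -/
def binaryModuleMap {P : LinOperad.{u, w} k} (g : W →ₗ[k] P.carrier 2) :
    ∀ n, (binaryModule k W t ht).carrier n →ₗ[k] P.carrier n
  | 2 => g ∘ₗ (LinearMap.proj ⟨rfl⟩ : (PLift (2 = 2) → W) →ₗ[k] W)
  | _ => 0

/-- The morphism from the free operad on a binary module that is given by an equivariant map. -/
def binaryLift (P : LinOperad.{u, w} k) (g : W →ₗ[k] P.carrier 2)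
    (hg : ∀ x, g (t x) = P.act (swap 0 1) (g x)) :
    LinOperad.Hom (FreeOperad (binaryModule k W t ht)) P :=
  FreeOperad.lift P (binaryModuleMap t ht g) fun n σ x => by
    by_cases hn : n = 2
    · subst hn
      rcases perm_fin_two σ with rfl | rfl
      · rw [P.act_one, SigmaModule.act_one]
      · exact (congrArg _ (binaryModule_act_swap x)).trans (hg _)
    · have := binaryModule_subsingleton (ht := ht) n hn
      rw [Subsingleton.elim x 0]
      simp only [map_zero]

variable {t ht}

theorem binaryLift_gen (P : LinOperad.{u, w} k) (g : W →ₗ[k] P.carrier 2)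
    (hg : ∀ x, g (t x) = P.act (swap 0 1) (g x)) (x : (binaryModule k W t ht).carrier 2) :
    (binaryLift t ht P g hg).app 2 (FreeOperad.gen (binaryModule k W t ht) 2 x) = g (x ⟨rfl⟩) :=
  rfl

/-- The free operad is a quotient of formal expressions, so the generators are shown not to collapse
by realizing them faithfully in some operad. -/
theorem gen_injective_of_binaryLift {P : LinOperad.{u, w} k} {g : W →ₗ[k] P.carrier 2}
    (hg : ∀ x, g (t x) = P.act (swap 0 1) (g x)) (hinj : Function.Injective g) :
    Function.Injective (FreeOperad.gen (binaryModule k W t ht) 2) := by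
  intro x y hxy
  have := congrArg ((binaryLift t ht P g hg).app 2) hxy
  rw [binaryLift_gen, binaryLift_gen] at this
  funext e
  exact hinj this

theorem binaryLift_gen_injective {P : LinOperad.{u, w} k} {g : W →ₗ[k] P.carrier 2}
    (hg : ∀ x, g (t x) = P.act (swap 0 1) (g x)) (hinj : Function.Injective g) :
    Function.Injective
      ((binaryLift t ht P g hg).app 2 ∘ₗ FreeOperad.gen (binaryModule k W t ht) 2) :=
  fun _ _ hxy => funext fun _ => hinj hxy

theorem range_binaryLift_gen {P : LinOperad.{u, w} k} {g : W →ₗ[k] P.carrier 2}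
    (hg : ∀ x, g (t x) = P.act (swap 0 1) (g x)) :
    LinearMap.range ((binaryLift t ht P g hg).app 2 ∘ₗ FreeOperad.gen (binaryModule k W t ht) 2) =
      LinearMap.range g := by
  ext y
  constructor
  · rintro ⟨x, rfl⟩
    exact ⟨x ⟨rfl⟩, rfl⟩
  · rintro ⟨x, rfl⟩
    exact ⟨fun _ => x, rfl⟩

end

/-- Trichotomy for one binary operation `μ`: the `Σ`-module it spans is one of three. -/
theorem LinOperad.binary_trichotomy {k : Type u} [Field k] {P : LinOperad.{u, w} k}
    {μ : P.carrier 2} (hμ : μ ≠ 0) :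
    P.act (swap 0 1) μ = -μ ∨ P.act (swap 0 1) μ = μ ∨
      LinearIndependent k ![μ, P.act (swap 0 1) μ] := by
  by_cases h : LinearIndependent k ![μ, P.act (swap 0 1) μ]
  · exact .inr (.inr h)
  · rw [LinearIndependent.pair_iff' hμ] at h
    push Not at h
    obtain ⟨c, hc⟩ := h
    -- The transposition acts on `μ` by the scalar `c` and is an involution, so `c` is a square root
    -- of one.
    have h2 : (c * c) • μ = (1 : k) • μ := by
      rw [mul_smul, hc, ← map_smul, hc, LinOperad.act_swap_act_swap, one_smul]
    rcases mul_self_eq_one_iff.1 (smul_left_injective k hμ h2) with rfl | rfl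
    · exact .inr (.inl (by rw [← hc, one_smul]))
    · exact .inl (by rw [← hc, neg_smul, one_smul])

/-! ### Identities between the arity three composites of a binary operation -/

namespace OperadComp

theorem perm_zero_swap_one :
    perm (rfl : 2 + 2 = 3 + 1) 0 (swap 0 1) 1 = finRotate 3 := by decide

theorem perm_one_one_swap :
    perm (rfl : 2 + 2 = 3 + 1) 1 1 (swap 0 1) = swap 1 2 := by decide

theorem perm_one_swap_one :
    perm (rfl : 2 + 2 = 3 + 1) 1 (swap 0 1) 1 = finRotate 3 * finRotate 3 := by decide

theorem perm_one_swap_swap :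
    perm (rfl : 2 + 2 = 3 + 1) 1 (swap 0 1) (swap 0 1) = swap 0 2 := by decide

theorem univ_perm_fin_three : (Finset.univ : Finset (Perm (Fin 3))) =
    {1, finRotate 3, finRotate 3 * finRotate 3, swap 0 1, swap 1 2, swap 0 2} := by decide

theorem sum_perm_fin_three {M : Type*} [AddCommMonoid M] (f : Perm (Fin 3) → M) :
    ∑ σ, f σ = f 1 + (f (finRotate 3) + (f (finRotate 3 * finRotate 3) +
      (f (swap 0 1) + (f (swap 1 2) + f (swap 0 2))))) := by
  rw [univ_perm_fin_three, Finset.sum_insert (by decide), Finset.sum_insert (by decide),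
    Finset.sum_insert (by decide), Finset.sum_insert (by decide), Finset.sum_insert (by decide),
    Finset.sum_singleton]

end OperadComp

namespace LinOperad

open OperadComp

variable {k : Type u} [Field k] {P : LinOperad.{u, w} k}

/-- Exchanging the two inputs of the outer operation turns `μ ∘_1 μ` into a rotation of `μ ∘_2 μ`.
For eigenvectors of the transposition one of the two combs is thus superfluous. -/
theorem act_finRotate_rightComb {ε : k} {μ : P.carrier 2} (h : P.act (swap 0 1) μ = ε • μ) :
    P.act (finRotate 3) (P.rightComb μ) = ε • P.leftComb μ := by
  have := P.comp_act (rfl : 2 + 2 = 3 + 1) 0 (swap 0 1) 1 μ μ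
  rw [P.act_one, h, perm_zero_swap_one, map_smul, LinearMap.smul_apply] at this
  exact this.symm

theorem act_swap_rightComb {ε : k} {μ : P.carrier 2} (h : P.act (swap 0 1) μ = ε • μ) :
    P.act (swap 1 2) (P.rightComb μ) = ε • P.rightComb μ := by
  have := P.comp_act (rfl : 2 + 2 = 3 + 1) 1 1 (swap 0 1) μ μ
  rw [P.act_one, h, perm_one_one_swap, map_smul] at this
  exact this.symm

theorem act_finRotate_jacobiator (μ : P.carrier 2) :
    P.act (finRotate 3) (P.jacobiator μ) = P.jacobiator μ := by
  have e : finRotate 3 * finRotate 3 * finRotate 3 = 1 := by decide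
  simp only [jacobiator, map_add, ← P.act_mul, e, P.act_one]
  abel

/-- The Jacobiator of an antisymmetric operation, up to an operadic commutator. -/
theorem jacobiator_eq {ν : P.carrier 2} (h : P.act (swap 0 1) ν = -ν) :
    P.jacobiator ν = P.rightComb ν - P.bracket (rfl : 2 + 2 = 3 + 1) 0 0 ν ν := by
  have h' : P.act (swap 0 1) ν = (-1 : k) • ν := by simpa using h
  have hL : P.leftComb ν = -P.act (finRotate 3) (P.rightComb ν) := by
    simp [act_finRotate_rightComb h']
  have hR : P.rightComb ν = -P.act (swap 1 2) (P.rightComb ν) := by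
    simp [act_swap_rightComb h']
  have e₁ : blockSwap 3 0 0 0 (by omega) = 1 := by decide
  have e₂ : blockSwap 3 1 1 1 (by omega) = swap 1 2 := by decide
  have e₃ : finRotate 3 * swap 1 2 = swap 1 2 * (finRotate 3 * finRotate 3) := by decide
  have key : P.act (swap 1 2) (P.leftComb ν) =
      P.act (finRotate 3 * finRotate 3) (P.rightComb ν) := by
    rw [hL, map_neg, ← P.act_mul, e₃, P.act_mul (swap 1 2), ← map_neg, ← hR]
  have hb : P.bracket (rfl : 2 + 2 = 3 + 1) 0 0 ν ν =
      P.act (blockSwap 3 0 0 0 (by omega)) (P.leftComb ν) -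
        P.act (blockSwap 3 1 1 1 (by omega)) (P.leftComb ν) := rfl
  rw [hb, e₁, e₂, P.act_one, key, hL, jacobiator]
  abel

/-- The commutator lowers the index at one input, the cyclic symmetry distributes this gain over all
three inputs, and saturation combines the three estimates. -/
theorem jacobiator_mem {F : ∀ n : ℕ, (Fin n → ℤ) → Submodule k (P.carrier n)}
    (hF : P.IsMultifiltration F) (hF' : P.IsSaturated F) {ν : P.carrier 2}
    (h : P.act (swap 0 1) ν = -ν) (hν : ν ∈ F 2 fun _ => 1) :
    P.jacobiator ν ∈ F 3 fun _ => 1 := by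
  -- Both `(1, 1) ∘_2 (1, 1)` and the bracket multiindex of `(1, 1)` and `(1, 1)` at the first
  -- inputs equal `(1, 2, 2)`; in the latter the first entry is `1 + 1 - 1`.
  have h₁ : P.jacobiator ν ∈ F 3 ![1, 2, 2] := by
    rw [jacobiator_eq h]
    refine Submodule.sub_mem _ ?_ ?_
    · convert hF.comp_mem (rfl : 2 + 2 = 3 + 1) 1 _ _ ν ν hν hν using 1
      · congr 1
        decide
      · rfl
    · convert hF.bracket_mem (rfl : 2 + 2 = 3 + 1) 0 0 _ _ ν ν hν hν using 1
      congr 1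
      decide
  have rot : ∀ p : Fin 3 → ℤ, P.jacobiator ν ∈ F 3 p →
      P.jacobiator ν ∈ F 3 fun x => p (finRotate 3 x) := fun p hp => by
    rw [← act_finRotate_jacobiator, ← hF.equivariant]
    exact Submodule.mem_map_of_mem hp
  have h₂ := rot _ h₁
  have h₃ := rot _ h₂
  refine hF.mono _ _ _ ?_ (hF' _ _ _ ⟨hF' _ _ _ ⟨h₁, h₂⟩, h₃⟩)
  intro x
  fin_cases x <;> decide

theorem act_swap_sub_act_swap (μ : P.carrier 2) :
    P.act (swap 0 1) (μ - P.act (swap 0 1) μ) = -(μ - P.act (swap 0 1) μ) := by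
  rw [map_sub, act_swap_act_swap, neg_sub]

theorem rightComb_sub_act_swap (μ : P.carrier 2) :
    P.rightComb (μ - P.act (swap 0 1) μ) = P.rightComb μ - P.act (swap 1 2) (P.rightComb μ) -
      P.act (finRotate 3 * finRotate 3) (P.leftComb μ) + P.act (swap 0 2) (P.leftComb μ) := by
  have h₁ := P.comp_act (rfl : 2 + 2 = 3 + 1) 1 1 (swap 0 1) μ μ
  have h₂ := P.comp_act (rfl : 2 + 2 = 3 + 1) 1 (swap 0 1) 1 μ μ
  have h₃ := P.comp_act (rfl : 2 + 2 = 3 + 1) 1 (swap 0 1) (swap 0 1) μ μ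
  rw [P.act_one, perm_one_one_swap] at h₁
  rw [P.act_one, perm_one_swap_one] at h₂
  rw [perm_one_swap_swap] at h₃
  simp only [rightComb, map_sub, LinearMap.sub_apply, h₁, h₂, h₃]
  simp only [leftComb, swap_apply_right, Perm.one_apply]
  abel

/-- The right comb of the commutator expands into four of the twelve signed trees `μ ∘_1 μ · σ` and
`μ ∘_2 μ · σ`. Its three rotations meet each of the twelve once, with sign `sgn σ` on right combs
and `-sgn σ` on left combs. -/
theorem lieAdmissibility_eq (μ : P.carrier 2) :
    P.lieAdmissibility μ = -P.jacobiator (μ - P.act (swap 0 1) μ) := by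
  have s₁ : Perm.sign (finRotate 3) = 1 := by decide
  have s₂ : Perm.sign (finRotate 3 * finRotate 3) = 1 := by decide
  have s₃ : Perm.sign (swap 0 1 : Perm (Fin 3)) = -1 := by decide
  have s₄ : Perm.sign (swap 1 2 : Perm (Fin 3)) = -1 := by decide
  have s₅ : Perm.sign (swap 0 2 : Perm (Fin 3)) = -1 := by decide
  have e₁ : swap 1 2 * finRotate 3 = swap 0 2 := by decide
  have e₂ : swap 1 2 * (finRotate 3 * finRotate 3) = swap 0 1 := by decide
  have e₃ : finRotate 3 * finRotate 3 * finRotate 3 = 1 := by decide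
  have e₄ : finRotate 3 * finRotate 3 * (finRotate 3 * finRotate 3) = finRotate 3 := by decide
  have e₅ : swap 0 2 * finRotate 3 = swap 0 1 := by decide
  have e₆ : swap 0 2 * (finRotate 3 * finRotate 3) = swap 1 2 := by decide
  rw [jacobiator, rightComb_sub_act_swap, lieAdmissibility, sum_perm_fin_three]
  simp only [map_add, map_sub, ← P.act_mul, s₁, s₂, s₃, s₄, s₅, e₁, e₂, e₃, e₄, e₅, e₆, P.act_one,
    Perm.sign_one, Units.val_one, Units.val_neg, Int.cast_one, Int.cast_neg, one_smul, neg_smul]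
  abel

end LinOperad

/-! ### Spanning sets in arity three of the free operad -/

namespace FreeOperad

open LinOperad OperadComp

variable {k : Type u} [Field k] {E : SigmaModule.{u, v} k}

/-- A `Σ`-stable subspace that contains the two basic composites of `μ` is everything. -/
theorem mem_of_comb_mem (hE : ∀ n, n ≠ 2 → Subsingleton (E.carrier n))
    {μ : (FreeOperad E).carrier 2}
    (hμ : ∀ x, gen E 2 x ∈ Submodule.span k {μ, (FreeOperad E).act (swap 0 1) μ})
    {S : Submodule k ((FreeOperad E).carrier 3)}
    (hS : ∀ (σ : Perm (Fin 3)), ∀ x ∈ S, (FreeOperad E).act σ x ∈ S)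
    (hl : (FreeOperad E).leftComb μ ∈ S) (hr : (FreeOperad E).rightComb μ ∈ S)
    (z : (FreeOperad E).carrier 3) : z ∈ S := by
  have h0 : ∀ i, (FreeOperad E).comp (rfl : 2 + 2 = 3 + 1) i μ μ ∈ S := by
    intro i
    fin_cases i
    exacts [hl, hr]
  have h1 : ∀ i σ τ, (FreeOperad E).comp (rfl : 2 + 2 = 3 + 1) i ((FreeOperad E).act σ μ)
      ((FreeOperad E).act τ μ) ∈ S := fun i σ τ => by
    rw [(FreeOperad E).comp_act]
    exact hS _ _ (h0 _)
  have h2 : ∀ i, ∀ x ∈ Submodule.span k {μ, (FreeOperad E).act (swap 0 1) μ},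
      ∀ y ∈ Submodule.span k {μ, (FreeOperad E).act (swap 0 1) μ},
      (FreeOperad E).comp (rfl : 2 + 2 = 3 + 1) i x y ∈ S := by
    intro i x hx y hy
    obtain ⟨a, b, rfl⟩ := Submodule.mem_span_pair.1 hx
    obtain ⟨c, d, rfl⟩ := Submodule.mem_span_pair.1 hy
    have h01 := h1 i 1 (swap 0 1)
    have h10 := h1 i (swap 0 1) 1
    rw [(FreeOperad E).act_one] at h01 h10
    simp only [map_add, map_smul, LinearMap.add_apply, LinearMap.smul_apply]
    exact S.add_mem
      (S.smul_mem _ (S.add_mem (S.smul_mem _ (h0 i)) (S.smul_mem _ h10)))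
      (S.smul_mem _ (S.add_mem (S.smul_mem _ h01) (S.smul_mem _ (h1 i _ _))))
  refine Submodule.span_le.2 ?_ (arity_three hE z)
  rintro _ ⟨m, n, h, i, x, y, σ, rfl⟩
  by_cases hm : m = 2
  · obtain rfl := hm
    obtain rfl : n = 2 := by omega
    exact hS _ _ (h2 i _ (hμ x) _ (hμ y))
  · have := hE m hm
    rw [Subsingleton.elim x 0]
    simp

/-- Operations of arity three on one (anti)symmetric generator. -/
theorem exists_coeff_of_eigen (hE : ∀ n, n ≠ 2 → Subsingleton (E.carrier n))
    {μ : (FreeOperad E).carrier 2} (hμ : ∀ x, gen E 2 x ∈ Submodule.span k {μ}) {ε : k}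
    (hε : (FreeOperad E).act (swap 0 1) μ = ε • μ) (hε' : ε * ε = 1)
    (z : (FreeOperad E).carrier 3) : ∃ a b c : k,
      z = a • (FreeOperad E).rightComb μ +
        b • (FreeOperad E).act (finRotate 3) ((FreeOperad E).rightComb μ) +
        c • (FreeOperad E).act (finRotate 3 * finRotate 3) ((FreeOperad E).rightComb μ) := by
  set R := (FreeOperad E).rightComb μ with hR
  have hsR := act_swap_rightComb hε
  rw [← hR] at hsR
  have key : ∀ σ : Perm (Fin 3), (FreeOperad E).act σ R ∈ Submodule.span k
      {R, (FreeOperad E).act (finRotate 3) R, (FreeOperad E).act (finRotate 3 * finRotate 3) R} := by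
    intro σ
    have hσ : σ ∈ (Finset.univ : Finset (Perm (Fin 3))) := Finset.mem_univ σ
    -- Every odd permutation acts as `swap 1 2`, which multiplies `R` by `ε`, followed by a
    -- rotation; so the three rotations of `R` suffice.
    have e₁ : swap 0 2 = swap 1 2 * finRotate 3 := by decide
    have e₂ : swap 0 1 = swap 1 2 * (finRotate 3 * finRotate 3) := by decide
    rw [univ_perm_fin_three] at hσ
    simp only [Finset.mem_insert, Finset.mem_singleton] at hσ
    rcases hσ with rfl | rfl | rfl | rfl | rfl | rfl
    · rw [(FreeOperad E).act_one]
      exact Submodule.subset_span (by simp)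
    · exact Submodule.subset_span (by simp)
    · exact Submodule.subset_span (by simp)
    · rw [e₂, (FreeOperad E).act_mul (swap 1 2), hsR, map_smul]
      exact Submodule.smul_mem _ _ (Submodule.subset_span (by simp))
    · rw [hsR]
      exact Submodule.smul_mem _ _ (Submodule.subset_span (by simp))
    · rw [e₁, (FreeOperad E).act_mul (swap 1 2), hsR, map_smul]
      exact Submodule.smul_mem _ _ (Submodule.subset_span (by simp))
  have hz : z ∈ Submodule.span k
      {R, (FreeOperad E).act (finRotate 3) R, (FreeOperad E).act (finRotate 3 * finRotate 3) R} := by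
    refine mem_of_comb_mem hE (μ := μ)
      (fun x => Submodule.span_mono (by simp) (hμ x)) (fun σ x hx => ?_) ?_ ?_ z
    · refine Submodule.span_le (p := (Submodule.span k _).comap _).2 ?_ hx
      rintro _ (rfl | rfl | rfl)
      · exact key σ
      · rw [SetLike.mem_coe, Submodule.mem_comap, ← (FreeOperad E).act_mul]
        exact key _
      · rw [SetLike.mem_coe, Submodule.mem_comap, ← (FreeOperad E).act_mul]
        exact key _
    · have : (FreeOperad E).leftComb μ = ε • (FreeOperad E).act (finRotate 3) R := by
        rw [act_finRotate_rightComb hε, smul_smul, hε', one_smul]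
      rw [this]
      exact Submodule.smul_mem _ _ (key _)
    · exact Submodule.subset_span (by simp [hR])
  obtain ⟨a, b, c, rfl⟩ := Submodule.mem_span_triple.1 hz
  exact ⟨a, b, c, rfl⟩

/-- Operations of arity three on one generator without symmetry. -/
theorem exists_coeff (hE : ∀ n, n ≠ 2 → Subsingleton (E.carrier n))
    {μ : (FreeOperad E).carrier 2}
    (hμ : ∀ x, gen E 2 x ∈ Submodule.span k {μ, (FreeOperad E).act (swap 0 1) μ})
    (z : (FreeOperad E).carrier 3) : ∃ a b : Perm (Fin 3) → k,
      z = ∑ σ, (FreeOperad E).act σ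
        (a σ • (FreeOperad E).leftComb μ + b σ • (FreeOperad E).rightComb μ) := by
  let Φ : ((Perm (Fin 3) → k) × (Perm (Fin 3) → k)) →ₗ[k] (FreeOperad E).carrier 3 :=
    ∑ σ : Perm (Fin 3), (FreeOperad E).act σ ∘ₗ
      (LinearMap.toSpanSingleton k _ ((FreeOperad E).leftComb μ) ∘ₗ LinearMap.proj σ ∘ₗ
          LinearMap.fst _ _ _ +
        LinearMap.toSpanSingleton k _ ((FreeOperad E).rightComb μ) ∘ₗ LinearMap.proj σ ∘ₗ
          LinearMap.snd _ _ _)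
  have hΦ : ∀ a b, Φ (a, b) = ∑ σ, (FreeOperad E).act σ
      (a σ • (FreeOperad E).leftComb μ + b σ • (FreeOperad E).rightComb μ) := fun a b => by
    simp [Φ]
  have hz : z ∈ LinearMap.range Φ := by
    refine mem_of_comb_mem (S := LinearMap.range Φ) hE hμ ?_ ⟨(Pi.single 1 1, 0), ?_⟩ ⟨(0, Pi.single 1 1), ?_⟩ z
    · rintro τ _ ⟨⟨a, b⟩, rfl⟩
      -- Acting by `τ` on the term indexed by `σ` gives the term indexed by `σ * τ`.
      refine ⟨(fun σ => a (σ * τ⁻¹), fun σ => b (σ * τ⁻¹)), ?_⟩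
      rw [hΦ, hΦ, map_sum]
      refine Fintype.sum_equiv (Equiv.mulRight τ⁻¹) _ _ fun σ => ?_
      simp [← (FreeOperad E).act_mul]
    · rw [hΦ, Finset.sum_eq_single 1] <;> simp +contextual [(FreeOperad E).act_one]
    · rw [hΦ, Finset.sum_eq_single 1] <;> simp +contextual [(FreeOperad E).act_one]
  obtain ⟨⟨a, b⟩, rfl⟩ := hz
  exact ⟨a, b, hΦ a b⟩

end FreeOperad

/-! ### Evaluation of symbols in arities two and three -/

namespace SymbolOperad

variable {k : Type u} [Field k]

theorem add_apply {n : ℕ} (f g : (SymbolOperad k).carrier n) (ξ : Fin n → k) :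
    (f + g) ξ = f ξ + g ξ := rfl

theorem neg_apply {n : ℕ} (f : (SymbolOperad k).carrier n) (ξ : Fin n → k) : (-f) ξ = -f ξ := rfl

theorem smul_apply {n : ℕ} (c : k) (f : (SymbolOperad k).carrier n) (ξ : Fin n → k) :
    (c • f) ξ = c * f ξ := rfl

theorem ne_zero_of_apply {n : ℕ} {f : (SymbolOperad k).carrier n} (ξ : Fin n → k) (h : f ξ ≠ 0) :
    f ≠ 0 := fun h0 => h (congrFun h0 ξ)

theorem act_swap_apply (m : (SymbolOperad k).carrier 2) (x y : k) :
    (SymbolOperad k).act (swap 0 1) m ![x, y] = m ![y, x] := by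
  rw [act_apply]
  congr 1
  ext i
  fin_cases i <;> rfl

theorem ext_two {f g : (SymbolOperad k).carrier 2} (h : ∀ x y, f ![x, y] = g ![x, y]) : f = g := by
  funext ξ
  rw [show ξ = ![ξ 0, ξ 1] by ext i; fin_cases i <;> rfl]
  exact h _ _

theorem leftComb_apply (m : (SymbolOperad k).carrier 2) (x y z : k) :
    (SymbolOperad k).leftComb m ![x, y, z] = m ![x + y, z] * m ![x, y] := by
  rw [LinOperad.leftComb, comp_apply]
  congr 2
  · ext i
    fin_cases i
    · exact (outerFreq_self _ _ _).trans (Fin.sum_univ_two _)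
    · rfl
  · ext i
    fin_cases i <;> rfl

theorem rightComb_apply (m : (SymbolOperad k).carrier 2) (x y z : k) :
    (SymbolOperad k).rightComb m ![x, y, z] = m ![x, y + z] * m ![y, z] := by
  rw [LinOperad.rightComb, comp_apply]
  congr 2
  · ext i
    fin_cases i
    · rfl
    · exact (outerFreq_self _ _ _).trans (Fin.sum_univ_two _)
  · ext i
    fin_cases i <;> rfl

theorem act_finRotate_apply (f : (SymbolOperad k).carrier 3) (x y z : k) :
    (SymbolOperad k).act (finRotate 3) f ![x, y, z] = f ![z, x, y] := by
  rw [act_apply]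
  congr 1
  ext i
  fin_cases i <;> rfl

theorem act_finRotate_mul_finRotate_apply (f : (SymbolOperad k).carrier 3) (x y z : k) :
    (SymbolOperad k).act (finRotate 3 * finRotate 3) f ![x, y, z] = f ![y, z, x] := by
  rw [SigmaModule.act_mul, act_finRotate_apply, act_finRotate_apply]

theorem act_swap_zero_one_apply (f : (SymbolOperad k).carrier 3) (x y z : k) :
    (SymbolOperad k).act (swap 0 1) f ![x, y, z] = f ![y, x, z] := by
  rw [act_apply]
  congr 1
  ext i
  fin_cases i <;> rfl

theorem act_swap_one_two_apply (f : (SymbolOperad k).carrier 3) (x y z : k) :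
    (SymbolOperad k).act (swap 1 2) f ![x, y, z] = f ![x, z, y] := by
  rw [act_apply]
  congr 1
  ext i
  fin_cases i <;> rfl

theorem act_swap_zero_two_apply (f : (SymbolOperad k).carrier 3) (x y z : k) :
    (SymbolOperad k).act (swap 0 2) f ![x, y, z] = f ![z, y, x] := by
  rw [act_apply]
  congr 1
  ext i
  fin_cases i <;> rfl

/-- The second difference of an affine function vanishes. This turns the degree bound into linear
equations between values of a symbol. -/
theorem second_difference {f : k → k} (hf : f ∈ polyDegLE k 1) : f 0 + f 2 = 2 * f 1 := by
  obtain ⟨q, hq, hf⟩ := mem_polyDegLE_natCast (d := 1).1 hf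
  obtain ⟨a, b, rfl⟩ := Polynomial.exists_eq_X_add_C_of_natDegree_le_one hq
  simp [hf]
  ring

theorem second_difference_of_mem {f : (SymbolOperad k).carrier 3}
    (hf : f ∈ filtration k 3 fun _ => 1) (y z : k) :
    f ![0, y, z] + f ![2, y, z] = 2 * f ![1, y, z] ∧
      f ![y, 0, z] + f ![y, 2, z] = 2 * f ![y, 1, z] ∧
      f ![y, z, 0] + f ![y, z, 2] = 2 * f ![y, z, 1] := by
  have e₀ : ∀ t, Function.update ![0, y, z] 0 t = ![t, y, z] := fun t => by
    ext i; fin_cases i <;> rfl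
  have e₁ : ∀ t, Function.update ![y, 0, z] 1 t = ![y, t, z] := fun t => by
    ext i; fin_cases i <;> rfl
  have e₂ : ∀ t, Function.update ![y, z, 0] 2 t = ![y, z, t] := fun t => by
    ext i; fin_cases i <;> rfl
  have h₀ := second_difference (hf 0 ![0, y, z])
  have h₁ := second_difference (hf 1 ![y, 0, z])
  have h₂ := second_difference (hf 2 ![y, z, 0])
  simp only [e₀, e₁, e₂] at h₀ h₁ h₂
  exact ⟨h₀, h₁, h₂⟩

/-- The operation with symbol `a x + b y + c x y`. -/
def bilinearSymbol (a b c : k) : (SymbolOperad k).carrier 2 :=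
  fun ξ => a * ξ 0 + b * ξ 1 + c * ξ 0 * ξ 1

theorem bilinearSymbol_mem (a b c : k) :
    bilinearSymbol a b c ∈ filtration k 2 fun _ => 1 := by
  open Polynomial in
  intro i ξ
  refine mem_polyDegLE_natCast (d := 1).2 ?_
  fin_cases i
  · refine ⟨C (a + c * ξ 1) * X + C (b * ξ 1), natDegree_linear_le, fun t => ?_⟩
    simp [bilinearSymbol]
    ring
  · refine ⟨C (b + c * ξ 0) * X + C (a * ξ 0), natDegree_linear_le, fun t => ?_⟩
    simp [bilinearSymbol]
    ring

end SymbolOperad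

/-! ### Binary modules and the morphisms given by one binary operation -/

section

variable {k : Type u} [Field k] {W : Type v} [AddCommGroup W] [Module k W] {t : W →ₗ[k] W}
  {ht : t ∘ₗ t = LinearMap.id}

variable (t ht) in
/-- The elements of arity two of a binary module. -/
def binaryConst : W →ₗ[k] (binaryModule k W t ht).carrier 2 :=
  (LinearMap.pi fun _ => LinearMap.id : W →ₗ[k] PLift (2 = 2) → W)

theorem binaryConst_surjective : Function.Surjective (binaryConst t ht) :=
  fun y => ⟨y ⟨rfl⟩, rfl⟩

theorem binaryConst_injective : Function.Injective (binaryConst t ht) :=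
  fun _ _ h => congrFun h ⟨rfl⟩

theorem act_swap_binaryConst (x : W) :
    (binaryModule k W t ht).act (swap 0 1) (binaryConst t ht x) = binaryConst t ht (t x) :=
  binaryModule_act_swap _

theorem act_swap_gen_binaryConst {x : W} {ε : k} (h : t x = ε • x) :
    (FreeOperad (binaryModule k W t ht)).act (swap 0 1) (FreeOperad.gen _ 2 (binaryConst t ht x)) =
      ε • FreeOperad.gen _ 2 (binaryConst t ht x) := by
  rw [FreeOperad.act_gen, act_swap_binaryConst, h, map_smul, map_smul]

theorem gen_mem_span_of_span {x : W} (h : ∀ y, y ∈ Submodule.span k {x})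
    (y : (binaryModule k W t ht).carrier 2) :
    FreeOperad.gen _ 2 y ∈ Submodule.span k {FreeOperad.gen _ 2 (binaryConst t ht x)} := by
  obtain ⟨y, rfl⟩ := binaryConst_surjective y
  obtain ⟨c, rfl⟩ := Submodule.mem_span_singleton.1 (h y)
  rw [map_smul, map_smul]
  exact Submodule.smul_mem _ _ (Submodule.mem_span_singleton_self _)

theorem mem_span_binaryConst {x : W} (h : ∀ y, y ∈ Submodule.span k {x, t x})
    (y : (binaryModule k W t ht).carrier 2) :
    y ∈ Submodule.span k
      {binaryConst t ht x, (binaryModule k W t ht).act (swap 0 1) (binaryConst t ht x)} := by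
  obtain ⟨y, rfl⟩ := binaryConst_surjective y
  have := Submodule.mem_map_of_mem (f := binaryConst t ht) (h y)
  rwa [Submodule.map_span, Set.image_pair, ← act_swap_binaryConst] at this

theorem gen_mem_span_pair {x : W} (h : ∀ y, y ∈ Submodule.span k {x, t x})
    (y : (binaryModule k W t ht).carrier 2) :
    FreeOperad.gen _ 2 y ∈ Submodule.span k {FreeOperad.gen _ 2 (binaryConst t ht x),
      (FreeOperad (binaryModule k W t ht)).act (swap 0 1)
        (FreeOperad.gen _ 2 (binaryConst t ht x))} := by
  have := Submodule.mem_map_of_mem (f := FreeOperad.gen _ 2) (mem_span_binaryConst (ht := ht) h y)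
  rwa [Submodule.map_span, Set.image_pair, ← FreeOperad.act_gen] at this

/-- A morphism to the operad of symbols maps the standard multifiltration to the filtration by the
degrees if the generators have degree one. -/
theorem binaryLift_mem_filtration {g : W →ₗ[k] (SymbolOperad k).carrier 2}
    (hg : ∀ x, g (t x) = (SymbolOperad k).act (swap 0 1) (g x))
    (hdeg : ∀ x, g x ∈ SymbolOperad.filtration k 2 fun _ => 1) {n : ℕ} {p : Fin n → ℤ}
    {z : (FreeOperad (binaryModule k W t ht)).carrier n}
    (hz : z ∈ FreeOperad.standard (binaryModule k W t ht) n p) :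
    (binaryLift t ht _ g hg).app n z ∈ SymbolOperad.filtration k n p := by
  refine (binaryLift t ht _ g hg).map_mem_of_mem_standard SymbolOperad.isMultifiltration
    SymbolOperad.isSaturated ?_ hz
  rintro m _ ⟨x, rfl⟩
  by_cases hm : m = 2
  · subst hm
    exact hdeg _
  · have := binaryModule_subsingleton (ht := ht) m hm
    rw [Subsingleton.elim x 0, map_zero, map_zero]
    exact Submodule.zero_mem _

end

section

variable (k : Type u) [Field k]

/-- The generator of the free operad on one symmetric binary operation. -/
def symOp : (FreeOperad (symGen k)).carrier 2 :=
  FreeOperad.gen (symGen k) 2 (fun _ : PLift (2 = 2) => (1 : k))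

variable {k} (P : LinOperad.{u, w} k)

/-- The morphism that is given by an antisymmetric operation. -/
def antisymLift (μ : P.carrier 2) (hμ : P.act (swap 0 1) μ = -μ) :
    LinOperad.Hom (FreeOperad (antisymGen k)) P :=
  binaryLift (-LinearMap.id) (by ext; simp) P (LinearMap.toSpanSingleton k _ μ) fun x => by
    simp [hμ]

/-- The morphism that is given by a symmetric operation. -/
def symLift (μ : P.carrier 2) (hμ : P.act (swap 0 1) μ = μ) :
    LinOperad.Hom (FreeOperad (symGen k)) P :=
  binaryLift LinearMap.id rfl P (LinearMap.toSpanSingleton k _ μ) fun x => by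
    simp [hμ]

/-- The linear map `(a, b) ↦ a μ + b μτ`. -/
def nosymMap (μ : P.carrier 2) : (k × k) →ₗ[k] P.carrier 2 :=
  (LinearMap.toSpanSingleton k _ μ).coprod
    (LinearMap.toSpanSingleton k _ (P.act (swap 0 1) μ))

theorem nosymMap_apply (μ : P.carrier 2) (x : k × k) :
    nosymMap P μ x = x.1 • μ + x.2 • P.act (swap 0 1) μ := rfl

/-- The morphism that is given by an arbitrary binary operation. -/
def nosymLift (μ : P.carrier 2) : LinOperad.Hom (FreeOperad (nosymGen k)) P :=
  binaryLift (LinearMap.prod (LinearMap.snd k k k) (LinearMap.fst k k k)) (by ext <;> simp) P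
    (nosymMap P μ) fun x => by
      simp [nosymMap_apply, LinOperad.act_swap_act_swap, add_comm]

theorem antisymLift_op (μ : P.carrier 2) (hμ : P.act (swap 0 1) μ = -μ) :
    (antisymLift P μ hμ).app 2 (antisymOp k) = μ := one_smul k μ

theorem symLift_op (μ : P.carrier 2) (hμ : P.act (swap 0 1) μ = μ) :
    (symLift P μ hμ).app 2 (symOp k) = μ := one_smul k μ

theorem nosymLift_op (μ : P.carrier 2) : (nosymLift P μ).app 2 (nosymOp k) = μ := by
  refine (nosymMap_apply P μ (1, 0)).trans ?_
  simp

theorem mem_span_one (x : k) : x ∈ Submodule.span k {(1 : k)} :=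
  Submodule.mem_span_singleton.2 ⟨x, by simp⟩

theorem mem_span_nosym (x : k × k) : x ∈ Submodule.span k {((1, 0) : k × k),
    LinearMap.prod (LinearMap.snd k k k) (LinearMap.fst k k k) (1, 0)} :=
  Submodule.mem_span_pair.2 ⟨x.1, x.2, by ext <;> simp⟩

theorem act_antisymOp :
    (FreeOperad (antisymGen k)).act (swap 0 1) (antisymOp k) = (-1 : k) • antisymOp k :=
  act_swap_gen_binaryConst (by simp)

theorem act_symOp : (FreeOperad (symGen k)).act (swap 0 1) (symOp k) = (1 : k) • symOp k :=
  act_swap_gen_binaryConst (by simp)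

theorem gen_antisym_mem (x : (antisymGen k).carrier 2) :
    FreeOperad.gen (antisymGen k) 2 x ∈ Submodule.span k {antisymOp k} :=
  gen_mem_span_of_span mem_span_one x

theorem gen_sym_mem (x : (symGen k).carrier 2) :
    FreeOperad.gen (symGen k) 2 x ∈ Submodule.span k {symOp k} :=
  gen_mem_span_of_span mem_span_one x

theorem gen_nosym_mem (x : (nosymGen k).carrier 2) :
    FreeOperad.gen (nosymGen k) 2 x ∈
      Submodule.span k {nosymOp k, (FreeOperad (nosymGen k)).act (swap 0 1) (nosymOp k)} :=
  gen_mem_span_pair mem_span_nosym x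

end

/-! ### Upper bounds for the standard piece, and nonvanishing of the relations -/

section

open LinOperad

variable {k : Type u} [Field k]

theorem act_swap_bilinearSymbol_antisym : (SymbolOperad k).act (swap 0 1)
    (SymbolOperad.bilinearSymbol (-1) 1 0) = -SymbolOperad.bilinearSymbol (-1 : k) 1 0 := by
  refine SymbolOperad.ext_two fun x y => ?_
  rw [SymbolOperad.act_swap_apply, SymbolOperad.neg_apply]
  simp [SymbolOperad.bilinearSymbol]

theorem act_swap_bilinearSymbol_sym : (SymbolOperad k).act (swap 0 1)
    (SymbolOperad.bilinearSymbol 0 0 1) = SymbolOperad.bilinearSymbol (0 : k) 0 1 := by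
  refine SymbolOperad.ext_two fun x y => ?_
  rw [SymbolOperad.act_swap_apply]
  simp [SymbolOperad.bilinearSymbol, mul_comm]

variable [CharZero k]

/-- The symbol `y - x` is that of the bracket `f g' - f' g`. The right comb becomes `z² - y² + x y -
x z`, so in the combination of its rotations with coefficients `a`, `b`, `c` the squares of `x`,
`y`, `z` have coefficients `c - b`, `b - a`, `a - c`. These vanish only if `a = b = c`, a multiple
of the Jacobiator. -/
theorem standard_antisymGen_le : FreeOperad.standard (antisymGen k) 3 (fun _ => 1) ≤
    Submodule.span k {(FreeOperad (antisymGen k)).jacobiator (antisymOp k)} := by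
  intro z hz
  have hφ := binaryLift_mem_filtration (g := LinearMap.toSpanSingleton k _
      (SymbolOperad.bilinearSymbol (-1) 1 0)) (by simp [act_swap_bilinearSymbol_antisym])
    (fun x => Submodule.smul_mem _ x (SymbolOperad.bilinearSymbol_mem _ _ _)) hz
  change (antisymLift (SymbolOperad k) _ act_swap_bilinearSymbol_antisym).app 3 z ∈ _ at hφ
  obtain ⟨a, b, c, rfl⟩ := FreeOperad.exists_coeff_of_eigen (E := antisymGen k)
    binaryModule_subsingleton gen_antisym_mem act_antisymOp (by simp) z
  simp only [map_add, map_smul, Hom.map_act, Hom.map_rightComb, antisymLift_op] at hφ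
  -- With the other variables set to zero, these are the equations for the coefficients of `x²` and
  -- `y²`.
  obtain ⟨h₀, h₁, -⟩ := SymbolOperad.second_difference_of_mem hφ 0 0
  simp only [SymbolOperad.add_apply, SymbolOperad.smul_apply, SymbolOperad.act_finRotate_apply,
    SymbolOperad.act_finRotate_mul_finRotate_apply, SymbolOperad.rightComb_apply,
    SymbolOperad.bilinearSymbol, Matrix.cons_val_zero, Matrix.cons_val_one] at h₀ h₁
  have hb : b = a := by linear_combination (1 / 2) * h₁
  have hc : c = a := by linear_combination (1 / 2) * h₀ + (1 / 2) * h₁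
  subst hb hc
  rw [← smul_add, ← smul_add]
  exact Submodule.smul_mem _ _ (Submodule.mem_span_singleton_self _)

/-- With the symbol `x y` the right comb becomes `x y z (y + z)`, and a combination of its rotations
is `x y z` times `(b + c) x + (a + b) y + (a + c) z`. Degree at most one in each variable makes the
pairwise sums vanish, and hence `a`, `b`, `c`, since two is invertible. -/
theorem standard_symGen_eq_bot : FreeOperad.standard (symGen k) 3 (fun _ => 1) = ⊥ := by
  refine le_bot_iff.1 fun z hz => ?_
  have hφ := binaryLift_mem_filtration (g := LinearMap.toSpanSingleton k _
      (SymbolOperad.bilinearSymbol 0 0 1)) (by simp [act_swap_bilinearSymbol_sym])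
    (fun x => Submodule.smul_mem _ x (SymbolOperad.bilinearSymbol_mem _ _ _)) hz
  change (symLift (SymbolOperad k) _ act_swap_bilinearSymbol_sym).app 3 z ∈ _ at hφ
  obtain ⟨a, b, c, rfl⟩ := FreeOperad.exists_coeff_of_eigen (E := symGen k)
    binaryModule_subsingleton gen_sym_mem act_symOp (by simp) z
  simp only [map_add, map_smul, Hom.map_act, Hom.map_rightComb, symLift_op] at hφ
  obtain ⟨h₀, h₁, h₂⟩ := SymbolOperad.second_difference_of_mem hφ 1 1
  simp only [SymbolOperad.add_apply, SymbolOperad.smul_apply, SymbolOperad.act_finRotate_apply,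
    SymbolOperad.act_finRotate_mul_finRotate_apply, SymbolOperad.rightComb_apply,
    SymbolOperad.bilinearSymbol, Matrix.cons_val_zero, Matrix.cons_val_one] at h₀ h₁ h₂
  have ha : a = 0 := by linear_combination (1 / 4) * (h₁ + h₂ - h₀)
  have hb : b = 0 := by linear_combination (1 / 4) * (h₀ + h₁ - h₂)
  have hc : c = 0 := by linear_combination (1 / 4) * (h₀ + h₂ - h₁)
  simp [ha, hb, hc]

/-- The symbol `-x + y + x y` mixes the antisymmetric and the symmetric symbols used for the other
two kinds of operation. An arity three element has twelve coefficients `a σ`, `b σ`, and the degree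
conditions force `a σ = sgn σ * a 1` and `b σ = -sgn σ * a 1`. -/
theorem standard_nosymGen_le : FreeOperad.standard (nosymGen k) 3 (fun _ => 1) ≤
    Submodule.span k {(FreeOperad (nosymGen k)).lieAdmissibility (nosymOp k)} := by
  intro z hz
  have hsw : ∀ a b c : k, (SymbolOperad k).act (swap 0 1) (SymbolOperad.bilinearSymbol a b c) =
      SymbolOperad.bilinearSymbol b a c := fun a b c => by
    refine SymbolOperad.ext_two fun x y => ?_
    rw [SymbolOperad.act_swap_apply]
    simp only [SymbolOperad.bilinearSymbol, Matrix.cons_val_zero, Matrix.cons_val_one]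
    ring
  have hφ := binaryLift_mem_filtration (g := nosymMap (SymbolOperad k)
      (SymbolOperad.bilinearSymbol (-1) 1 1))
    (fun x => by simp [nosymMap_apply, act_swap_act_swap, add_comm])
    (fun x => Submodule.add_mem _
      (Submodule.smul_mem _ x.1 (SymbolOperad.bilinearSymbol_mem _ _ _))
      (Submodule.smul_mem _ x.2 (hsw _ _ _ ▸ SymbolOperad.bilinearSymbol_mem _ _ _))) hz
  change (nosymLift (SymbolOperad k) (SymbolOperad.bilinearSymbol (-1) 1 1)).app 3 z ∈ _ at hφ
  obtain ⟨a, b, rfl⟩ := FreeOperad.exists_coeff (E := nosymGen k) binaryModule_subsingleton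
    gen_nosym_mem z
  simp only [OperadComp.sum_perm_fin_three, SigmaModule.act_one, map_add, map_smul, Hom.map_act,
    Hom.map_leftComb, Hom.map_rightComb, nosymLift_op] at hφ
  have h := SymbolOperad.second_difference_of_mem hφ
  simp only [SymbolOperad.add_apply, SymbolOperad.smul_apply, SymbolOperad.act_finRotate_apply,
    SymbolOperad.act_finRotate_mul_finRotate_apply, SymbolOperad.act_swap_zero_one_apply,
    SymbolOperad.act_swap_one_two_apply, SymbolOperad.act_swap_zero_two_apply,
    SymbolOperad.leftComb_apply, SymbolOperad.rightComb_apply,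
    SymbolOperad.bilinearSymbol, Matrix.cons_val_zero, Matrix.cons_val_one] at h
  -- The first digit is the variable in which the second difference is taken, the other two are the
  -- values of the remaining variables. Eleven of the twelve equations suffice to cut the twelve
  -- unknowns down to a line.
  obtain ⟨h000, h100, h200⟩ := h 0 0
  obtain ⟨h001, h101, h201⟩ := h 0 1
  obtain ⟨h010, h110, h210⟩ := h 1 0
  obtain ⟨h011, h111, h211⟩ := h 1 1
  replace h000 : a 1 - a (finRotate 3) - a (swap 0 1) + a (swap 1 2) - b (finRotate 3) +
      b (finRotate 3 * finRotate 3) - b (swap 0 1) + b (swap 0 2) = 0 := by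
    linear_combination (1 / 2) * h000
  replace h001 : -2 * a (finRotate 3) - 2 * b (finRotate 3) +
      2 * b (finRotate 3 * finRotate 3) + 2 * b (swap 0 2) = 0 := by
    linear_combination (1 / 2) * h001
  replace h010 : -2 * a (swap 0 1) + 2 * b (finRotate 3 * finRotate 3) - 2 * b (swap 0 1) +
      2 * b (swap 0 2) = 0 := by
    linear_combination (1 / 2) * h010
  replace h011 : 4 * b (finRotate 3 * finRotate 3) + 4 * b (swap 0 2) = 0 := by
    linear_combination (1 / 2) * h011
  replace h100 : -a 1 + a (finRotate 3 * finRotate 3) + a (swap 0 1) - a (swap 0 2) - b 1 +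
      b (finRotate 3) + b (swap 1 2) - b (swap 0 2) = 0 := by
    linear_combination (1 / 2) * h100
  replace h101 : -2 * a (swap 0 2) + 2 * b (finRotate 3) + 2 * b (swap 1 2) -
      2 * b (swap 0 2) = 0 := by
    linear_combination (1 / 2) * h101
  replace h110 : -2 * a 1 - 2 * b 1 + 2 * b (finRotate 3) + 2 * b (swap 1 2) = 0 := by
    linear_combination (1 / 2) * h110
  replace h111 : 4 * b (finRotate 3) + 4 * b (swap 1 2) = 0 := by
    linear_combination (1 / 2) * h111
  replace h201 : -2 * a (finRotate 3 * finRotate 3) + 2 * b 1 -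
      2 * b (finRotate 3 * finRotate 3) + 2 * b (swap 0 1) = 0 := by
    linear_combination (1 / 2) * h201
  replace h210 : -2 * a (swap 1 2) + 2 * b 1 + 2 * b (swap 0 1) - 2 * b (swap 1 2) = 0 := by
    linear_combination (1 / 2) * h210
  replace h211 : 4 * b 1 + 4 * b (swap 0 1) = 0 := by
    linear_combination (1 / 2) * h211
  -- Gaussian elimination: each unknown is expressed through `a 1`.
  have e1 : a (finRotate 3) = a 1 := by
    linear_combination (-1) * h000 + (1/2) * h010 + (-1/4) * h111 + (-1/2) * h210 + (1/4) * h211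
  have e2 : a (finRotate 3 * finRotate 3) = a 1 := by
    linear_combination (1/2) * h010 + (-1/4) * h011 + (1) * h100 + (-1/2) * h101 + (1/4) * h211
  have e3 : a (swap 0 1) = -a 1 := by
    linear_combination (-1/2) * h010 + (1/4) * h011 + (-1/2) * h110 + (1/4) * h111 + (-1/4) * h211
  have e4 : a (swap 1 2) = -a 1 := by
    linear_combination (1) * h000 + (-1/2) * h001 + (-1/2) * h010 + (1/4) * h011
  have e5 : a (swap 0 2) = -a 1 := by
    linear_combination (-1/2) * h010 + (-1) * h100 + (1/4) * h111 + (-1/2) * h201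
  have e6 : b 1 = -a 1 := by
    linear_combination (-1/2) * h110 + (1/4) * h111
  have e7 : b (finRotate 3) = -a 1 := by
    linear_combination (1) * h000 + (-1/2) * h001 + (-1/2) * h010 + (1/4) * h011 +
      (1/4) * h111 + (1/2) * h210 + (-1/4) * h211
  have e8 : b (finRotate 3 * finRotate 3) = -a 1 := by
    linear_combination (-1/2) * h010 + (1/4) * h011 + (-1) * h100 + (1/2) * h101 + (-1/2) * h201
  have e9 : b (swap 0 1) = a 1 := by
    linear_combination (1/2) * h110 + (-1/4) * h111 + (1/4) * h211
  have e10 : b (swap 1 2) = a 1 := by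
    linear_combination (-1) * h000 + (1/2) * h001 + (1/2) * h010 + (-1/4) * h011 +
      (-1/2) * h210 + (1/4) * h211
  have e11 : b (swap 0 2) = a 1 := by
    linear_combination (1/2) * h010 + (1) * h100 + (-1/2) * h101 + (1/2) * h201
  have s₁ : Perm.sign (finRotate 3) = 1 := by decide
  have s₂ : Perm.sign (finRotate 3 * finRotate 3) = 1 := by decide
  have s₃ : Perm.sign (swap 0 1 : Perm (Fin 3)) = -1 := by decide
  have s₄ : Perm.sign (swap 1 2 : Perm (Fin 3)) = -1 := by decide
  have s₅ : Perm.sign (swap 0 2 : Perm (Fin 3)) = -1 := by decide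
  refine Submodule.mem_span_singleton.2 ⟨a 1, ?_⟩
  rw [lieAdmissibility, Finset.smul_sum, OperadComp.sum_perm_fin_three,
    OperadComp.sum_perm_fin_three]
  simp only [e1, e2, e3, e4, e5, e6, e7, e8, e9, e10, e11, s₁, s₂, s₃, s₄, s₅, Perm.sign_one,
    Units.val_one, Units.val_neg, Int.cast_one, Int.cast_neg, map_add, map_sub, map_smul]
  module

/-- The symbol `y - x` satisfies the Jacobi identity, so a different antisymmetric symbol is needed
to detect the Jacobiator; `x³ - y³` violates the identity. -/
theorem jacobiator_antisymOp_ne_zero :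
    (FreeOperad (antisymGen k)).jacobiator (antisymOp k) ≠ 0 := by
  intro h
  let m : (SymbolOperad k).carrier 2 := fun ξ => ξ 0 ^ 3 - ξ 1 ^ 3
  have hm : (SymbolOperad k).act (swap 0 1) m = -m := by
    refine SymbolOperad.ext_two fun x y => ?_
    rw [SymbolOperad.act_swap_apply, SymbolOperad.neg_apply]
    simp [m]
  have := congrArg ((antisymLift (SymbolOperad k) m hm).app 3) h
  rw [Hom.map_jacobiator, antisymLift_op, map_zero] at this
  -- The three summands at this point are `-56`, `189` and `-7`, with sum `126`.
  have := congrFun this ![1, 2, 0]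
  simp only [jacobiator, SymbolOperad.add_apply, SymbolOperad.act_finRotate_apply,
    SymbolOperad.act_finRotate_mul_finRotate_apply, SymbolOperad.rightComb_apply] at this
  change _ = (0 : k) at this
  norm_num [m] at this

/-- Specializing the operation to an antisymmetric one doubles it under the commutator. The
Jacobiator is quadratic, so the relation specializes, up to sign, to four times the Jacobiator of
the free antisymmetric operation. -/
theorem lieAdmissibility_nosymOp_ne_zero :
    (FreeOperad (nosymGen k)).lieAdmissibility (nosymOp k) ≠ 0 := by
  intro h
  rw [lieAdmissibility_eq, neg_eq_zero] at h
  let φ := nosymLift (FreeOperad (antisymGen k)) (antisymOp k)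
  have hφ := congrArg (φ.app 3) h
  rw [Hom.map_jacobiator, map_sub, Hom.map_act, nosymLift_op, act_antisymOp, map_zero] at hφ
  have e : antisymOp k - (-1 : k) • antisymOp k = (2 : k) • antisymOp k := by module
  have e' : (FreeOperad (antisymGen k)).jacobiator ((2 : k) • antisymOp k) =
      (4 : k) • (FreeOperad (antisymGen k)).jacobiator (antisymOp k) := by
    simp only [jacobiator, rightComb, map_smul, LinearMap.smul_apply]
    module
  rw [e, e', smul_eq_zero] at hφ
  exact hφ.elim (by norm_num) jacobiator_antisymOp_ne_zero

end

/-! ### Lower bounds for the standard piece -/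

section

open LinOperad

variable {k : Type u} [Field k]

/-- Every binary operation of the free operad is a generator, so `ν` has multiindex `(1, 1)` in each
multifiltration that enters the intersection. -/
theorem jacobiator_mem_standard {E : SigmaModule.{u, v} k} {ν : (FreeOperad E).carrier 2}
    (hE : ∀ n, n ≠ 2 → Subsingleton (E.carrier n)) (hν : (FreeOperad E).act (swap 0 1) ν = -ν) :
    (FreeOperad E).jacobiator ν ∈ FreeOperad.standard E 3 fun _ => 1 :=
  mem_standardMultifiltration.2 fun _ hF hF' h =>
    jacobiator_mem hF hF' hν (h 2 (FreeOperad.arity_two hE ν))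

theorem jacobiator_antisymOp_mem_standard :
    (FreeOperad (antisymGen k)).jacobiator (antisymOp k) ∈
      FreeOperad.standard (antisymGen k) 3 fun _ => 1 :=
  jacobiator_mem_standard binaryModule_subsingleton (act_antisymOp.trans (neg_one_smul _ _))

theorem lieAdmissibility_nosymOp_mem_standard :
    (FreeOperad (nosymGen k)).lieAdmissibility (nosymOp k) ∈
      FreeOperad.standard (nosymGen k) 3 fun _ => 1 := by
  rw [lieAdmissibility_eq]
  exact Submodule.neg_mem _
    (jacobiator_mem_standard binaryModule_subsingleton (act_swap_sub_act_swap _))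

/-! ### Tight quadratic operads that are isomorphic to the given ones -/

variable {P : LinOperad.{u, w} k} {V : SigmaModule.{u, v} k}

theorem isTightQuadraticOneBinary_of_isomorphic_free
    (hV : ∀ n, n ≠ 2 → Subsingleton (V.carrier n)) (hgen : Function.Injective (FreeOperad.gen V 2))
    {x : V.carrier 2} (hx : x ≠ 0) (hspan : ∀ y, y ∈ Submodule.span k {x, V.act (swap 0 1) x})
    (h : P.Isomorphic (FreeOperad V)) : P.IsTightQuadraticOneBinary := by
  refine isTightQuadraticOneBinary_of_isomorphic hV hgen hx hspan
    ⟨fun _ => LinearMap.id, rfl, fun _ _ => rfl, fun _ _ _ _ => rfl⟩ (R := fun _ => ∅)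
    (fun n => ⟨Function.surjective_id, ?_⟩) (by simp) (by simp) h
  rw [idealSpan_eq_bot (by simp)]
  exact LinearMap.ker_id

/-- Any relation of arity three has weight two when the generators are binary, so quadraticity is
automatic and only tightness has to be assumed. -/
theorem isTightQuadraticOneBinary_of_isomorphic_quotient
    (hV : ∀ n, n ≠ 2 → Subsingleton (V.carrier n)) (hgen : Function.Injective (FreeOperad.gen V 2))
    {x : V.carrier 2} (hx : x ≠ 0) (hspan : ∀ y, y ∈ Submodule.span k {x, V.act (swap 0 1) x})
    {r : (FreeOperad V).carrier 3} (hr : r ∈ FreeOperad.standard V 3 fun _ => 1)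
    (h : P.Isomorphic ((FreeOperad V).quotient
      ((FreeOperad V).idealSpan ((FreeOperad V).oneRelation r)))) :
    P.IsTightQuadraticOneBinary :=
  isTightQuadraticOneBinary_of_isomorphic hV hgen hx hspan (quotientMap _ _)
    (R := (FreeOperad V).oneRelation r)
    (fun n => ⟨quotientMap_surjective _ n, ker_quotientMap _ n⟩)
    (fun n => oneRelation_subset (r := r)
      (S := fun n => (FreeOperad.weightTwo V n : Set ((FreeOperad V).carrier n)))
      (FreeOperad.arity_three hV r) n)
    (fun n => oneRelation_subset (r := r)
      (S := fun n => (FreeOperad.standard V n (fun _ => 1) : Set ((FreeOperad V).carrier n))) hr n)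
    h

end

/-! ### The classification -/

section

open LinOperad

variable {k : Type u} [Field k]

theorem LinOperad.IsTightQuadraticOneBinary.isomorphic [CharZero k] {P : LinOperad.{u, w} k}
    (h : P.IsTightQuadraticOneBinary) :
    P.Isomorphic (FreeOperad (antisymGen k)) ∨ P.Isomorphic (FreeOperad (symGen k)) ∨
      P.Isomorphic (FreeOperad (nosymGen k)) ∨ P.Isomorphic (LieOperad k) ∨
      P.Isomorphic (LieAdmOperad k) := by
  obtain ⟨μ, hμ, hq, ht⟩ := h
  rcases binary_trichotomy hμ with h | h | h
  · obtain ⟨hq', ht'⟩ := spanOne_isQuadratic_and_isTight_iff (V := antisymGen k)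
      binaryModule_subsingleton (antisymLift P μ h) (μ := μ)
      (binaryLift_gen_injective _ (smul_left_injective k hμ))
      ((range_binaryLift_gen _).trans
        (by rw [h, ← LinearMap.span_singleton_eq_range, Set.pair_comm,
          Submodule.span_insert_eq_span
            (Submodule.neg_mem _ (Submodule.mem_span_singleton_self μ))]))
    rcases isomorphic_free_or_quotient binaryModule_subsingleton (hq'.1 hq) (ht'.1 ht)
      standard_antisymGen_le with h | h
    · exact .inl h
    · exact .inr (.inr (.inr (.inl h)))
  · obtain ⟨hq', ht'⟩ := spanOne_isQuadratic_and_isTight_iff (V := symGen k)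
      binaryModule_subsingleton (symLift P μ h) (μ := μ)
      (binaryLift_gen_injective _ (smul_left_injective k hμ))
      ((range_binaryLift_gen _).trans
        (by rw [h, ← LinearMap.span_singleton_eq_range, Set.pair_eq_singleton]))
    refine .inr (.inl (isomorphic_free_of_ker_eq_bot binaryModule_subsingleton (hq'.1 hq)
      (ht'.1 ht) (le_bot_iff.1 ?_)))
    rw [← standard_symGen_eq_bot]
    exact (FreeOperad.exists_generators_of_quadratic_of_tight binaryModule_subsingleton (hq'.1 hq)
      (ht'.1 ht)).1
  -- Linear independence of `μ` and its opposite says that `P(2)` contains the regular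
  -- representation as the span of `μ`.
  · have hinj : Function.Injective (nosymMap P μ) := by
      rw [injective_iff_map_eq_zero]
      intro x hx
      obtain ⟨h₁, h₂⟩ := LinearIndependent.pair_iff.1 h x.1 x.2 hx
      exact Prod.ext h₁ h₂
    obtain ⟨hq', ht'⟩ := spanOne_isQuadratic_and_isTight_iff (V := nosymGen k)
      binaryModule_subsingleton (nosymLift P μ) (μ := μ) (binaryLift_gen_injective _ hinj)
      ((range_binaryLift_gen _).trans
        (by rw [nosymMap, LinearMap.range_coprod, ← LinearMap.span_singleton_eq_range,
          ← LinearMap.span_singleton_eq_range, ← Submodule.span_union, Set.singleton_union]))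
    rcases isomorphic_free_or_quotient binaryModule_subsingleton (hq'.1 hq) (ht'.1 ht)
      standard_nosymGen_le with h | h
    · exact .inr (.inr (.inl h))
    · exact .inr (.inr (.inr (.inr h)))

theorem gen_antisymGen_injective : Function.Injective (FreeOperad.gen (antisymGen k) 2) :=
  gen_injective_of_binaryLift (P := SymbolOperad k) (g := LinearMap.toSpanSingleton k _
    (SymbolOperad.bilinearSymbol (-1) 1 0)) (by simp [act_swap_bilinearSymbol_antisym])
    (smul_left_injective k (SymbolOperad.ne_zero_of_apply ![0, 1] (by
      simp [SymbolOperad.bilinearSymbol])))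

theorem gen_symGen_injective : Function.Injective (FreeOperad.gen (symGen k) 2) :=
  gen_injective_of_binaryLift (P := SymbolOperad k) (g := LinearMap.toSpanSingleton k _
    (SymbolOperad.bilinearSymbol 0 0 1)) (by simp [act_swap_bilinearSymbol_sym])
    (smul_left_injective k (SymbolOperad.ne_zero_of_apply ![1, 1] (by
      simp [SymbolOperad.bilinearSymbol])))

/-- The symbol `x` and its opposite `y` are linearly independent, as their values at `(1, 0)` and
`(0, 1)` show. -/
theorem gen_nosymGen_injective : Function.Injective (FreeOperad.gen (nosymGen k) 2) := by
  refine gen_injective_of_binaryLift (P := SymbolOperad k) (g := nosymMap (SymbolOperad k)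
    (SymbolOperad.bilinearSymbol 1 0 0))
    (fun x => by simp [nosymMap_apply, act_swap_act_swap, add_comm]) ?_
  rw [injective_iff_map_eq_zero]
  intro x hx
  have h₁ := congrFun hx ![1, 0]
  have h₂ := congrFun hx ![0, 1]
  rw [nosymMap_apply, SymbolOperad.add_apply, SymbolOperad.smul_apply, SymbolOperad.smul_apply,
    SymbolOperad.act_swap_apply] at h₁ h₂
  change _ = (0 : k) at h₁ h₂
  simp only [SymbolOperad.bilinearSymbol, Matrix.cons_val_zero, Matrix.cons_val_one] at h₁ h₂
  exact Prod.ext (by simpa using h₁) (by simpa using h₂)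

theorem isTightQuadraticOneBinary_of_isomorphic_standard {P : LinOperad.{u, w} k}
    (h : P.Isomorphic (FreeOperad (antisymGen k)) ∨ P.Isomorphic (FreeOperad (symGen k)) ∨
      P.Isomorphic (FreeOperad (nosymGen k)) ∨ P.Isomorphic (LieOperad k) ∨
      P.Isomorphic (LieAdmOperad k)) : P.IsTightQuadraticOneBinary := by
  have ha : binaryConst (-LinearMap.id) (by ext; simp) (1 : k) ≠ (0 : (antisymGen k).carrier 2) :=
    fun h => one_ne_zero (binaryConst_injective (h.trans (map_zero _).symm))
  have hs : binaryConst LinearMap.id rfl (1 : k) ≠ (0 : (symGen k).carrier 2) :=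
    fun h => one_ne_zero (binaryConst_injective (h.trans (map_zero _).symm))
  have hn : binaryConst (LinearMap.prod (LinearMap.snd k k k) (LinearMap.fst k k k))
      (by ext <;> simp) ((1, 0) : k × k) ≠ (0 : (nosymGen k).carrier 2) :=
    fun h => one_ne_zero (congrArg Prod.fst (binaryConst_injective (h.trans (map_zero _).symm)))
  have one : ∀ t x y : k, y ∈ Submodule.span k {(1 : k), t} := fun t _ y =>
    Submodule.span_mono (by simp) (mem_span_one y)
  rcases h with h | h | h | h | h
  · exact isTightQuadraticOneBinary_of_isomorphic_free binaryModule_subsingleton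
      gen_antisymGen_injective ha (mem_span_binaryConst (one _ 0)) h
  · exact isTightQuadraticOneBinary_of_isomorphic_free binaryModule_subsingleton
      gen_symGen_injective hs (mem_span_binaryConst (one _ 0)) h
  · exact isTightQuadraticOneBinary_of_isomorphic_free binaryModule_subsingleton
      gen_nosymGen_injective hn (mem_span_binaryConst mem_span_nosym) h
  · exact isTightQuadraticOneBinary_of_isomorphic_quotient binaryModule_subsingleton
      gen_antisymGen_injective ha (mem_span_binaryConst (one _ 0))
      jacobiator_antisymOp_mem_standard h
  · exact isTightQuadraticOneBinary_of_isomorphic_quotient binaryModule_subsingleton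
      gen_nosymGen_injective hn (mem_span_binaryConst mem_span_nosym)
      lieAdmissibility_nosymOp_mem_standard h

end

theorem mainTheorem1 (k : Type u) [Field k] [CharZero k] :
    (∀ P : LinOperad.{u, v} k, P.IsTightQuadraticOneBinary ↔
      (P.Isomorphic (FreeOperad (antisymGen k)) ∨
        P.Isomorphic (FreeOperad (symGen k)) ∨
        P.Isomorphic (FreeOperad (nosymGen k)) ∨
        P.Isomorphic (LieOperad k) ∨
        P.Isomorphic (LieAdmOperad k))) ∧
    (FreeOperad.standard (antisymGen k) 3 (fun _ => 1) =
        Submodule.span k {(FreeOperad (antisymGen k)).jacobiator (antisymOp k)} ∧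
      (FreeOperad (antisymGen k)).jacobiator (antisymOp k) ≠ 0) ∧
    FreeOperad.standard (symGen k) 3 (fun _ => 1) = ⊥ ∧
    (FreeOperad.standard (nosymGen k) 3 (fun _ => 1) =
        Submodule.span k {(FreeOperad (nosymGen k)).lieAdmissibility (nosymOp k)} ∧
      (FreeOperad (nosymGen k)).lieAdmissibility (nosymOp k) ≠ 0) := by
  refine ⟨fun P => ⟨LinOperad.IsTightQuadraticOneBinary.isomorphic,
    isTightQuadraticOneBinary_of_isomorphic_standard⟩, ⟨?_, jacobiator_antisymOp_ne_zero⟩,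
    standard_symGen_eq_bot, ?_, lieAdmissibility_nosymOp_ne_zero⟩
  · exact le_antisymm standard_antisymGen_le
      ((Submodule.span_singleton_le_iff_mem _ _).2 jacobiator_antisymOp_mem_standard)
  · exact le_antisymm standard_nosymGen_le
      ((Submodule.span_singleton_le_iff_mem _ _).2 lieAdmissibility_nosymOp_mem_standard)
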